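/- Let $G$ be a finite group and $A\trianglelefteq G$ a normal subgroup. Let $\mathrm{Irr}(A)$ be the set of isomorphism classes of finite-dimensional complex irreducible representations of $A$, with the $G$-action induced by $(g\cdot\rho)(a)=\rho(g^{-1}ag)$, and let $G_{[\tau]}$ denote the isotropy group of $[\tau]\in\mathrm{Irr}(A)$; it contains $A$. Choose a representative $\tau\colon A\to GL(V_\tau)$ in every orbit of $G\backslash\mathrm{Irr}(A)$. All spaces $X$ below are compact Hausdorff $G$-spaces on which $A$ acts trivially. For a $G$-vector bundle $E\to X$ (complex, of finite rank) the group $A$ acts linearly on each fibre. The bundle $V_\tau\otimes\mathrm{Hom}_A(V_\tau,E)$ is a $G_{[\tau]}$-vector bundle with action $h\star(v\otimes f)=M_hv\otimes (h\circ f\circ M_h^{-1})$, where $M_h\in GL(V_\tau)$ is any operator with $\tau(h^{-1}ah)=M_h^{-1}\tau(a)M_h$ for all $a\in A$ (the action does not depend on its choice). A $G_{[\tau]}$-vector bundle $F\to X$ is called $(G_{[\tau]},\tau)$-equivariant if the evaluation map $V_\tau\otimes\mathrm{Hom}_A(V_\tau,F)\to F$, $v\otimes f\mapsto f(v)$, is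 an isomorphism of vector bundles. Let $K^0_G(X)$, respectively $K^0_{G_{[\tau]},\tau}(X)$, be the Grothendieck group of the monoid of isomorphism classes of $G$-vector bundles, respectively of $(G_{[\tau]},\tau)$-equivariant vector bundles, over $X$ under direct sum. For $n>0$ let $K^n_G(X)$ and $K^n_{G_{[\tau]},\tau}(X)$ be the corresponding reduced groups of $\Sigma^nX_+$, that is, the kernels of restriction of $K^0(\Sigma^nX_+)$ to the base point. Then: 1. For every $X$ and every $n\ge 0$ the assignment $E\mapsto\bigoplus_{[\tau]}V_\tau\otimes\mathrm{Hom}_A(V_\tau,E)$ induces an isomorphism of abelian groups $$\Psi_X\colon K^n_G(X)\;\xrightarrow{\ \cong\ }\bigoplus_{[\tau]\in G\backslash\mathrm{Irr}(A)}K^n_{G_{[\tau]},\tau}(X),$$ and $\Psi$ is natural with respect to continuous $G$-equivariant maps between such spaces. 2. For every $G$-vector bundle $E\to X$, evaluation gives an isomorphism $\bigoplus_{[\sigma]\in\mathrm{Irr}(A)}V_\sigma\otimes\mathrm{Hom}_A(V_\sigma,E)\to E$ on every fibre. For each $G$-orbit $O\subseteq\mathrm{Irr}(A)$ the sum $E_O\subseteq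 E$ of the images of the pieces with $[\sigma]\in O$ is a $G$-invariant subbundle, and $E=\bigoplus_OE_O$ as $G$-vector bundles. 3. The inverse of $\Psi_X$ is given on the summand of $[\tau]$ by the map that induction from $G_{[\tau]}$ to $G$ induces on $K^n$: it sends $F$ to $\bigoplus_j(g_j^{-1})^*F$, where $g_1,\dots,g_r$ are representatives of the cosets in $G/G_{[\tau]}$; an element $g\in G$ maps the $j$-th summand to the $l$-th, by the action of $h$ on $F$, where $gg_j=g_lh$ with $h\in G_{[\tau]}$. -/

import Mathlib

universe u u' v w

namespace EqK

open TensorProduct Topology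

/-- The disjoint union of a family of fibres, without a preferred topology. -/
structure Tot {X : Type u} (F : X → Type v) : Type (max u v) where
  base : X
  vec : F base

/-- `F` is trivial over `U` with fibre `W`: linear maps `φ x : F x → W` and `ψ x : W → F x`,
mutually inverse for `x ∈ U`, such that `(x, v) ↦ φ x v` is continuous on the part of the total
space over `U` and `(x, w) ↦ (x, ψ x w)` is continuous on `U × W`. -/
def IsTrivialOn {X : Type u} [TopologicalSpace X] (F : X → Type v)
    [∀ x, AddCommGroup (F x)] [∀ x, Module ℂ (F x)] [TopologicalSpace (Tot F)] (U : Set X)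
    (W : Type w) [AddCommGroup W] [Module ℂ W] [TopologicalSpace W] : Prop :=
  ∃ (φ : ∀ x, F x →ₗ[ℂ] W) (ψ : ∀ x, W →ₗ[ℂ] F x),
    (∀ x ∈ U, ∀ v, ψ x (φ x v) = v) ∧ (∀ x ∈ U, ∀ w, φ x (ψ x w) = w) ∧
    ContinuousOn (fun p : Tot F => φ p.base p.vec) (Tot.base ⁻¹' U) ∧
    ContinuousOn (fun q : X × W => (⟨q.1, ψ q.1 q.2⟩ : Tot F)) (U ×ˢ Set.univ)

/-- A complex vector bundle of finite rank (the rank is locally constant) over a space `X`. -/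
structure VB (X : Type u) [TopologicalSpace X] : Type (max u (v + 1)) where
  fiber : X → Type v
  [acg : ∀ x, AddCommGroup (fiber x)]
  [mod : ∀ x, Module ℂ (fiber x)]
  [top : TopologicalSpace (Tot fiber)]
  continuous_base : Continuous (Tot.base : Tot fiber → X)
  locTriv : ∀ x : X, ∃ U : Set X, IsOpen U ∧ x ∈ U ∧ ∃ n : ℕ, IsTrivialOn fiber U (Fin n → ℂ)

attribute [instance] VB.acg VB.mod VB.top

theorem IsTrivialOn.change {X : Type u} [TopologicalSpace X] {F : X → Type v}
    [∀ x, AddCommGroup (F x)] [∀ x, Module ℂ (F x)] [TopologicalSpace (Tot F)] {U : Set X}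
    {W : Type w} [NormedAddCommGroup W] [NormedSpace ℂ W] [FiniteDimensional ℂ W]
    (h : IsTrivialOn F U W) : ∃ n : ℕ, IsTrivialOn F U (Fin n → ℂ) := by
  obtain ⟨φ, ψ, h1, h2, h3, h4⟩ := h
  let e : W ≃ₗ[ℂ] (Fin (Module.finrank ℂ W) → ℂ) := (Module.finBasis ℂ W).equivFun
  have ce : Continuous e := LinearMap.continuous_of_finiteDimensional e.toLinearMap
  have ce' : Continuous e.symm := LinearMap.continuous_of_finiteDimensional e.symm.toLinearMap
  refine ⟨_, fun x => e.toLinearMap ∘ₗ φ x, fun x => ψ x ∘ₗ e.symm.toLinearMap, ?_, ?_, ?_, ?_⟩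
  · intro x hx v; simp [h1 x hx]
  · intro x hx v; simp [h2 x hx]
  · exact ce.comp_continuousOn h3
  · exact h4.comp (f := fun q : X × _ => (q.1, e.symm q.2))
      (continuous_fst.prodMk (ce'.comp continuous_snd)).continuousOn (fun q hq => ⟨hq.1, trivial⟩)

namespace Tot

variable {X : Type u} {F : X → Type v}

theorem mk_inj {x : X} {v v' : F x} (h : (⟨x, v⟩ : Tot F) = ⟨x, v'⟩) : v = v' := by
  cases h; rfl

end Tot

namespace VB

variable {X : Type u} {Y : Type u'} [TopologicalSpace X] [TopologicalSpace Y]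

/-- Transport of fibres along an equality of base points. -/
def cast (E : VB.{u, v} X) {x y : X} (h : x = y) : E.fiber x ≃ₗ[ℂ] E.fiber y :=
  h ▸ LinearEquiv.refl ℂ (E.fiber x)

@[simp] theorem cast_rfl (E : VB.{u, v} X) {x : X} (h : x = x) (v : E.fiber x) : E.cast h v = v := rfl

theorem mk_cast (E : VB.{u, v} X) {x y : X} (h : x = y) (v : E.fiber x) :
    (⟨y, E.cast h v⟩ : Tot E.fiber) = ⟨x, v⟩ := by subst h; rfl

theorem mk_cast_symm (E : VB.{u, v} X) {x y : X} (h : x = y) (v : E.fiber y) :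
    (⟨x, (E.cast h).symm v⟩ : Tot E.fiber) = ⟨y, v⟩ := by subst h; rfl

/-- The pullback `f^* E`, a subspace of `Y × E`. -/
def pullback (E : VB.{u, v} X) (f : Y → X) (hf : Continuous f) : VB.{u', v} Y :=
  letI top : TopologicalSpace (Tot fun y => E.fiber (f y)) :=
    TopologicalSpace.induced
      (fun p => ((p.base, ⟨f p.base, p.vec⟩) : Y × Tot E.fiber)) inferInstance
  have hj : IsInducing fun p : Tot fun y => E.fiber (f y) =>
      ((p.base, ⟨f p.base, p.vec⟩) : Y × Tot E.fiber) := ⟨rfl⟩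
  { fiber := fun y => E.fiber (f y)
    top := top
    continuous_base := continuous_fst.comp hj.continuous
    locTriv := by
      intro y
      obtain ⟨U, hU, hy, n, φ, ψ, h1, h2, h3, h4⟩ := E.locTriv (f y)
      refine ⟨f ⁻¹' U, hU.preimage hf, hy, n, fun y => φ (f y), fun y => ψ (f y),
        fun y hy => h1 _ hy, fun y hy => h2 _ hy, ?_, ?_⟩
      · exact h3.comp (continuous_snd.comp hj.continuous).continuousOn (fun p hp => hp)
      · rw [hj.continuousOn_iff]
        refine continuous_fst.continuousOn.prodMk ?_
        exact h4.comp (f := fun q : Y × (Fin n → ℂ) => (f q.1, q.2))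
          ((hf.comp continuous_fst).prodMk continuous_snd).continuousOn
          (fun q hq => ⟨hq.1, trivial⟩) }

/-- The direct sum `E ⊕ F`, a subspace of `E × F`. -/
def prod (E F : VB.{u, v} X) : VB.{u, v} X :=
  letI top : TopologicalSpace (Tot fun x => E.fiber x × F.fiber x) :=
    TopologicalSpace.induced
      (fun p => ((⟨p.base, p.vec.1⟩, ⟨p.base, p.vec.2⟩) : Tot E.fiber × Tot F.fiber)) inferInstance
  have hj : IsInducing fun p : Tot fun x => E.fiber x × F.fiber x =>
      ((⟨p.base, p.vec.1⟩, ⟨p.base, p.vec.2⟩) : Tot E.fiber × Tot F.fiber) := ⟨rfl⟩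
  { fiber := fun x => E.fiber x × F.fiber x
    top := top
    continuous_base :=
      E.continuous_base.comp (continuous_fst.comp hj.continuous)
    locTriv := by
      intro x
      obtain ⟨U, hU, hx, n, φ, ψ, h1, h2, h3, h4⟩ := E.locTriv x
      obtain ⟨U', hU', hx', n', φ', ψ', h1', h2', h3', h4'⟩ := F.locTriv x
      refine ⟨U ∩ U', hU.inter hU', ⟨hx, hx'⟩,
        IsTrivialOn.change (W := (Fin n → ℂ) × (Fin n' → ℂ))
        ⟨fun x => (φ x).prodMap (φ' x), fun x => (ψ x).prodMap (ψ' x), ?_, ?_, ?_, ?_⟩⟩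
      · intro x hx v; simp [h1 x hx.1, h1' x hx.2]
      · intro x hx v; simp [h2 x hx.1, h2' x hx.2]
      · exact (h3.comp (continuous_fst.comp hj.continuous).continuousOn
            (fun p hp => hp.1)).prodMk
          (h3'.comp (continuous_snd.comp hj.continuous).continuousOn (fun p hp => hp.2))
      · rw [hj.continuousOn_iff]
        refine (h4.comp (f := fun q : X × ((Fin n → ℂ) × (Fin n' → ℂ)) => (q.1, q.2.1))
          (by fun_prop) (fun q hq => ⟨hq.1.1, trivial⟩)).prodMk
          (h4'.comp (f := fun q : X × ((Fin n → ℂ) × (Fin n' → ℂ)) => (q.1, q.2.2))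
          (by fun_prop) (fun q hq => ⟨hq.1.2, trivial⟩)) }

/-- The direct sum of a finite family of bundles, a subspace of `X × ∏ᵢ Eᵢ`. -/
def pi {ι : Type v} [Finite ι] (E : ι → VB.{u, v} X) : VB.{u, v} X :=
  letI top : TopologicalSpace (Tot fun x => ∀ k, (E k).fiber x) :=
    TopologicalSpace.induced
      (fun p => ((p.base, fun k => ⟨p.base, p.vec k⟩) : X × ∀ k, Tot (E k).fiber)) inferInstance
  have hj : IsInducing fun p : Tot fun x => ∀ k, (E k).fiber x =>
      ((p.base, fun k => ⟨p.base, p.vec k⟩) : X × ∀ k, Tot (E k).fiber) := ⟨rfl⟩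
  { fiber := fun x => ∀ k, (E k).fiber x
    top := top
    continuous_base := continuous_fst.comp hj.continuous
    locTriv := by
      have := Fintype.ofFinite ι
      intro x
      choose U hU hx n φ ψ h1 h2 h3 h4 using fun k => (E k).locTriv x
      refine ⟨⋂ k, U k, isOpen_iInter_of_finite hU, Set.mem_iInter.2 hx,
        IsTrivialOn.change (W := ∀ k, Fin (n k) → ℂ)
        ⟨fun x => LinearMap.pi fun k => φ k x ∘ₗ LinearMap.proj k,
         fun x => LinearMap.pi fun k => ψ k x ∘ₗ LinearMap.proj k, ?_, ?_, ?_, ?_⟩⟩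
      · intro x hx v; funext k; exact h1 k x (Set.mem_iInter.1 hx k) _
      · intro x hx v; funext k; exact h2 k x (Set.mem_iInter.1 hx k) _
      · refine continuousOn_pi.2 fun k => ?_
        exact (h3 k).comp (((continuous_apply k).comp continuous_snd).comp
          hj.continuous).continuousOn (fun p hp => Set.mem_iInter.1 hp k)
      · rw [hj.continuousOn_iff]
        refine continuous_fst.continuousOn.prodMk (continuousOn_pi.2 fun k => ?_)
        exact (h4 k).comp (f := fun q : X × (∀ k, Fin (n k) → ℂ) => (q.1, q.2 k))
          (by fun_prop) (fun q hq => ⟨Set.mem_iInter.1 hq.1 k, trivial⟩) }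

/-- The zero bundle. -/
def zero (X : Type u) [TopologicalSpace X] : VB.{u, v} X :=
  letI top : TopologicalSpace (Tot fun _ : X => PUnit.{v + 1}) :=
    TopologicalSpace.induced Tot.base inferInstance
  { fiber := fun _ => PUnit.{v + 1}
    top := top
    continuous_base := continuous_induced_dom
    locTriv := by
      intro x
      refine ⟨Set.univ, isOpen_univ, trivial, 0, 0, 0, ?_, ?_, ?_, ?_⟩
      · intro x hx v; rfl
      · intro x hx v; exact Subsingleton.elim _ _
      · exact continuousOn_const
      · exact (Continuous.continuousOn (continuous_induced_rng.2 continuous_fst)) }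

/-- Let `K x ⊆ E x` be a family of subspaces, split by retractions whose associated projector of
`E` is continuous. Then `K`, with the topology induced from `E`, is a vector bundle. -/
def ofSplit (E : VB.{u, v} X) (K : X → Type v) [∀ x, AddCommGroup (K x)] [∀ x, Module ℂ (K x)]
    (i : ∀ x, K x →ₗ[ℂ] E.fiber x) (r : ∀ x, E.fiber x →ₗ[ℂ] K x) (hri : ∀ x k, r x (i x k) = k)
    (hc : Continuous fun p : Tot E.fiber => (⟨p.base, i p.base (r p.base p.vec)⟩ : Tot E.fiber)) :
    VB.{u, v} X :=
  letI top : TopologicalSpace (Tot K) :=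
    TopologicalSpace.induced (fun p => (⟨p.base, i p.base p.vec⟩ : Tot E.fiber)) inferInstance
  have hj : IsInducing fun p : Tot K => (⟨p.base, i p.base p.vec⟩ : Tot E.fiber) := ⟨rfl⟩
  { fiber := K
    top := top
    continuous_base := E.continuous_base.comp hj.continuous
    locTriv := by
      intro x₀
      obtain ⟨U, hU, hx₀, n, φ, ψ, h1, h2, h3, h4⟩ := E.locTriv x₀
      let W := Fin n → ℂ
      let P : X → (W →L[ℂ] W) := fun x =>
        LinearMap.toContinuousLinearMap (φ x ∘ₗ i x ∘ₗ r x ∘ₗ ψ x)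
      have hP : ∀ x w, P x w = φ x (i x (r x (ψ x w))) := fun x w => rfl
      have hPP : ∀ x ∈ U, ∀ w, P x (P x w) = P x w := by
        intro x hx w; simp only [hP, h1 x hx, hri]
      have hpc : ContinuousOn (fun q : X × W => P q.1 q.2) (U ×ˢ Set.univ) :=
        h3.comp (hc.comp_continuousOn h4) (fun q hq => hq.1)
      have hPc : ContinuousOn P U := by
        rw [continuousOn_clm_apply]
        intro w
        exact hpc.comp (f := fun x : X => (x, w)) (by fun_prop) (fun x hx => ⟨hx, trivial⟩)
      let T : X → (W →L[ℂ] W) := fun x => P x * P x₀ + (1 - P x) * (1 - P x₀)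
      have hT : ContinuousOn T U := by
        have := hPc.mul (continuousOn_const (c := P x₀))
        exact this.add ((continuousOn_const.sub hPc).mul continuousOn_const)
      have hPP' : ∀ x ∈ U, P x * P x = P x := fun x hx => by
        ext1 w; exact hPP x hx w
      have hT0 : T x₀ = 1 := by
        have := hPP' x₀ hx₀
        simp only [T, mul_sub, sub_mul, mul_one, one_mul, this]
        abel
      let S : X → (W →L[ℂ] W) := fun x => Ring.inverse (T x)
      let V : Set X := U ∩ T ⁻¹' {t | IsUnit t}
      have hV : IsOpen V := hT.isOpen_inter_preimage hU Units.isOpen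
      have hSc : ContinuousOn S V := by
        intro x hx
        obtain ⟨t, ht⟩ := hx.2
        have hinv : ContinuousAt Ring.inverse (T x) := by
          rw [← ht]; exact NormedRing.inverse_continuousAt t
        exact hinv.comp_continuousWithinAt ((hT x hx.1).mono Set.inter_subset_left)
      have hTS : ∀ x ∈ V, ∀ w, T x (S x w) = w := fun x hx w => by
        have := Ring.mul_inverse_cancel _ hx.2
        exact congrArg (fun L : W →L[ℂ] W => L w) this
      have hST : ∀ x ∈ V, ∀ w, S x (T x w) = w := fun x hx w => by
        have := Ring.inverse_mul_cancel _ hx.2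
        exact congrArg (fun L : W →L[ℂ] W => L w) this
      have hcomm : ∀ x ∈ U, T x * P x₀ = P x * T x := fun x hx => by
        have e0 := hPP' x₀ hx₀
        have e1 := hPP' x hx
        simp only [T, mul_sub, sub_mul, mul_one, one_mul, mul_add, add_mul]
        simp only [mul_assoc, e0]
        simp only [← mul_assoc, e1]
        abel
      have hcomm' : ∀ x ∈ U, ∀ w, T x (P x₀ w) = P x (T x w) := fun x hx w =>
        congrArg (fun L : W →L[ℂ] W => L w) (hcomm x hx)
      let W₀ := LinearMap.range (P x₀).toLinearMap
      let R : W →ₗ[ℂ] W₀ := (P x₀).toLinearMap.rangeRestrict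
      have hRc : Continuous R := LinearMap.continuous_of_finiteDimensional R
      have hR : ∀ w : W, ((R w : W₀) : W) = P x₀ w := fun w => rfl
      refine ⟨V, hV, ⟨hx₀, by simp [hT0]⟩, IsTrivialOn.change (W := W₀)
        ⟨fun x => R ∘ₗ (S x).toLinearMap ∘ₗ φ x ∘ₗ i x,
          fun x => r x ∘ₗ ψ x ∘ₗ (T x).toLinearMap ∘ₗ W₀.subtype, ?_, ?_, ?_, ?_⟩⟩
      · intro x hx k
        change r x (ψ x (T x (P x₀ (S x (φ x (i x k)))))) = k
        rw [hcomm' x hx.1, hTS x hx, hP, h1 x hx.1, h1 x hx.1, hri, hri]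
      · rintro x hx ⟨w, z, hz⟩
        apply Subtype.ext
        change P x₀ (S x (P x (T x w))) = w
        rw [← hcomm' x hx.1, hST x hx, hPP x₀ hx₀, ← hz]
        exact hPP x₀ hx₀ z
      · refine hRc.comp_continuousOn ?_
        have hb : Continuous (Tot.base : Tot K → X) :=
          E.continuous_base.comp hj.continuous
        have a1 : ContinuousOn (fun p : Tot K => S p.base) (Tot.base ⁻¹' V) :=
          hSc.comp hb.continuousOn (fun p hp => hp)
        have a2 : ContinuousOn (fun p : Tot K => φ p.base (i p.base p.vec)) (Tot.base ⁻¹' V) :=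
          h3.comp (f := fun p : Tot K => (⟨p.base, i p.base p.vec⟩ : Tot E.fiber))
            hj.continuous.continuousOn (fun p hp => hp.1)
        exact a1.clm_apply a2
      · rw [hj.continuousOn_iff]
        refine hc.comp_continuousOn (f := fun q : X × W₀ =>
          (⟨q.1, ψ q.1 (T q.1 q.2)⟩ : Tot E.fiber)) ?_
        refine h4.comp (f := fun q : X × W₀ => (q.1, T q.1 q.2)) ?_ (fun q hq => ⟨hq.1.1, trivial⟩)
        refine continuous_fst.continuousOn.prodMk ?_
        exact ((hT.mono Set.inter_subset_left).comp continuous_fst.continuousOn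
          (fun q hq => hq.1)).clm_apply (continuous_subtype_val.comp continuous_snd).continuousOn }

end VB

namespace VB

variable {X : Type u} {Y : Type u'} [TopologicalSpace X] [TopologicalSpace Y]

theorem pullback_isInducing (E : VB.{u, v} X) (f : Y → X) (hf : Continuous f) :
    IsInducing fun p : Tot (E.pullback f hf).fiber =>
      ((p.base, ⟨f p.base, p.vec⟩) : Y × Tot E.fiber) := ⟨rfl⟩

theorem prod_isInducing (E F : VB.{u, v} X) :
    IsInducing fun p : Tot (E.prod F).fiber =>
      ((⟨p.base, p.vec.1⟩, ⟨p.base, p.vec.2⟩) : Tot E.fiber × Tot F.fiber) := ⟨rfl⟩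

theorem pi_isInducing {ι : Type v} [Finite ι] (E : ι → VB.{u, v} X) :
    IsInducing fun p : Tot (VB.pi E).fiber =>
      ((p.base, fun k => ⟨p.base, p.vec k⟩) : X × ∀ k, Tot (E k).fiber) := ⟨rfl⟩

theorem pullback_ext {E : VB.{u, v} X} {f : Y → X} {hf : Continuous f}
    {p q : Tot (E.pullback f hf).fiber} (h : p.base = q.base)
    (h' : (⟨f p.base, p.vec⟩ : Tot E.fiber) = ⟨f q.base, q.vec⟩) : p = q := by
  obtain ⟨x, v⟩ := p; obtain ⟨y, w⟩ := q
  obtain rfl : x = y := h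
  have := Tot.mk_inj h'
  exact congrArg _ this

theorem prod_ext {E F : VB.{u, v} X} {p q : Tot (E.prod F).fiber}
    (h : (⟨p.base, p.vec.1⟩ : Tot E.fiber) = ⟨q.base, q.vec.1⟩)
    (h' : (⟨p.base, p.vec.2⟩ : Tot F.fiber) = ⟨q.base, q.vec.2⟩) : p = q := by
  obtain ⟨x, v⟩ := p; obtain ⟨y, w⟩ := q
  obtain rfl : x = y := congrArg Tot.base h
  have h1 := Tot.mk_inj h
  have h2 := Tot.mk_inj h'
  exact congrArg _ (Prod.ext h1 h2)

theorem pi_ext {ι : Type v} [Finite ι] {E : ι → VB.{u, v} X} {p q : Tot (VB.pi E).fiber}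
    (hb : p.base = q.base)
    (h : ∀ k, (⟨p.base, p.vec k⟩ : Tot (E k).fiber) = ⟨q.base, q.vec k⟩) : p = q := by
  obtain ⟨x, v⟩ := p; obtain ⟨y, w⟩ := q
  obtain rfl : x = y := hb
  exact congrArg _ (funext fun k => Tot.mk_inj (h k))

/-- Addition of two continuous maps into `E` over the same map into the base is continuous. -/
theorem continuous_add (E : VB.{u, v} X) {Z : Type w} [TopologicalSpace Z] {b : Z → X}
    {s t : ∀ z, E.fiber (b z)} (hs : Continuous fun z => (⟨b z, s z⟩ : Tot E.fiber))
    (ht : Continuous fun z => (⟨b z, t z⟩ : Tot E.fiber)) :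
    Continuous fun z => (⟨b z, s z + t z⟩ : Tot E.fiber) := by
  have hb : Continuous b := E.continuous_base.comp hs
  rw [continuous_iff_continuousAt]
  intro z
  obtain ⟨U, hU, hz, n, φ, ψ, h1, h2, h3, h4⟩ := E.locTriv (b z)
  have hV : IsOpen (b ⁻¹' U) := hU.preimage hb
  have c1 : ContinuousOn (fun z => φ (b z) (s z)) (b ⁻¹' U) :=
    h3.comp hs.continuousOn (fun z hz => hz)
  have c2 : ContinuousOn (fun z => φ (b z) (t z)) (b ⁻¹' U) :=
    h3.comp ht.continuousOn (fun z hz => hz)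
  have c3 : ContinuousOn (fun z => (⟨b z, ψ (b z) (φ (b z) (s z) + φ (b z) (t z))⟩ : Tot E.fiber))
      (b ⁻¹' U) :=
    h4.comp (f := fun z => (b z, φ (b z) (s z) + φ (b z) (t z)))
      (hb.continuousOn.prodMk (c1.add c2)) (fun z hz => ⟨hz, trivial⟩)
  have c4 := c3.continuousAt (hV.mem_nhds hz)
  refine c4.congr ?_
  filter_upwards [hV.mem_nhds hz] with z hz
  rw [← map_add, h1 _ hz]

theorem continuous_smul (E : VB.{u, v} X) {Z : Type w} [TopologicalSpace Z] {b : Z → X}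
    {s : ∀ z, E.fiber (b z)} (hs : Continuous fun z => (⟨b z, s z⟩ : Tot E.fiber)) (c : ℂ) :
    Continuous fun z => (⟨b z, c • s z⟩ : Tot E.fiber) := by
  have hb : Continuous b := E.continuous_base.comp hs
  rw [continuous_iff_continuousAt]
  intro z
  obtain ⟨U, hU, hz, n, φ, ψ, h1, h2, h3, h4⟩ := E.locTriv (b z)
  have hV : IsOpen (b ⁻¹' U) := hU.preimage hb
  have c1 : ContinuousOn (fun z => φ (b z) (s z)) (b ⁻¹' U) :=
    h3.comp hs.continuousOn (fun z hz => hz)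
  have c3 : ContinuousOn (fun z => (⟨b z, ψ (b z) (c • φ (b z) (s z))⟩ : Tot E.fiber))
      (b ⁻¹' U) :=
    h4.comp (f := fun z => (b z, c • φ (b z) (s z)))
      (hb.continuousOn.prodMk (c1.const_smul c)) (fun z hz => ⟨hz, trivial⟩)
  have c4 := c3.continuousAt (hV.mem_nhds hz)
  refine c4.congr ?_
  filter_upwards [hV.mem_nhds hz] with z hz
  rw [← map_smul, h1 _ hz]

theorem continuous_zero (E : VB.{u, v} X) {Z : Type w} [TopologicalSpace Z] {b : Z → X}
    (hb : Continuous b) : Continuous fun z => (⟨b z, 0⟩ : Tot E.fiber) := by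
  rw [continuous_iff_continuousAt]
  intro z
  obtain ⟨U, hU, hz, n, φ, ψ, h1, h2, h3, h4⟩ := E.locTriv (b z)
  have hV : IsOpen (b ⁻¹' U) := hU.preimage hb
  have c3 : ContinuousOn (fun z => (⟨b z, ψ (b z) 0⟩ : Tot E.fiber)) (b ⁻¹' U) :=
    h4.comp (f := fun z => (b z, 0)) (hb.continuousOn.prodMk continuousOn_const)
      (fun z hz => ⟨hz, trivial⟩)
  simpa using c3.continuousAt (hV.mem_nhds hz)

theorem continuous_sum (E : VB.{u, v} X) {Z : Type w} [TopologicalSpace Z] {b : Z → X}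
    (hb : Continuous b) {κ : Type*} (S : Finset κ) {s : κ → ∀ z, E.fiber (b z)}
    (hs : ∀ k ∈ S, Continuous fun z => (⟨b z, s k z⟩ : Tot E.fiber)) :
    Continuous fun z => (⟨b z, ∑ k ∈ S, s k z⟩ : Tot E.fiber) := by
  classical
  induction S using Finset.induction_on with
  | empty => simpa using E.continuous_zero hb
  | insert a S ha ih =>
    simp only [Finset.sum_insert ha]
    exact E.continuous_add (hs a (Finset.mem_insert_self a S))
      (ih fun k hk => hs k (Finset.mem_insert_of_mem hk))

end VB

/-- A continuous equivariant map of `G`-spaces. -/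
structure GMap (G : Type w) [Group G] (Y : Type u') (X : Type u) [TopologicalSpace Y]
    [TopologicalSpace X] [MulAction G Y] [MulAction G X] where
  toFun : Y → X
  continuous_toFun : Continuous toFun
  map_smul : ∀ (g : G) (y : Y), toFun (g • y) = g • toFun y

/-- A `G`-equivariant complex vector bundle over the `G`-space `X`, for a discrete group `G`:
the elements of `G` act on the total space by homeomorphisms covering the action on `X`,
linearly on the fibres. -/
structure GVect (G : Type w) [Group G] (X : Type u) [TopologicalSpace X] [MulAction G X]
    extends VB.{u, v} X where
  act : ∀ (g : G) (x : X), fiber x →ₗ[ℂ] fiber (g • x)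
  act_one : ∀ (x : X) (v : fiber x), (⟨(1 : G) • x, act 1 x v⟩ : Tot fiber) = ⟨x, v⟩
  act_mul : ∀ (g h : G) (x : X) (v : fiber x), (⟨(g * h) • x, act (g * h) x v⟩ : Tot fiber) =
    ⟨g • h • x, act g (h • x) (act h x v)⟩
  continuous_act : ∀ g : G,
    Continuous fun p : Tot fiber => (⟨g • p.base, act g p.base p.vec⟩ : Tot fiber)

namespace GVect

variable {G : Type w} [Group G] {X : Type u} {Y : Type u'} [TopologicalSpace X]
  [TopologicalSpace Y] [MulAction G X] [MulAction G Y]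

/-- The action on the total space. -/
def tact (E : GVect.{u, v} G X) (g : G) (p : Tot E.fiber) : Tot E.fiber :=
  ⟨g • p.base, E.act g p.base p.vec⟩

theorem tact_mk (E : GVect.{u, v} G X) (g : G) (x : X) (v : E.fiber x) :
    E.tact g ⟨x, v⟩ = ⟨g • x, E.act g x v⟩ := rfl

theorem tact_one (E : GVect.{u, v} G X) (p : Tot E.fiber) : E.tact 1 p = p := E.act_one _ _

theorem tact_mul (E : GVect.{u, v} G X) (g h : G) (p : Tot E.fiber) :
    E.tact (g * h) p = E.tact g (E.tact h p) := E.act_mul _ _ _ _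

theorem continuous_tact (E : GVect.{u, v} G X) (g : G) : Continuous (E.tact g) :=
  E.continuous_act g

/-- Homomorphisms of `G`-vector bundles over the identity of the base. -/
structure Hom (E F : GVect.{u, v} G X) where
  toFun : ∀ x, E.fiber x →ₗ[ℂ] F.fiber x
  continuous_toFun :
    Continuous fun p : Tot E.fiber => (⟨p.base, toFun p.base p.vec⟩ : Tot F.fiber)
  map_act : ∀ g x v, toFun (g • x) (E.act g x v) = F.act g x (toFun x v)

/-- Isomorphisms of `G`-vector bundles over the identity of the base. -/
structure Iso (E F : GVect.{u, v} G X) where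
  toEquiv : ∀ x, E.fiber x ≃ₗ[ℂ] F.fiber x
  continuous_toFun :
    Continuous fun p : Tot E.fiber => (⟨p.base, toEquiv p.base p.vec⟩ : Tot F.fiber)
  continuous_invFun :
    Continuous fun p : Tot F.fiber => (⟨p.base, (toEquiv p.base).symm p.vec⟩ : Tot E.fiber)
  map_act : ∀ g x v, toEquiv (g • x) (E.act g x v) = F.act g x (toEquiv x v)

namespace Iso

variable {E F D : GVect.{u, v} G X}

def refl (E : GVect.{u, v} G X) : Iso E E :=
  ⟨fun _ => LinearEquiv.refl ℂ _, continuous_id, continuous_id, fun _ _ _ => rfl⟩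

def symm (e : Iso E F) : Iso F E :=
  ⟨fun x => (e.toEquiv x).symm, e.continuous_invFun, e.continuous_toFun, fun g x v => by
    rw [LinearEquiv.symm_apply_eq, e.map_act, LinearEquiv.apply_symm_apply]⟩

def trans (e : Iso E F) (f : Iso F D) : Iso E D :=
  ⟨fun x => (e.toEquiv x).trans (f.toEquiv x), f.continuous_toFun.comp e.continuous_toFun,
    e.continuous_invFun.comp f.continuous_invFun, fun g x v => by
    simp only [LinearEquiv.trans_apply, e.map_act, f.map_act]⟩

theorem apply_cast (e : Iso E F) {x y : X} (h : x = y) (v : E.fiber x) :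
    e.toEquiv y (E.cast h v) = F.cast h (e.toEquiv x v) := by subst h; rfl

end Iso

/-- The zero bundle. -/
def zero (G : Type w) [Group G] (X : Type u) [TopologicalSpace X] [MulAction G X]
    [ContinuousConstSMul G X] : GVect.{u, v} G X where
  toVB := VB.zero X
  act _ _ := LinearMap.id
  act_one x v := by
    change (⟨_, _⟩ : Tot fun _ : X => PUnit.{v + 1}) = ⟨_, _⟩
    rw [one_smul]; rfl
  act_mul g h x v := by
    change (⟨_, _⟩ : Tot fun _ : X => PUnit.{v + 1}) = ⟨_, _⟩
    rw [mul_smul]; rfl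
  continuous_act g := continuous_induced_rng.2
    ((continuous_const_smul g).comp (VB.zero X).continuous_base)

/-- The direct sum of two `G`-vector bundles. -/
def sum (E F : GVect.{u, v} G X) : GVect.{u, v} G X where
  toVB := E.toVB.prod F.toVB
  act g x := (E.act g x).prodMap (F.act g x)
  act_one x v := VB.prod_ext (E.act_one x v.1) (F.act_one x v.2)
  act_mul g h x v := VB.prod_ext (E.act_mul g h x v.1) (F.act_mul g h x v.2)
  continuous_act g := by
    have hj := VB.prod_isInducing E.toVB F.toVB
    refine hj.continuous_iff.2 ?_
    exact ((E.continuous_act g).comp (continuous_fst.comp hj.continuous)).prodMk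
      ((F.continuous_act g).comp (continuous_snd.comp hj.continuous))

/-- The pullback of a `G`-vector bundle along a `G`-map. -/
def pullback (E : GVect.{u, v} G X) (f : GMap G Y X) [ContinuousConstSMul G Y] :
    GVect.{u', v} G Y where
  toVB := E.toVB.pullback f.toFun f.continuous_toFun
  act g y := (E.cast (f.map_smul g y).symm).toLinearMap ∘ₗ E.act g (f.toFun y)
  act_one y v := VB.pullback_ext (one_smul G y) ((E.mk_cast _ _).trans (E.act_one _ v))
  act_mul g h y v := by
    refine VB.pullback_ext (mul_smul g h y) ?_
    refine (E.mk_cast _ _).trans ((E.act_mul g h _ v).trans ?_)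
    refine Eq.trans ?_ (E.mk_cast _ _).symm
    change E.tact g ⟨_, _⟩ = E.tact g ⟨_, _⟩
    exact congrArg _ (E.mk_cast _ _).symm
  continuous_act g := by
    have hj := VB.pullback_isInducing E.toVB f.toFun f.continuous_toFun
    refine hj.continuous_iff.2 ?_
    refine ((continuous_const_smul g).comp (continuous_fst.comp hj.continuous)).prodMk ?_
    refine ((E.continuous_act g).comp (continuous_snd.comp hj.continuous)).congr fun p => ?_
    exact (E.mk_cast _ _).symm

instance setoid (G : Type w) [Group G] (X : Type u) [TopologicalSpace X] [MulAction G X] :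
    Setoid (GVect.{u, v} G X) where
  r E F := Nonempty (Iso E F)
  iseqv := ⟨fun E => ⟨Iso.refl E⟩, fun ⟨e⟩ => ⟨e.symm⟩, fun ⟨e⟩ ⟨f⟩ => ⟨e.trans f⟩⟩

def sumCongr {E E' F F' : GVect.{u, v} G X} (e : Iso E E') (f : Iso F F') :
    Iso (E.sum F) (E'.sum F') where
  toEquiv x := (e.toEquiv x).prodCongr (f.toEquiv x)
  continuous_toFun := by
    have hj := VB.prod_isInducing E.toVB F.toVB
    refine (VB.prod_isInducing E'.toVB F'.toVB).continuous_iff.2 ?_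
    exact (e.continuous_toFun.comp (continuous_fst.comp hj.continuous)).prodMk
      (f.continuous_toFun.comp (continuous_snd.comp hj.continuous))
  continuous_invFun := by
    have hj := VB.prod_isInducing E'.toVB F'.toVB
    refine (VB.prod_isInducing E.toVB F.toVB).continuous_iff.2 ?_
    exact (e.continuous_invFun.comp (continuous_fst.comp hj.continuous)).prodMk
      (f.continuous_invFun.comp (continuous_snd.comp hj.continuous))
  map_act g x v := Prod.ext (e.map_act g x v.1) (f.map_act g x v.2)

def sumComm (E F : GVect.{u, v} G X) : Iso (E.sum F) (F.sum E) where
  toEquiv x := LinearEquiv.prodComm ℂ (E.fiber x) (F.fiber x)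
  continuous_toFun := by
    have hj := VB.prod_isInducing E.toVB F.toVB
    refine (VB.prod_isInducing F.toVB E.toVB).continuous_iff.2 ?_
    exact (continuous_snd.comp hj.continuous).prodMk (continuous_fst.comp hj.continuous)
  continuous_invFun := by
    have hj := VB.prod_isInducing F.toVB E.toVB
    refine (VB.prod_isInducing E.toVB F.toVB).continuous_iff.2 ?_
    exact (continuous_snd.comp hj.continuous).prodMk (continuous_fst.comp hj.continuous)
  map_act g x v := rfl

def sumAssoc (E F D : GVect.{u, v} G X) : Iso ((E.sum F).sum D) (E.sum (F.sum D)) where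
  toEquiv x := LinearEquiv.prodAssoc ℂ (E.fiber x) (F.fiber x) (D.fiber x)
  continuous_toFun := by
    have h1 := (VB.prod_isInducing E.toVB F.toVB).continuous
    have h2 := (VB.prod_isInducing (E.sum F).toVB D.toVB).continuous
    refine (VB.prod_isInducing E.toVB (F.sum D).toVB).continuous_iff.2 ?_
    refine (continuous_fst.comp (h1.comp (continuous_fst.comp h2))).prodMk ?_
    refine (VB.prod_isInducing F.toVB D.toVB).continuous_iff.2 ?_
    exact (continuous_snd.comp (h1.comp (continuous_fst.comp h2))).prodMk (continuous_snd.comp h2)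
  continuous_invFun := by
    have h1 := (VB.prod_isInducing F.toVB D.toVB).continuous
    have h2 := (VB.prod_isInducing E.toVB (F.sum D).toVB).continuous
    refine (VB.prod_isInducing (E.sum F).toVB D.toVB).continuous_iff.2 ?_
    refine Continuous.prodMk ?_ (continuous_snd.comp (h1.comp (continuous_snd.comp h2)))
    refine (VB.prod_isInducing E.toVB F.toVB).continuous_iff.2 ?_
    exact (continuous_fst.comp h2).prodMk (continuous_fst.comp (h1.comp (continuous_snd.comp h2)))
  map_act g x v := rfl

def sumZero [ContinuousConstSMul G X] (E : GVect.{u, v} G X) : Iso (E.sum (zero G X)) E where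
  toEquiv x := LinearEquiv.prodUnique (R := ℂ) (M := E.fiber x) (M₂ := PUnit.{v + 1})
  continuous_toFun := continuous_fst.comp (VB.prod_isInducing E.toVB (zero G X).toVB).continuous
  continuous_invFun := by
    refine (VB.prod_isInducing E.toVB (zero G X).toVB).continuous_iff.2 ?_
    exact continuous_id.prodMk (continuous_induced_rng.2 E.continuous_base)
  map_act g x v := rfl

def pullbackCongr {E E' : GVect.{u, v} G X} (e : Iso E E') (f : GMap G Y X)
    [ContinuousConstSMul G Y] : Iso (E.pullback f) (E'.pullback f) where
  toEquiv y := e.toEquiv (f.toFun y)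
  continuous_toFun := by
    have hj := VB.pullback_isInducing E.toVB f.toFun f.continuous_toFun
    refine (VB.pullback_isInducing E'.toVB f.toFun f.continuous_toFun).continuous_iff.2 ?_
    exact (continuous_fst.comp hj.continuous).prodMk
      (e.continuous_toFun.comp (continuous_snd.comp hj.continuous))
  continuous_invFun := by
    have hj := VB.pullback_isInducing E'.toVB f.toFun f.continuous_toFun
    refine (VB.pullback_isInducing E.toVB f.toFun f.continuous_toFun).continuous_iff.2 ?_
    exact (continuous_fst.comp hj.continuous).prodMk
      (e.continuous_invFun.comp (continuous_snd.comp hj.continuous))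
  map_act g y v := by
    exact (e.apply_cast _ _).trans (congrArg _ (e.map_act g _ v))

theorem cast_prod {E F : VB.{u, v} X} {x y : X} (h : x = y) (v : E.fiber x × F.fiber x) :
    (E.prod F).cast h v = (E.cast h v.1, F.cast h v.2) := by subst h; rfl

def pullbackSum (E F : GVect.{u, v} G X) (f : GMap G Y X) [ContinuousConstSMul G Y] :
    Iso ((E.sum F).pullback f) ((E.pullback f).sum (F.pullback f)) where
  toEquiv y := LinearEquiv.refl ℂ (E.fiber (f.toFun y) × F.fiber (f.toFun y))
  continuous_toFun := by
    have h1 := (VB.pullback_isInducing (E.sum F).toVB f.toFun f.continuous_toFun).continuous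
    have h2 := (VB.prod_isInducing E.toVB F.toVB).continuous.comp (continuous_snd.comp h1)
    refine (VB.prod_isInducing (E.pullback f).toVB (F.pullback f).toVB).continuous_iff.2 ?_
    refine Continuous.prodMk ?_ ?_
    · refine (VB.pullback_isInducing E.toVB f.toFun f.continuous_toFun).continuous_iff.2 ?_
      exact (continuous_fst.comp h1).prodMk (continuous_fst.comp h2)
    · refine (VB.pullback_isInducing F.toVB f.toFun f.continuous_toFun).continuous_iff.2 ?_
      exact (continuous_fst.comp h1).prodMk (continuous_snd.comp h2)
  continuous_invFun := by
    have h := (VB.prod_isInducing (E.pullback f).toVB (F.pullback f).toVB).continuous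
    have h1 := (VB.pullback_isInducing E.toVB f.toFun f.continuous_toFun).continuous.comp
      (continuous_fst.comp h)
    have h2 := (VB.pullback_isInducing F.toVB f.toFun f.continuous_toFun).continuous.comp
      (continuous_snd.comp h)
    refine (VB.pullback_isInducing (E.sum F).toVB f.toFun f.continuous_toFun).continuous_iff.2 ?_
    refine (continuous_fst.comp h1).prodMk ?_
    refine (VB.prod_isInducing E.toVB F.toVB).continuous_iff.2 ?_
    exact (continuous_snd.comp h1).prodMk (continuous_snd.comp h2)
  map_act g y v := cast_prod (f.map_smul g y).symm _

def pullbackZero (G : Type w) [Group G] [MulAction G X] [MulAction G Y] [ContinuousConstSMul G X]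
    [ContinuousConstSMul G Y] (f : GMap G Y X) :
    Iso ((zero.{u, v} G X).pullback f) (zero G Y) where
  toEquiv y := LinearEquiv.refl ℂ PUnit.{v + 1}
  continuous_toFun := by
    have h1 := (VB.pullback_isInducing (zero.{u, v} G X).toVB f.toFun
      f.continuous_toFun).continuous
    exact continuous_induced_rng.2 (continuous_fst.comp h1)
  continuous_invFun := by
    refine (VB.pullback_isInducing (zero.{u, v} G X).toVB f.toFun f.continuous_toFun).continuous_iff.2 ?_
    exact (VB.zero Y).continuous_base.prodMk
      (continuous_induced_rng.2 (f.continuous_toFun.comp (VB.zero Y).continuous_base))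
  map_act g y v := rfl

end GVect

/-- The monoid `Vec_G(X)` of isomorphism classes of `G`-vector bundles over `X`. -/
def Vec (G : Type w) [Group G] (X : Type u) [TopologicalSpace X] [MulAction G X] :=
  Quotient (GVect.setoid.{u, v} G X)

namespace Vec

variable {G : Type w} [Group G] {X : Type u} {Y : Type u'} [TopologicalSpace X]
  [TopologicalSpace Y] [MulAction G X] [MulAction G Y]

/-- The isomorphism class of a bundle. -/
def mk (E : GVect.{u, v} G X) : Vec.{u, v} G X := Quotient.mk _ E

theorem mk_eq {E F : GVect.{u, v} G X} (e : GVect.Iso E F) : mk E = mk F := Quotient.sound ⟨e⟩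

instance [ContinuousConstSMul G X] : Zero (Vec.{u, v} G X) := ⟨mk (GVect.zero G X)⟩

instance : Add (Vec.{u, v} G X) :=
  ⟨Quotient.map₂ GVect.sum fun _ _ ⟨e⟩ _ _ ⟨f⟩ => ⟨GVect.sumCongr e f⟩⟩

instance [ContinuousConstSMul G X] : AddCommMonoid (Vec.{u, v} G X) where
  add_assoc := by
    rintro ⟨E⟩ ⟨F⟩ ⟨D⟩; exact mk_eq (GVect.sumAssoc E F D)
  add_comm := by
    rintro ⟨E⟩ ⟨F⟩; exact mk_eq (GVect.sumComm E F)
  zero_add := by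
    rintro ⟨E⟩; exact mk_eq ((GVect.sumComm _ _).trans (GVect.sumZero E))
  add_zero := by
    rintro ⟨E⟩; exact mk_eq (GVect.sumZero E)
  nsmul := nsmulRec

theorem mk_add [ContinuousConstSMul G X] (E F : GVect.{u, v} G X) :
    mk E + mk F = mk (E.sum F) := rfl

/-- Pullback of isomorphism classes along a `G`-map. -/
def pullback [ContinuousConstSMul G X] [ContinuousConstSMul G Y] (f : GMap G Y X) :
    Vec.{u, v} G X →+ Vec.{u', v} G Y where
  toFun := Quotient.map (fun E => E.pullback f) fun _ _ ⟨e⟩ => ⟨GVect.pullbackCongr e f⟩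
  map_zero' := mk_eq (GVect.pullbackZero G f)
  map_add' := by rintro ⟨E⟩ ⟨F⟩; exact mk_eq (GVect.pullbackSum E F f)

theorem pullback_mk [ContinuousConstSMul G X] [ContinuousConstSMul G Y] (f : GMap G Y X)
    (E : GVect.{u, v} G X) : pullback f (mk E) = mk (E.pullback f) := rfl

end Vec

/-- The homomorphism of Grothendieck groups induced by a homomorphism of commutative monoids. -/
noncomputable def grothMap {M : Type u} {N : Type u'} [AddCommMonoid M] [AddCommMonoid N]
    (f : M →+ N) : Algebra.GrothendieckAddGroup M →+ Algebra.GrothendieckAddGroup N :=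
  Algebra.GrothendieckAddGroup.lift (Algebra.GrothendieckAddGroup.of.comp f)

theorem grothMap_of {M : Type u} {N : Type u'} [AddCommMonoid M] [AddCommMonoid N]
    (f : M →+ N) (m : M) : grothMap f (Algebra.GrothendieckAddGroup.of m) =
      Algebra.GrothendieckAddGroup.of (f m) := by
  have := Algebra.GrothendieckAddGroup.lift.symm_apply_apply
    ((Algebra.GrothendieckAddGroup.of (M := N)).comp f)
  exact DFunLike.congr_fun this m

theorem groth_ext {M : Type u} {N : Type u'} [AddCommMonoid M] [AddCommGroup N]
    {f g : Algebra.GrothendieckAddGroup M →+ N}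
    (h : ∀ m, f (Algebra.GrothendieckAddGroup.of m) = g (Algebra.GrothendieckAddGroup.of m)) :
    f = g := by
  apply Algebra.GrothendieckAddGroup.lift.symm.injective
  ext m
  exact h m

/-! ### Representations -/

/-- A finite-dimensional complex irreducible representation of `A`. -/
structure IrrRep (A : Type w) [Group A] : Type (max w (v + 1)) where
  V : Type v
  [acg : AddCommGroup V]
  [mod : Module ℂ V]
  [fd : FiniteDimensional ℂ V]
  ρ : Representation ℂ A V
  irr : ρ.IsIrreducible

attribute [instance] IrrRep.acg IrrRep.mod IrrRep.fd IrrRep.irr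

section Rep

variable {A : Type w} [Group A] (τ : IrrRep.{v} A) {W : Type v} [AddCommGroup W] [Module ℂ W]
  (σ : Representation ℂ A W)

/-- The evaluation `V_τ ⊗ Hom_A(V_τ, W) → W`, `v ⊗ f ↦ f v`. -/
noncomputable def evRep : τ.V ⊗[ℂ] (τ.ρ.IntertwiningMap σ) →ₗ[ℂ] W :=
  TensorProduct.lift
    { toFun := fun v =>
        { toFun := fun f => f v
          map_add' := fun _ _ => rfl
          map_smul' := fun _ _ => rfl }
      map_add' := fun v v' => by ext f; exact map_add f v v'
      map_smul' := fun c v => by ext f; exact map_smul f c v }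

@[simp] theorem evRep_tmul (v : τ.V) (f : τ.ρ.IntertwiningMap σ) :
    evRep τ σ (v ⊗ₜ f) = f v := rfl

theorem schur_average [Fintype A] (T : τ.V →ₗ[ℂ] τ.V) :
    (Module.finrank ℂ τ.V : ℂ) • ∑ a, τ.ρ a ∘ₗ T ∘ₗ τ.ρ a⁻¹ =
      ((Fintype.card A : ℂ) * LinearMap.trace ℂ τ.V T) • LinearMap.id := by
  let S : τ.V →ₗ[ℂ] τ.V := ∑ a, τ.ρ a ∘ₗ T ∘ₗ τ.ρ a⁻¹
  have hS : ∀ b, S ∘ₗ τ.ρ b = τ.ρ b ∘ₗ S := by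
    intro b
    ext v
    simp only [S, LinearMap.comp_apply, LinearMap.sum_apply, map_sum]
    refine Fintype.sum_equiv (Equiv.mulLeft b⁻¹) _ _ fun a => ?_
    have h1 : τ.ρ (b⁻¹ * a)⁻¹ v = τ.ρ a⁻¹ (τ.ρ b v) := by
      rw [mul_inv_rev, inv_inv, map_mul, Module.End.mul_apply]
    have h2 : ∀ z, τ.ρ b (τ.ρ (b⁻¹ * a) z) = τ.ρ a z := by
      intro z
      rw [← Module.End.mul_apply, ← map_mul, mul_inv_cancel_left]
    rw [Equiv.coe_mulLeft, h2, h1]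
  let S' : τ.ρ.IntertwiningMap τ.ρ := ⟨S, hS⟩
  obtain ⟨c, hc⟩ :=
    (Representation.IsIrreducible.algebraMap_intertwiningMap_bijective_of_isAlgClosed
      (ρ := τ.ρ)).2 S'
  have hc' : S = c • LinearMap.id := by
    ext v
    have := DFunLike.congr_fun hc v
    exact this.symm
  have ht : LinearMap.trace ℂ τ.V S = (Fintype.card A : ℂ) * LinearMap.trace ℂ τ.V T := by
    simp only [S, map_sum]
    have : ∀ a, LinearMap.trace ℂ τ.V (τ.ρ a ∘ₗ T ∘ₗ τ.ρ a⁻¹) = LinearMap.trace ℂ τ.V T := by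
      intro a
      rw [LinearMap.trace_comp_comm', LinearMap.comp_assoc, ← Module.End.mul_eq_comp (τ.ρ a⁻¹),
        ← map_mul, inv_mul_cancel, map_one]
      rfl
    simp [this]
  have ht' : LinearMap.trace ℂ τ.V S = c * Module.finrank ℂ τ.V := by
    rw [hc', map_smul, LinearMap.trace_id, smul_eq_mul]
  change (Module.finrank ℂ τ.V : ℂ) • S = _
  rw [hc', smul_smul, ← ht, ht', mul_comm]

/-- The map `w ↦ ∑ₐ ξ(τ(a⁻¹) w) • σ(a) e` as an element of `Hom_A(V_τ, W)`. -/
noncomputable def coeffMap [Fintype A] (ξ : Module.Dual ℂ τ.V) :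
    W →ₗ[ℂ] τ.ρ.IntertwiningMap σ where
  toFun e :=
    { toLinearMap := ∑ a, (ξ ∘ₗ τ.ρ a⁻¹).smulRight (σ a e)
      isIntertwining' := by
        intro b
        ext v
        simp only [LinearMap.comp_apply, LinearMap.sum_apply, map_sum, LinearMap.smulRight_apply,
          map_smul]
        refine Fintype.sum_equiv (Equiv.mulLeft b⁻¹) _ _ fun a => ?_
        simp only [Equiv.coe_mulLeft, mul_inv_rev, inv_inv, ← Module.End.mul_apply, ← map_mul,
          mul_inv_cancel_left] }
  map_add' e e' := by
    ext v
    simp [Finset.sum_add_distrib]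
  map_smul' c e := by
    ext v
    simp [Finset.smul_sum, smul_comm c]

theorem coeffMap_apply [Fintype A] (ξ : Module.Dual ℂ τ.V) (e : W) (v : τ.V) :
    coeffMap τ σ ξ e v = ∑ a, ξ (τ.ρ a⁻¹ v) • σ a e := by
  change (∑ a, (ξ ∘ₗ τ.ρ a⁻¹).smulRight (σ a e)) v = _
  simp

theorem exists_retraction [Fintype A] : ∃ c : A → ℂ,
    ∀ {W : Type v} [AddCommGroup W] [Module ℂ W] (σ : Representation ℂ A W),
      ∃ r : W →ₗ[ℂ] τ.V ⊗[ℂ] (τ.ρ.IntertwiningMap σ),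
        (∀ t, r (evRep τ σ t) = t) ∧ ∀ e, evRep τ σ (r e) = ∑ a, c a • σ a e := by
  let b := Module.finBasis ℂ τ.V
  let k : ℂ := (Module.finrank ℂ τ.V : ℂ) / (Fintype.card A : ℂ)
  have hA : (Fintype.card A : ℂ) ≠ 0 := Nat.cast_ne_zero.2 Fintype.card_ne_zero
  refine ⟨fun a => k * ∑ i, b.coord i (τ.ρ a⁻¹ (b i)), fun {W} _ _ σ => ?_⟩
  let r : W →ₗ[ℂ] τ.V ⊗[ℂ] (τ.ρ.IntertwiningMap σ) :=
    k • ∑ i, (TensorProduct.mk ℂ _ _ (b i)) ∘ₗ coeffMap τ σ (b.coord i)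
  have hr : ∀ e, r e = k • ∑ i, b i ⊗ₜ[ℂ] coeffMap τ σ (b.coord i) e := by
    intro e; simp [r]
  refine ⟨r, ?_, ?_⟩
  · intro t
    induction t using TensorProduct.induction_on with
    | zero => simp
    | add x y hx hy => rw [map_add, map_add, hx, hy]
    | tmul v f =>
      have key : ∀ ξ : Module.Dual ℂ τ.V, k • coeffMap τ σ ξ (f v) = ξ v • f := by
        intro ξ
        ext w
        have h1 := LinearMap.congr_fun (schur_average τ (ξ.smulRight v)) w
        have h2 : coeffMap τ σ ξ (f v) w =
            f ((∑ a, τ.ρ a ∘ₗ (ξ.smulRight v) ∘ₗ τ.ρ a⁻¹) w) := by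
          rw [coeffMap_apply]
          simp only [LinearMap.sum_apply, map_sum]
          refine Finset.sum_congr rfl fun a _ => ?_
          simp only [LinearMap.comp_apply, LinearMap.smulRight_apply, map_smul]
          rw [f.isIntertwining]
        have h3 : LinearMap.trace ℂ τ.V (ξ.smulRight v) = ξ v := by
          simp
        have h4 : (k • coeffMap τ σ ξ (f v)) w = k • (coeffMap τ σ ξ (f v) w) := rfl
        have h5 : (ξ v • f) w = ξ v • f w := rfl
        change (k • coeffMap τ σ ξ (f v)) w = (ξ v • f) w
        rw [h4, h5, h2, ← map_smul f, ← map_smul f]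
        congr 1
        rw [h3] at h1
        have h6 : k • (∑ a, τ.ρ a ∘ₗ (ξ.smulRight v) ∘ₗ τ.ρ a⁻¹) w = (Fintype.card A : ℂ)⁻¹ •
            ((Module.finrank ℂ τ.V : ℂ) • ∑ a, τ.ρ a ∘ₗ (ξ.smulRight v) ∘ₗ τ.ρ a⁻¹) w := by
          rw [LinearMap.smul_apply, smul_smul]; congr 1; simp only [k]; field_simp
        rw [h6, h1, LinearMap.smul_apply, smul_smul, LinearMap.id_apply, inv_mul_cancel_left₀ hA]
      rw [hr, evRep_tmul, Finset.smul_sum]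
      have : ∀ i, k • b i ⊗ₜ[ℂ] coeffMap τ σ (b.coord i) (f v) = (b.coord i v • b i) ⊗ₜ[ℂ] f := by
        intro i
        rw [← TensorProduct.tmul_smul, key, TensorProduct.tmul_smul, TensorProduct.smul_tmul']
      simp only [this, ← TensorProduct.sum_tmul]
      congr 1
      exact b.sum_repr v
  · intro e
    rw [hr, map_smul, map_sum]
    simp only [evRep_tmul, coeffMap_apply]
    rw [Finset.sum_comm, Finset.smul_sum]
    refine Finset.sum_congr rfl fun a _ => ?_
    rw [← Finset.sum_smul, smul_smul]

theorem evRep_injective [Finite A] : Function.Injective (evRep τ σ) := by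
  have := Fintype.ofFinite A
  obtain ⟨c, hc⟩ := exists_retraction τ
  obtain ⟨r, hr, -⟩ := hc σ
  exact Function.LeftInverse.injective hr

end Rep

/-- Two irreducible representations are equivalent if they are isomorphic. -/
instance IrrRep.setoid (A : Type w) [Group A] : Setoid (IrrRep.{v} A) where
  r σ τ := Nonempty (σ.ρ.Equiv τ.ρ)
  iseqv := ⟨fun σ => ⟨Representation.Equiv.refl σ.ρ⟩, fun ⟨e⟩ => ⟨e.symm⟩,
    fun ⟨e⟩ ⟨f⟩ => ⟨e.trans f⟩⟩

/-- The set `Irr(A)` of isomorphism classes of complex irreducible representations of `A`. -/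
def Irr (A : Type w) [Group A] := Quotient (IrrRep.setoid.{v} A)

/-- The class `[τ] ∈ Irr(A)`. -/
def Irr.mk {A : Type w} [Group A] (τ : IrrRep.{v} A) : Irr.{v} A := Quotient.mk _ τ

section Conj

variable {G : Type w} [Group G] {A : Subgroup G} [A.Normal]

theorem irreducible_comp {B : Type*} {C : Type*} [Group B] [Group C] {V : Type*} [AddCommGroup V]
    [Module ℂ V] (ρ : Representation ℂ B V) [ρ.IsIrreducible] (e : C ≃* B) :
    Representation.IsIrreducible (ρ.comp e.toMonoidHom : Representation ℂ C V) := by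
  let f : Subrepresentation (ρ.comp e.toMonoidHom : Representation ℂ C V) ≃o
      Subrepresentation ρ :=
    { toFun := fun s => ⟨s.toSubmodule, fun b v hv => by
        have := s.apply_mem_toSubmodule (e.symm b) hv
        simpa using this⟩
      invFun := fun s => ⟨s.toSubmodule, fun c v hv => s.apply_mem_toSubmodule (e c) hv⟩
      left_inv := fun s => rfl
      right_inv := fun s => rfl
      map_rel_iff' := Iff.rfl }
  exact f.isSimpleOrder_iff.2 inferInstance

/-- The conjugate `g · τ`, `(g · τ)(a) = τ(g⁻¹ a g)`. -/
def IrrRep.conj (g : G) (τ : IrrRep.{v} A) : IrrRep.{v} A where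
  V := τ.V
  ρ := τ.ρ.comp (MulAut.conjNormal g⁻¹ : A ≃* A).toMonoidHom
  irr := irreducible_comp τ.ρ _

theorem IrrRep.conj_apply (g : G) (τ : IrrRep.{v} A) (a : A) :
    (τ.conj g).ρ a = τ.ρ (MulAut.conjNormal g⁻¹ a) := rfl

/-- The action of `G` on `Irr(A)` by conjugation. -/
instance : MulAction G (Irr.{v} A) where
  smul g := Quotient.map (IrrRep.conj g) fun σ τ ⟨e⟩ =>
    ⟨Representation.Equiv.mk e.toLinearEquiv fun a => by
      ext v; exact e.toIntertwiningMap.isIntertwining _ _ _ v⟩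
  one_smul := by
    rintro ⟨τ⟩
    refine Quotient.sound ⟨Representation.Equiv.mk (LinearEquiv.refl ℂ τ.V) fun a => ?_⟩
    ext v
    change τ.ρ (MulAut.conjNormal 1⁻¹ a) v = τ.ρ a v
    simp
  mul_smul := by
    rintro g h ⟨τ⟩
    refine Quotient.sound ⟨Representation.Equiv.mk (LinearEquiv.refl ℂ τ.V) fun a => ?_⟩
    ext v
    change τ.ρ (MulAut.conjNormal (g * h)⁻¹ a) v =
      τ.ρ (MulAut.conjNormal h⁻¹ (MulAut.conjNormal g⁻¹ a)) v
    rw [mul_inv_rev, map_mul, MulAut.mul_apply]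

/-- The isotropy group `G_[τ]` of the class of `τ`. -/
def IrrRep.stab (τ : IrrRep.{v} A) : Subgroup G := MulAction.stabilizer G (Irr.mk τ)

theorem IrrRep.exists_intertwiner (τ : IrrRep.{v} A) (h : τ.stab) :
    ∃ M : τ.V ≃ₗ[ℂ] τ.V, ∀ (a : A) (v : τ.V),
      M (τ.ρ (MulAut.conjNormal (h : G)⁻¹ a) v) = τ.ρ a (M v) := by
  obtain ⟨e⟩ := Quotient.exact (s := IrrRep.setoid.{v} A) (MulAction.mem_stabilizer_iff.1 h.2)
  exact ⟨e.toLinearEquiv, fun a v => e.toIntertwiningMap.isIntertwining _ _ a v⟩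

/-- A linear automorphism `M_h` of `V_τ` with `τ(h⁻¹ a h) = M_h⁻¹ τ(a) M_h`. -/
noncomputable def IrrRep.inter (τ : IrrRep.{v} A) (h : τ.stab) : τ.V ≃ₗ[ℂ] τ.V :=
  (τ.exists_intertwiner h).choose

theorem IrrRep.inter_spec (τ : IrrRep.{v} A) (h : τ.stab) (a : A) (v : τ.V) :
    τ.inter h (τ.ρ (MulAut.conjNormal (h : G)⁻¹ a) v) = τ.ρ a (τ.inter h v) :=
  (τ.exists_intertwiner h).choose_spec a v

theorem IrrRep.le_stab (τ : IrrRep.{v} A) : A ≤ τ.stab := by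
  intro b hb
  let c : A := ⟨b, hb⟩
  have h1 : τ.ρ c ∘ₗ τ.ρ c⁻¹ = LinearMap.id := by
    rw [← Module.End.mul_eq_comp, ← map_mul, mul_inv_cancel, map_one]; rfl
  have h2 : τ.ρ c⁻¹ ∘ₗ τ.ρ c = LinearMap.id := by
    rw [← Module.End.mul_eq_comp, ← map_mul, inv_mul_cancel, map_one]; rfl
  refine MulAction.mem_stabilizer_iff.2 (Quotient.sound ⟨Representation.Equiv.mk
    (LinearEquiv.ofLinearMap (τ.ρ c) (τ.ρ c⁻¹) h1 h2) fun a => ?_⟩)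
  change τ.ρ c * τ.ρ (MulAut.conjNormal b⁻¹ a) = τ.ρ a * τ.ρ c
  rw [← map_mul, ← map_mul]
  congr 1
  ext
  simp [c, mul_assoc]

/-- The inclusion `A → G_[τ]`. -/
def IrrRep.incl (τ : IrrRep.{v} A) : A →* τ.stab := Subgroup.inclusion τ.le_stab

end Conj

/-- `A` acts trivially, through `i : A → H`, on the `H`-space `X`. -/
class ActsTrivially {A : Type*} {H : Type*} [Group A] [Group H] (i : A →* H) (X : Type*)
    [MulAction H X] : Prop where
  smul_eq : ∀ (a : A) (x : X), i a • x = x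

namespace GVect

section FiberRep

variable {A : Type*} {H : Type*} [Group A] [Group H] (i : A →* H) {X : Type u}
  [TopologicalSpace X] [MulAction H X] [ActsTrivially i X]

/-- The fibre `E_x` as a representation of `A`. -/
def fiberRep (E : GVect.{u, v} H X) (x : X) : Representation ℂ A (E.fiber x) :=
  have key : ∀ (a : A) (v : E.fiber x),
      (⟨x, E.cast (ActsTrivially.smul_eq (i := i) a x) (E.act (i a) x v)⟩ : Tot E.fiber) =
        E.tact (i a) ⟨x, v⟩ := fun a v => E.mk_cast _ _
  { toFun := fun a =>
      (E.cast (ActsTrivially.smul_eq (i := i) a x)).toLinearMap ∘ₗ E.act (i a) x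
    map_one' := by
      ext v
      apply Tot.mk_inj (F := E.fiber)
      refine (key 1 v).trans ?_
      rw [map_one, E.tact_one]; rfl
    map_mul' := fun a b => by
      ext v
      apply Tot.mk_inj (F := E.fiber)
      refine (key (a * b) v).trans ?_
      rw [map_mul, E.tact_mul, ← key b v, ← key a]; rfl }

theorem mk_fiberRep (E : GVect.{u, v} H X) (x : X) (a : A) (v : E.fiber x) :
    (⟨x, E.fiberRep i x a v⟩ : Tot E.fiber) = E.tact (i a) ⟨x, v⟩ := E.mk_cast _ _

variable (τ : IrrRep.{v} A)

/-- The fibre `V_τ ⊗ Hom_A(V_τ, E_x)`. -/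
abbrev IsoFiber (E : GVect.{u, v} H X) (x : X) : Type v :=
  τ.V ⊗[ℂ] (τ.ρ.IntertwiningMap (E.fiberRep i x))

/-- The evaluation `V_τ ⊗ Hom_A(V_τ, E_x) → E_x`, `v ⊗ f ↦ f v`. -/
noncomputable def ev (E : GVect.{u, v} H X) (x : X) : E.IsoFiber i τ x →ₗ[ℂ] E.fiber x :=
  evRep τ (E.fiberRep i x)

theorem ev_injective [Finite A] (E : GVect.{u, v} H X) (x : X) :
    Function.Injective (E.ev i τ x) := evRep_injective τ _

/-- `E` is an `(H, τ)`-equivariant bundle: the evaluation `V_τ ⊗ Hom_A(V_τ, E) → E` is an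
isomorphism. (The source carries the topology for which evaluation is a topological embedding, see
`isoVB`, so that it suffices to ask for bijectivity on the fibres.) -/
def IsIsotypic (E : GVect.{u, v} H X) : Prop := ∀ x, Function.Bijective (E.ev i τ x)

theorem exists_isoRetraction [Finite A] (E : GVect.{u, v} H X) :
    ∃ r : ∀ x, E.fiber x →ₗ[ℂ] E.IsoFiber i τ x, (∀ x t, r x (E.ev i τ x t) = t) ∧
      Continuous fun p : Tot E.fiber => (⟨p.base, E.ev i τ p.base (r p.base p.vec)⟩ :
        Tot E.fiber) := by
  have := Fintype.ofFinite A
  obtain ⟨c, hc⟩ := exists_retraction τ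
  choose r h1 h2 using fun x => hc (E.fiberRep i x)
  refine ⟨r, h1, ?_⟩
  have : (fun p : Tot E.fiber => (⟨p.base, E.ev i τ p.base (r p.base p.vec)⟩ : Tot E.fiber)) =
      fun p => ⟨p.base, ∑ a, c a • E.fiberRep i p.base a p.vec⟩ := by
    funext p
    exact congrArg _ (h2 p.base p.vec)
  rw [this]
  refine E.continuous_sum E.continuous_base _ fun a _ => E.continuous_smul ?_ _
  exact (E.continuous_tact (i a)).congr fun p => (E.mk_fiberRep i _ a _).symm

/-- The vector bundle `V_τ ⊗ Hom_A(V_τ, E)`. Evaluation embeds it fibrewise into `E`, as a direct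
summand, and its topology is the one induced by this embedding. -/
noncomputable def isoVB [Finite A] (E : GVect.{u, v} H X) : VB.{u, v} X :=
  E.toVB.ofSplit (E.IsoFiber i τ) (E.ev i τ) (E.exists_isoRetraction i τ).choose
    (E.exists_isoRetraction i τ).choose_spec.1 (E.exists_isoRetraction i τ).choose_spec.2

theorem isoVB_isInducing [Finite A] (E : GVect.{u, v} H X) :
    IsInducing fun p : Tot (E.isoVB i τ).fiber =>
      (⟨p.base, E.ev i τ p.base p.vec⟩ : Tot E.fiber) := ⟨rfl⟩

theorem isoVB_ext [Finite A] {E : GVect.{u, v} H X} {p q : Tot (E.isoVB i τ).fiber}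
    (h : (⟨p.base, E.ev i τ p.base p.vec⟩ : Tot E.fiber) = ⟨q.base, E.ev i τ q.base q.vec⟩) :
    p = q := by
  obtain ⟨x, v⟩ := p; obtain ⟨y, w⟩ := q
  obtain rfl : x = y := congrArg Tot.base h
  exact congrArg _ (E.ev_injective i τ x (Tot.mk_inj h))

/-- The map `V_τ ⊗ Hom_A(V_τ, E_x) → V_τ ⊗ Hom_A(V_τ, F_y)` induced by an `A`-map `E_x → F_y`. -/
noncomputable def isoMap {B : Type*} [Group B] (j : A →* B) {Y : Type u'} [TopologicalSpace Y]
    [MulAction B Y] [ActsTrivially j Y] {E : GVect.{u, v} H X} {F : GVect.{u', v} B Y} {x : X}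
    {y : Y} (φ : E.fiber x →ₗ[ℂ] F.fiber y)
    (hφ : ∀ a v, φ (E.fiberRep i x a v) = F.fiberRep j y a (φ v)) :
    E.IsoFiber i τ x →ₗ[ℂ] F.IsoFiber j τ y :=
  TensorProduct.map LinearMap.id
    { toFun := fun f => ⟨φ ∘ₗ f.toLinearMap, fun a => by
        ext v
        change φ (f (τ.ρ a v)) = F.fiberRep j y a (φ (f v))
        rw [f.isIntertwining, hφ]⟩
      map_add' := fun f g => by ext v; exact map_add φ _ _
      map_smul' := fun c f => by ext v; exact map_smul φ _ _ }

theorem ev_isoMap {B : Type*} [Group B] (j : A →* B) {Y : Type u'} [TopologicalSpace Y]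
    [MulAction B Y] [ActsTrivially j Y] {E : GVect.{u, v} H X} {F : GVect.{u', v} B Y} {x : X}
    {y : Y} (φ : E.fiber x →ₗ[ℂ] F.fiber y)
    (hφ : ∀ a v, φ (E.fiberRep i x a v) = F.fiberRep j y a (φ v)) (t : E.IsoFiber i τ x) :
    F.ev j τ y (isoMap i τ j φ hφ t) = φ (E.ev i τ x t) := by
  induction t using TensorProduct.induction_on with
  | zero => simp
  | add s t hs ht => simp only [map_add, hs, ht]
  | tmul v f => rfl

end FiberRep

section Isotypic

variable {G : Type w} [Group G] {A : Subgroup G} [A.Normal] (τ : IrrRep.{v} A)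
  {X : Type u} [TopologicalSpace X] [MulAction G X] [hA : ActsTrivially A.subtype X]

instance : ActsTrivially τ.incl X := ⟨fun a x => hA.smul_eq a x⟩

theorem act_fiberRep (E : GVect.{u, v} G X) (g : G) (x : X) (a : A) (v : E.fiber x) :
    E.act g x (E.fiberRep A.subtype x (MulAut.conjNormal g⁻¹ a) v) =
      E.fiberRep A.subtype (g • x) a (E.act g x v) := by
  apply Tot.mk_inj (F := E.fiber)
  rw [mk_fiberRep, ← E.tact_mk, ← E.tact_mk, mk_fiberRep, ← E.tact_mul, ← E.tact_mul]
  congr 1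
  simp [mul_assoc]

/-- The operation `h • f = h ∘ f ∘ M_h⁻¹ : V_τ → E_{hx}` on `f ∈ Hom_A(V_τ, E_x)`. -/
noncomputable def bullet (E : GVect.{u, v} G X) (h : τ.stab) (x : X) :
    τ.ρ.IntertwiningMap (E.fiberRep A.subtype x) →ₗ[ℂ]
      τ.ρ.IntertwiningMap (E.fiberRep A.subtype ((h : G) • x)) where
  toFun f := ⟨E.act (h : G) x ∘ₗ f.toLinearMap ∘ₗ (τ.inter h).symm.toLinearMap, fun a => by
    ext w
    change E.act (h : G) x (f ((τ.inter h).symm (τ.ρ a w))) =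
      E.fiberRep A.subtype ((h : G) • x) a (E.act (h : G) x (f ((τ.inter h).symm w)))
    have : (τ.inter h).symm (τ.ρ a w) =
        τ.ρ (MulAut.conjNormal (h : G)⁻¹ a) ((τ.inter h).symm w) := by
      rw [LinearEquiv.symm_apply_eq, τ.inter_spec, LinearEquiv.apply_symm_apply]
    rw [this, f.isIntertwining, act_fiberRep]⟩
  map_add' f g := by ext w; exact map_add (E.act (h : G) x) _ _
  map_smul' c f := by ext w; exact map_smul (E.act (h : G) x) _ _

/-- The action `h ⋆ (v ⊗ f) = M_h v ⊗ (h • f)` of `G_[τ]` on `V_τ ⊗ Hom_A(V_τ, E)`. -/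
noncomputable def star (E : GVect.{u, v} G X) (h : τ.stab) (x : X) :
    E.IsoFiber A.subtype τ x →ₗ[ℂ] E.IsoFiber A.subtype τ ((h : G) • x) :=
  TensorProduct.map (τ.inter h).toLinearMap (E.bullet τ h x)

theorem ev_star (E : GVect.{u, v} G X) (h : τ.stab) (x : X) (t : E.IsoFiber A.subtype τ x) :
    E.ev A.subtype τ _ (E.star τ h x t) = E.act (h : G) x (E.ev A.subtype τ x t) := by
  induction t using TensorProduct.induction_on with
  | zero => simp
  | add s t hs ht => simp only [map_add, hs, ht]
  | tmul v f =>
    change E.act (h : G) x (f ((τ.inter h).symm (τ.inter h v))) = E.act (h : G) x (f v)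
    rw [LinearEquiv.symm_apply_apply]

variable [Finite G]

/-- The `G_[τ]`-vector bundle `V_τ ⊗ Hom_A(V_τ, E)` of a `G`-vector bundle `E`. -/
noncomputable def isotypic (E : GVect.{u, v} G X) : GVect.{u, v} τ.stab X where
  toVB := E.isoVB A.subtype τ
  act h x := E.star τ h x
  act_one x t := by
    apply isoVB_ext
    exact (congrArg _ (E.ev_star τ 1 x t)).trans (E.act_one x _)
  act_mul g h x t := by
    apply isoVB_ext
    refine (congrArg _ (E.ev_star τ (g * h) x t)).trans ((E.act_mul g h x _).trans ?_)
    exact (congrArg _ ((E.ev_star τ g _ _).trans (congrArg _ (E.ev_star τ h x t)))).symm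
  continuous_act h := by
    have hj := E.isoVB_isInducing A.subtype τ
    refine hj.continuous_iff.2 (((E.continuous_tact (h : G)).comp hj.continuous).congr fun p => ?_)
    exact congrArg _ (E.ev_star τ h p.base p.vec).symm

theorem ev_fiberRep_isotypic (E : GVect.{u, v} G X) (x : X) (a : A)
    (t : E.IsoFiber A.subtype τ x) :
    E.ev A.subtype τ x ((E.isotypic τ).fiberRep τ.incl x a t) =
      E.fiberRep A.subtype x a (E.ev A.subtype τ x t) := by
  apply Tot.mk_inj (F := E.fiber)
  rw [mk_fiberRep]
  have h := (E.isotypic τ).mk_fiberRep τ.incl x a t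
  have h' := congrArg (fun p : Tot (E.isotypic τ).fiber =>
    (⟨p.base, E.ev A.subtype τ p.base p.vec⟩ : Tot E.fiber)) h
  exact h'.trans (congrArg _ (E.ev_star τ (τ.incl a) x t))

theorem isotypic_isIsotypic (E : GVect.{u, v} G X) :
    (E.isotypic τ).IsIsotypic τ.incl τ := by
  intro x
  refine ⟨ev_injective _ _ _ _, fun t => ?_⟩
  change E.IsoFiber A.subtype τ x at t
  induction t using TensorProduct.induction_on with
  | zero => exact ⟨0, map_zero _⟩
  | add s t hs ht =>
    obtain ⟨s', hs'⟩ := hs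
    obtain ⟨t', ht'⟩ := ht
    exact ⟨s' + t', (map_add _ _ _).trans (congrArg₂ _ hs' ht')⟩
  | tmul v f =>
    let k : τ.V →ₗ[ℂ] E.IsoFiber A.subtype τ x := (TensorProduct.mk ℂ _ _).flip f
    let g : τ.ρ.IntertwiningMap ((E.isotypic τ).fiberRep τ.incl x) := ⟨k, fun a => by
      ext w
      apply E.ev_injective A.subtype τ x
      refine Eq.trans ?_ (E.ev_fiberRep_isotypic τ x a (w ⊗ₜ f)).symm
      exact f.isIntertwining _ _ a w⟩
    exact ⟨v ⊗ₜ g, rfl⟩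

end Isotypic

end GVect

instance {G : Type*} [Group G] (S : Subgroup G) {X : Type*} [TopologicalSpace X] [MulAction G X]
    [ContinuousConstSMul G X] : ContinuousConstSMul S X :=
  ⟨fun s => continuous_const_smul (s : G)⟩

namespace GVect

/-! ### Functoriality of the isotypic parts -/

section

variable {A : Type*} {H : Type*} [Group A] [Group H] (i : A →* H) {X : Type u} {Y : Type u'}
  [TopologicalSpace X] [MulAction H X] [ActsTrivially i X]
  [TopologicalSpace Y] [MulAction H Y] [ActsTrivially i Y] (τ : IrrRep.{v} A)

theorem fiberRep_sum (E F : GVect.{u, v} H X) (x : X) (a : A) (v : E.fiber x × F.fiber x) :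
    (E.sum F).fiberRep i x a v = (E.fiberRep i x a v.1, F.fiberRep i x a v.2) :=
  cast_prod (E := E.toVB) (F := F.toVB) _ _

theorem fiberRep_inl (E F : GVect.{u, v} H X) (x : X) (a : A) (v : E.fiber x) :
    (LinearMap.inl ℂ (E.fiber x) (F.fiber x) (E.fiberRep i x a v) : (E.sum F).fiber x) =
      (E.sum F).fiberRep i x a (LinearMap.inl ℂ (E.fiber x) (F.fiber x) v) :=
  Eq.trans (b := (E.fiberRep i x a v, F.fiberRep i x a 0))
    (congrArg (Prod.mk _) (map_zero (F.fiberRep i x a)).symm)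
    (fiberRep_sum i E F x a (LinearMap.inl ℂ (E.fiber x) (F.fiber x) v)).symm

theorem fiberRep_inr (E F : GVect.{u, v} H X) (x : X) (a : A) (v : F.fiber x) :
    (LinearMap.inr ℂ (E.fiber x) (F.fiber x) (F.fiberRep i x a v) : (E.sum F).fiber x) =
      (E.sum F).fiberRep i x a (LinearMap.inr ℂ (E.fiber x) (F.fiber x) v) :=
  Eq.trans (b := (E.fiberRep i x a 0, F.fiberRep i x a v))
    (congrArg (fun z => (z, F.fiberRep i x a v)) (map_zero (E.fiberRep i x a)).symm)
    (fiberRep_sum i E F x a (LinearMap.inr ℂ (E.fiber x) (F.fiber x) v)).symm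

theorem fiberRep_pullback (E : GVect.{u, v} H X) (f : GMap H Y X) [ContinuousConstSMul H Y]
    (y : Y) (a : A) (v : E.fiber (f.toFun y)) :
    (E.pullback f).fiberRep i y a v = E.fiberRep i (f.toFun y) a v := by
  apply Tot.mk_inj (F := E.fiber)
  rw [mk_fiberRep]
  have h := (E.pullback f).mk_fiberRep i y a v
  have h' := congrArg (fun p : Tot (E.pullback f).fiber =>
    (⟨f.toFun p.base, p.vec⟩ : Tot E.fiber)) h
  exact h'.trans (E.mk_cast _ _)

theorem Iso.map_fiberRep {E F : GVect.{u, v} H X} (e : Iso E F) (x : X) (a : A) (v : E.fiber x) :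
    e.toEquiv x (E.fiberRep i x a v) = F.fiberRep i x a (e.toEquiv x v) :=
  (e.apply_cast _ _).trans (congrArg _ (e.map_act (i a) x v))

theorem IsIsotypic.sum [Finite A] {E F : GVect.{u, v} H X} (hE : E.IsIsotypic i τ)
    (hF : F.IsIsotypic i τ) : (E.sum F).IsIsotypic i τ := by
  intro x
  refine ⟨ev_injective _ _ _ _, ?_⟩
  rintro ⟨e, f⟩
  obtain ⟨s, rfl⟩ := (hE x).2 e
  obtain ⟨t, rfl⟩ := (hF x).2 f
  have h1 := ev_isoMap i τ i (E := E) (F := E.sum F) (x := x) (y := x)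
    (LinearMap.inl ℂ (E.fiber x) (F.fiber x)) (fiberRep_inl i E F x) s
  have h2 := ev_isoMap i τ i (E := F) (F := E.sum F) (x := x) (y := x)
    (LinearMap.inr ℂ (E.fiber x) (F.fiber x)) (fiberRep_inr i E F x) t
  refine ⟨_ + _, (map_add _ _ _).trans ((congrArg₂ _ h1 h2).trans ?_)⟩
  exact Prod.ext (add_zero _) (zero_add _)

theorem IsIsotypic.zero [Finite A] [ContinuousConstSMul H X] :
    (GVect.zero.{u, v} H X).IsIsotypic i τ :=
  fun _ => ⟨ev_injective _ _ _ _, fun _ => ⟨0, rfl⟩⟩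

theorem IsIsotypic.pullback [Finite A] {E : GVect.{u, v} H X} (hE : E.IsIsotypic i τ)
    (f : GMap H Y X) [ContinuousConstSMul H Y] : (E.pullback f).IsIsotypic i τ := by
  intro y
  refine ⟨ev_injective _ _ _ _, fun e => ?_⟩
  obtain ⟨s, hs⟩ := (hE (f.toFun y)).2 e
  have h1 := ev_isoMap i τ i (E := E) (F := E.pullback f) (x := f.toFun y) (y := y)
    LinearMap.id (fun a v => (E.fiberRep_pullback i f y a v).symm) s
  exact ⟨_, h1.trans hs⟩

end

section

variable {G : Type w} [Group G] [Finite G] {A : Subgroup G} [A.Normal] (τ : IrrRep.{v} A)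
  {X : Type u} {Y : Type u'}
  [TopologicalSpace X] [MulAction G X] [ActsTrivially A.subtype X]
  [TopologicalSpace Y] [MulAction G Y] [ActsTrivially A.subtype Y]

/-- A `G`-map is an `S`-map for every subgroup `S`. -/
def _root_.EqK.GMap.restrict (f : GMap G Y X) (S : Subgroup G) : GMap S Y X :=
  ⟨f.toFun, f.continuous_toFun, fun s y => f.map_smul s y⟩

noncomputable def isotypicCongr {E F : GVect.{u, v} G X} (e : Iso E F) :
    Iso (E.isotypic τ) (F.isotypic τ) :=
  let φ : ∀ x, E.IsoFiber A.subtype τ x →ₗ[ℂ] F.IsoFiber A.subtype τ x := fun x =>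
    isoMap A.subtype τ A.subtype (e.toEquiv x).toLinearMap (e.map_fiberRep A.subtype x)
  let ψ : ∀ x, F.IsoFiber A.subtype τ x →ₗ[ℂ] E.IsoFiber A.subtype τ x := fun x =>
    isoMap A.subtype τ A.subtype (e.symm.toEquiv x).toLinearMap (e.symm.map_fiberRep A.subtype x)
  have hφ : ∀ x t, F.ev A.subtype τ x (φ x t) = e.toEquiv x (E.ev A.subtype τ x t) :=
    fun x t => ev_isoMap _ _ _ _ _ t
  have hψ : ∀ x t, E.ev A.subtype τ x (ψ x t) = (e.toEquiv x).symm (F.ev A.subtype τ x t) :=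
    fun x t => ev_isoMap _ _ _ _ _ t
  { toEquiv := fun x => LinearEquiv.ofLinearMap (φ x) (ψ x)
      (LinearMap.ext fun t => F.ev_injective A.subtype τ x 
        ((hφ _ _).trans ((congrArg _ (hψ _ _)).trans (LinearEquiv.apply_symm_apply _ _))))
      (LinearMap.ext fun t => E.ev_injective A.subtype τ x 
        ((hψ _ _).trans ((congrArg _ (hφ _ _)).trans (LinearEquiv.symm_apply_apply _ _))))
    continuous_toFun := (F.isoVB_isInducing A.subtype τ).continuous_iff.2
      ((e.continuous_toFun.comp (E.isoVB_isInducing A.subtype τ).continuous).congr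
        fun p => congrArg _ (hφ _ _).symm)
    continuous_invFun := (E.isoVB_isInducing A.subtype τ).continuous_iff.2
      ((e.continuous_invFun.comp (F.isoVB_isInducing A.subtype τ).continuous).congr
        fun p => congrArg _ (hψ _ _).symm)
    map_act := fun h x t => F.ev_injective A.subtype τ _ (by
      refine (hφ _ _).trans ((congrArg _ (E.ev_star τ h x t)).trans ?_)
      refine (e.map_act (h : G) x _).trans ?_
      exact ((F.ev_star τ h x _).trans (congrArg _ (hφ x t))).symm) }

noncomputable def isotypicSum (E F : GVect.{u, v} G X) :
    Iso ((E.sum F).isotypic τ) ((E.isotypic τ).sum (F.isotypic τ)) :=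
  let p₁ : ∀ x, (E.sum F).IsoFiber A.subtype τ x →ₗ[ℂ] E.IsoFiber A.subtype τ x := fun x =>
    isoMap A.subtype τ A.subtype (LinearMap.fst ℂ (E.fiber x) (F.fiber x))
      (fun a v => congrArg Prod.fst (fiberRep_sum A.subtype E F x a v))
  let p₂ : ∀ x, (E.sum F).IsoFiber A.subtype τ x →ₗ[ℂ] F.IsoFiber A.subtype τ x := fun x =>
    isoMap A.subtype τ A.subtype (LinearMap.snd ℂ (E.fiber x) (F.fiber x))
      (fun a v => congrArg Prod.snd (fiberRep_sum A.subtype E F x a v))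
  let i₁ : ∀ x, E.IsoFiber A.subtype τ x →ₗ[ℂ] (E.sum F).IsoFiber A.subtype τ x := fun x =>
    isoMap A.subtype τ A.subtype (LinearMap.inl ℂ (E.fiber x) (F.fiber x)) 
      (fiberRep_inl A.subtype E F x)
  let i₂ : ∀ x, F.IsoFiber A.subtype τ x →ₗ[ℂ] (E.sum F).IsoFiber A.subtype τ x := fun x =>
    isoMap A.subtype τ A.subtype (LinearMap.inr ℂ (E.fiber x) (F.fiber x)) 
      (fiberRep_inr A.subtype E F x)
  have hp₁ : ∀ x t, E.ev A.subtype τ x (p₁ x t) = ((E.sum F).ev A.subtype τ x t).1 :=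
    fun x t => ev_isoMap _ _ _ _ _ t
  have hp₂ : ∀ x t, F.ev A.subtype τ x (p₂ x t) = ((E.sum F).ev A.subtype τ x t).2 :=
    fun x t => ev_isoMap _ _ _ _ _ t
  have hi₁ : ∀ x t, (E.sum F).ev A.subtype τ x (i₁ x t) = (E.ev A.subtype τ x t, 0) :=
    fun x t => ev_isoMap _ _ _ _ _ t
  have hi₂ : ∀ x t, (E.sum F).ev A.subtype τ x (i₂ x t) = (0, F.ev A.subtype τ x t) :=
    fun x t => ev_isoMap _ _ _ _ _ t
  have hφ : ∀ x s t, (E.sum F).ev A.subtype τ x (i₁ x s + i₂ x t) =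
      (E.ev A.subtype τ x s, F.ev A.subtype τ x t) := fun x s t => by
    refine (map_add _ _ _).trans ((congrArg₂ _ (hi₁ x s) (hi₂ x t)).trans ?_)
    exact Prod.ext (add_zero _) (zero_add _)
  { toEquiv := fun x => LinearEquiv.ofLinearMap ((p₁ x).prod (p₂ x)) ((i₁ x).coprod (i₂ x))
      (LinearMap.ext fun t => Prod.ext
        (E.ev_injective A.subtype τ x ((hp₁ _ _).trans (congrArg Prod.fst (hφ x t.1 t.2))))
        (F.ev_injective A.subtype τ x ((hp₂ _ _).trans (congrArg Prod.snd (hφ x t.1 t.2)))))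
      (LinearMap.ext fun t => (E.sum F).ev_injective A.subtype τ x
        ((hφ x _ _).trans (Prod.ext (hp₁ x t) (hp₂ x t))))
    continuous_toFun := by
      have h1 := ((E.sum F).isoVB_isInducing A.subtype τ).continuous
      have h2 := (VB.prod_isInducing E.toVB F.toVB).continuous.comp h1
      refine (VB.prod_isInducing (E.isotypic τ).toVB (F.isotypic τ).toVB).continuous_iff.2 ?_
      refine Continuous.prodMk ?_ ?_
      · exact (E.isoVB_isInducing A.subtype τ).continuous_iff.2
          ((continuous_fst.comp h2).congr fun p => congrArg _ (hp₁ _ _).symm)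
      · exact (F.isoVB_isInducing A.subtype τ).continuous_iff.2
          ((continuous_snd.comp h2).congr fun p => congrArg _ (hp₂ _ _).symm)
    continuous_invFun := by
      have h1 := (VB.prod_isInducing (E.isotypic τ).toVB (F.isotypic τ).toVB).continuous
      have h2 := (E.isoVB_isInducing A.subtype τ).continuous.comp (continuous_fst.comp h1)
      have h3 := (F.isoVB_isInducing A.subtype τ).continuous.comp (continuous_snd.comp h1)
      refine ((E.sum F).isoVB_isInducing A.subtype τ).continuous_iff.2 ?_
      refine (VB.prod_isInducing E.toVB F.toVB).continuous_iff.2 ?_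
      refine (h2.prodMk h3).congr fun p => ?_
      exact congrArg (fun z : E.fiber p.base × F.fiber p.base =>
        ((⟨p.base, z.1⟩, ⟨p.base, z.2⟩) : Tot E.fiber × Tot F.fiber)) (hφ _ _ _).symm
    map_act := fun h x t => by
      have key := (E.sum F).ev_star τ h x t
      refine Prod.ext (E.ev_injective A.subtype τ _ ?_) (F.ev_injective A.subtype τ _ ?_)
      · refine (hp₁ _ _).trans ((congrArg Prod.fst key).trans ?_)
        exact ((E.ev_star τ h x _).trans (congrArg _ (hp₁ x t))).symm
      · refine (hp₂ _ _).trans ((congrArg Prod.snd key).trans ?_)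
        exact ((F.ev_star τ h x _).trans (congrArg _ (hp₂ x t))).symm }

noncomputable def isotypicZero [ContinuousConstSMul G X] :
    Iso ((GVect.zero.{u, v} G X).isotypic τ) (GVect.zero.{u, v} τ.stab X) :=
  have key : ∀ (x : X) (s t : (GVect.zero.{u, v} G X).IsoFiber A.subtype τ x), s = t :=
    fun x _ _ => ev_injective A.subtype τ (GVect.zero.{u, v} G X) x rfl
  { toEquiv := fun x => LinearEquiv.ofLinearMap (0 : _ →ₗ[ℂ] PUnit.{v + 1}) 0
      (LinearMap.ext fun _ => rfl) (LinearMap.ext fun _ => key x _ _)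
    continuous_toFun := continuous_induced_rng.2
      ((GVect.zero.{u, v} G X).isotypic τ).continuous_base
    continuous_invFun := (isoVB_isInducing A.subtype τ (GVect.zero.{u, v} G X)).continuous_iff.2
      (continuous_induced_rng.2 (GVect.zero.{u, v} τ.stab X).continuous_base)
    map_act := fun _ _ _ => rfl }

noncomputable def isotypicPullback (E : GVect.{u, v} G X) (f : GMap G Y X)
    [ContinuousConstSMul G Y] :
    Iso ((E.pullback f).isotypic τ) ((E.isotypic τ).pullback (f.restrict τ.stab)) :=
  let φ : ∀ y, (E.pullback f).IsoFiber A.subtype τ y →ₗ[ℂ]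
      E.IsoFiber A.subtype τ (f.toFun y) := fun y =>
    isoMap (E := E.pullback f) (F := E) A.subtype τ A.subtype
      (LinearMap.id : E.fiber (f.toFun y) →ₗ[ℂ] E.fiber (f.toFun y))
      (fun a v => E.fiberRep_pullback A.subtype f y a v)
  let ψ : ∀ y, E.IsoFiber A.subtype τ (f.toFun y) →ₗ[ℂ]
      (E.pullback f).IsoFiber A.subtype τ y := fun y =>
    isoMap (E := E) (F := E.pullback f) A.subtype τ A.subtype
      (LinearMap.id : E.fiber (f.toFun y) →ₗ[ℂ] E.fiber (f.toFun y))
      (fun a v => (E.fiberRep_pullback A.subtype f y a v).symm)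
  have hφ : ∀ y t, E.ev A.subtype τ _ (φ y t) = (E.pullback f).ev A.subtype τ y t :=
    fun x t => ev_isoMap (E := E.pullback f) (F := E) _ _ _ _ _ t
  have hψ : ∀ y t, (E.pullback f).ev A.subtype τ y (ψ y t) = E.ev A.subtype τ _ t :=
    fun x t => ev_isoMap (E := E) (F := E.pullback f) _ _ _ _ _ t
  { toEquiv := fun y => LinearEquiv.ofLinearMap (φ y) (ψ y)
      (LinearMap.ext fun t => E.ev_injective A.subtype τ _ ((hφ _ _).trans (hψ _ _)))
      (LinearMap.ext fun t => (E.pullback f).ev_injective A.subtype τ _ ((hψ _ _).trans (hφ _ _)))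
    continuous_toFun := by
      have h1 := ((E.pullback f).isoVB_isInducing A.subtype τ).continuous
      have h2 := (VB.pullback_isInducing E.toVB f.toFun f.continuous_toFun).continuous.comp h1
      refine (VB.pullback_isInducing (E.isotypic τ).toVB f.toFun
        f.continuous_toFun).continuous_iff.2 ?_
      refine (continuous_fst.comp h2).prodMk ?_
      exact (E.isoVB_isInducing A.subtype τ).continuous_iff.2
        ((continuous_snd.comp h2).congr fun p => congrArg (fun z : E.fiber (f.toFun p.base) =>
          (⟨f.toFun p.base, z⟩ : Tot E.fiber)) (hφ _ _).symm)
    continuous_invFun := by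
      have h1 := (VB.pullback_isInducing (E.isotypic τ).toVB f.toFun f.continuous_toFun).continuous
      have h2 := (E.isoVB_isInducing A.subtype τ).continuous.comp (continuous_snd.comp h1)
      refine ((E.pullback f).isoVB_isInducing A.subtype τ).continuous_iff.2 ?_
      refine (VB.pullback_isInducing E.toVB f.toFun f.continuous_toFun).continuous_iff.2 ?_
      refine (continuous_fst.comp h1).prodMk (h2.congr fun p => ?_)
      exact congrArg (fun z : E.fiber (f.toFun p.base) =>
          (⟨f.toFun p.base, z⟩ : Tot E.fiber)) (hψ _ _).symm
    map_act := fun h y t => by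
      refine E.ev_injective A.subtype τ _ (Tot.mk_inj (F := E.fiber) ?_)
      refine (congrArg (fun z : E.fiber (f.toFun ((h : G) • y)) =>
          (⟨f.toFun ((h : G) • y), z⟩ : Tot E.fiber))
        ((hφ _ _).trans ((E.pullback f).ev_star τ h y t))).trans ?_
      refine (E.mk_cast _ _).trans ?_
      have h1 := congrArg (fun p : Tot (E.isotypic τ).fiber =>
        (⟨p.base, E.ev A.subtype τ p.base p.vec⟩ : Tot E.fiber))
        ((E.isotypic τ).mk_cast (f.map_smul (h : G) y).symm (E.star τ h _ (φ y t)))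
      refine Eq.trans ?_ h1.symm
      refine congrArg (fun z => (⟨_, z⟩ : Tot E.fiber)) ?_
      exact ((E.ev_star τ h _ _).trans (congrArg _ (hφ y t))).symm }

end

/-! ### Induction -/

section Ind

variable {G : Type v} [Group G] [Finite G] {S : Subgroup G} {X : Type u} {Y : Type u'}
  [TopologicalSpace X] [MulAction G X] [ContinuousConstSMul G X]
  [TopologicalSpace Y] [MulAction G Y] [ContinuousConstSMul G Y]

/-- For a coset `q = g_l S` with chosen representative `g_l`, and `g ∈ G`, let `g_j` be the chosen
representative of `g⁻¹ q`; this is the element `s = g_l⁻¹ g g_j` of `S`, so that `g g_j = g_l s`. -/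
noncomputable def cosetElt {G : Type v} [Group G] (S : Subgroup G) (g : G) (q : G ⧸ S) : S :=
  ⟨q.out⁻¹ * g * (g⁻¹ • q).out, by
    rw [mul_assoc, ← QuotientGroup.eq, QuotientGroup.out_eq']
    have h : ((g * (g⁻¹ • q).out : G) : G ⧸ S) = g • (((g⁻¹ • q).out : G) : G ⧸ S) := rfl
    rw [h, QuotientGroup.out_eq', smul_inv_smul]⟩

theorem cosetElt_smul {G : Type v} [Group G] {S : Subgroup G} {X : Type u} [MulAction G X]
    (g : G) (q : G ⧸ S) (x : X) :
    cosetElt S g q • ((g⁻¹ • q).out⁻¹ • x) = q.out⁻¹ • g • x := by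
  change (q.out⁻¹ * g * (g⁻¹ • q).out) • ((g⁻¹ • q).out⁻¹ • x) = _
  simp only [mul_smul, smul_inv_smul]

/-- The vector bundle underlying the induced bundle: `⊕_j (g_j⁻¹)^* F`, the sum being over the
cosets `g_j S` in `G / S` with chosen representatives `g_j`. -/
noncomputable def indVB (F : GVect.{u, v} S X) : VB.{u, v} X :=
  VB.pi fun q : G ⧸ S => F.toVB.pullback (fun x => q.out⁻¹ • x) (continuous_const_smul _)

/-- The component in `F` at the coset `q` of an element of the induced bundle. -/
noncomputable def indComp (F : GVect.{u, v} S X) (q : G ⧸ S) (p : Tot F.indVB.fiber) :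
    Tot F.fiber := ⟨q.out⁻¹ • p.base, p.vec q⟩

theorem ind_ext {F : GVect.{u, v} S X} {p p' : Tot F.indVB.fiber} (hb : p.base = p'.base)
    (h : ∀ q, F.indComp q p = F.indComp q p') : p = p' :=
  VB.pi_ext hb fun q => VB.pullback_ext hb (h q)

theorem ind_continuous_iff {F : GVect.{u, v} S X} {Z : Type*} [TopologicalSpace Z]
    {f : Z → Tot F.indVB.fiber} : Continuous f ↔
      Continuous (fun z => (f z).base) ∧ ∀ q, Continuous fun z => F.indComp q (f z) := by
  have hj := VB.pi_isInducing
    fun q : G ⧸ S => F.toVB.pullback (fun x => q.out⁻¹ • x) (continuous_const_smul _)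
  have hk := fun q : G ⧸ S =>
    VB.pullback_isInducing F.toVB (fun x => q.out⁻¹ • x) (continuous_const_smul _)
  constructor
  · intro h
    have h' := hj.continuous.comp h
    exact ⟨continuous_fst.comp h', fun q => continuous_snd.comp ((hk q).continuous.comp
      ((continuous_apply q).comp (continuous_snd.comp h')))⟩
  · rintro ⟨h1, h2⟩
    refine hj.continuous_iff.2 (h1.prodMk (continuous_pi fun q => ?_))
    exact (hk q).continuous_iff.2 (h1.prodMk (h2 q))

theorem continuous_indComp (F : GVect.{u, v} S X) (q : G ⧸ S) : Continuous (F.indComp q) :=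
  (ind_continuous_iff.1 continuous_id).2 q

/-- The action of `g` on `⊕_j (g_j⁻¹)^* F`: the component `(x, f)` at `j` is sent to `(g x, s f)`
at `l`, where `g g_j = g_l s` with `s ∈ S`. -/
noncomputable def indAct (F : GVect.{u, v} S X) (g : G) (x : X) :
    F.indVB.fiber x →ₗ[ℂ] F.indVB.fiber (g • x) :=
  (LinearMap.pi fun q : G ⧸ S =>
    (F.cast (cosetElt_smul g q x)).toLinearMap ∘ₗ
      F.act (cosetElt S g q) ((g⁻¹ • q).out⁻¹ • x) ∘ₗ
        (LinearMap.proj (g⁻¹ • q) :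
          (∀ q : G ⧸ S, F.fiber (q.out⁻¹ • x)) →ₗ[ℂ] F.fiber ((g⁻¹ • q).out⁻¹ • x)) :
    (∀ q : G ⧸ S, F.fiber (q.out⁻¹ • x)) →ₗ[ℂ] (∀ q : G ⧸ S, F.fiber (q.out⁻¹ • g • x)))

theorem indComp_act (F : GVect.{u, v} S X) (g : G) (q : G ⧸ S) (p : Tot F.indVB.fiber) :
    F.indComp q ⟨g • p.base, F.indAct g p.base p.vec⟩ =
      F.tact (cosetElt S g q) (F.indComp (g⁻¹ • q) p) := F.mk_cast _ _

theorem tact_indComp_congr (F : GVect.{u, v} S X) {s s' : S} {q q' : G ⧸ S} (hq : q = q')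
    (hs : s = s') (p : Tot F.indVB.fiber) :
    F.tact s (F.indComp q p) = F.tact s' (F.indComp q' p) := by
  subst hq; subst hs; rfl

/-- The `G`-vector bundle induced from an `S`-vector bundle over a `G`-space. -/
noncomputable def ind (F : GVect.{u, v} S X) : GVect.{u, v} G X where
  toVB := F.indVB
  act g x := F.indAct g x
  act_one x v := by
    refine ind_ext (one_smul G x) fun q => ?_
    refine (F.indComp_act 1 q ⟨x, v⟩).trans ?_
    have hq : (1 : G)⁻¹ • q = q := by simp
    refine (F.tact_indComp_congr hq (s' := 1) ?_ _).trans (F.tact_one _)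
    apply Subtype.ext
    simp [cosetElt]
  act_mul g h x v := by
    refine ind_ext (mul_smul g h x) fun q => ?_
    refine (F.indComp_act (g * h) q ⟨x, v⟩).trans ?_
    refine Eq.trans ?_ (F.indComp_act g q ⟨h • x, F.indAct h x v⟩).symm
    rw [F.indComp_act h (g⁻¹ • q) ⟨x, v⟩, ← F.tact_mul]
    have hq : (g * h)⁻¹ • q = h⁻¹ • g⁻¹ • q := by rw [mul_inv_rev, mul_smul]
    refine F.tact_indComp_congr hq ?_ _
    apply Subtype.ext
    simp only [cosetElt, Subgroup.coe_mul, hq]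
    group
  continuous_act g := by
    refine ind_continuous_iff.2 ⟨(continuous_const_smul g).comp F.indVB.continuous_base, ?_⟩
    intro q
    exact ((F.continuous_tact _).comp (F.continuous_indComp _)).congr
      fun p => (F.indComp_act g q p).symm

theorem indAct_apply (F : GVect.{u, v} S X) (g : G) (x : X) (v : F.indVB.fiber x) (q : G ⧸ S) :
    F.indAct g x v q = F.cast (cosetElt_smul g q x)
      (F.act (cosetElt S g q) ((g⁻¹ • q).out⁻¹ • x) (v (g⁻¹ • q))) := rfl

noncomputable def indCongr {E F : GVect.{u, v} S X} (e : Iso E F) : Iso E.ind F.ind where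
  toEquiv x := LinearEquiv.piCongrRight fun q : G ⧸ S => e.toEquiv (q.out⁻¹ • x)
  continuous_toFun := ind_continuous_iff.2 ⟨E.indVB.continuous_base, fun q =>
    e.continuous_toFun.comp (E.continuous_indComp q)⟩
  continuous_invFun := ind_continuous_iff.2 ⟨F.indVB.continuous_base, fun q =>
    e.continuous_invFun.comp (F.continuous_indComp q)⟩
  map_act _ _ _ := funext fun _ =>
    (e.apply_cast _ _).trans (congrArg _ (e.map_act _ _ _))

noncomputable def indSum (E F : GVect.{u, v} S X) : Iso (E.sum F).ind (E.ind.sum F.ind) where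
  toEquiv x :=
    { toFun := fun v : (∀ q : G ⧸ S, E.fiber (q.out⁻¹ • x) × F.fiber (q.out⁻¹ • x)) =>
        ((fun q => (v q).1, fun q => (v q).2) :
          (∀ q : G ⧸ S, E.fiber (q.out⁻¹ • x)) × (∀ q : G ⧸ S, F.fiber (q.out⁻¹ • x)))
      invFun := fun v : (∀ q : G ⧸ S, E.fiber (q.out⁻¹ • x)) ×
          (∀ q : G ⧸ S, F.fiber (q.out⁻¹ • x)) => fun q => (v.1 q, v.2 q)
      left_inv := fun _ => rfl
      right_inv := fun _ => rfl
      map_add' := fun _ _ => rfl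
      map_smul' := fun _ _ => rfl }
  continuous_toFun := by
    refine (VB.prod_isInducing E.indVB F.indVB).continuous_iff.2 (Continuous.prodMk ?_ ?_)
    · exact ind_continuous_iff.2 ⟨(E.sum F).indVB.continuous_base, fun q =>
        continuous_fst.comp ((VB.prod_isInducing E.toVB F.toVB).continuous.comp
          ((E.sum F).continuous_indComp q))⟩
    · exact ind_continuous_iff.2 ⟨(E.sum F).indVB.continuous_base, fun q =>
        continuous_snd.comp ((VB.prod_isInducing E.toVB F.toVB).continuous.comp
          ((E.sum F).continuous_indComp q))⟩
  continuous_invFun := by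
    have h := (VB.prod_isInducing E.indVB F.indVB).continuous
    refine ind_continuous_iff.2 ⟨(E.ind.sum F.ind).continuous_base, fun q => ?_⟩
    refine (VB.prod_isInducing E.toVB F.toVB).continuous_iff.2 (Continuous.prodMk ?_ ?_)
    · exact (E.continuous_indComp q).comp (continuous_fst.comp h)
    · exact (F.continuous_indComp q).comp (continuous_snd.comp h)
  map_act g x v := Prod.ext
    (funext fun q => congrArg Prod.fst (cast_prod (E := E.toVB) (F := F.toVB) _ _))
    (funext fun q => congrArg Prod.snd (cast_prod (E := E.toVB) (F := F.toVB) _ _))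

noncomputable def indZero (S : Subgroup G) (X : Type u) [TopologicalSpace X] [MulAction G X]
    [ContinuousConstSMul G X] : Iso (GVect.zero.{u, v} S X).ind (GVect.zero.{u, v} G X) where
  toEquiv _ := LinearEquiv.ofLinearMap
    (0 : (∀ _ : G ⧸ S, PUnit.{v + 1}) →ₗ[ℂ] PUnit.{v + 1}) 0
    (LinearMap.ext fun _ => rfl) (LinearMap.ext fun _ => rfl)
  continuous_toFun := continuous_induced_rng.2 (GVect.zero.{u, v} S X).indVB.continuous_base
  continuous_invFun := ind_continuous_iff.2 ⟨(GVect.zero.{u, v} G X).continuous_base, fun q =>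
    continuous_induced_rng.2
      ((continuous_const_smul q.out⁻¹).comp (GVect.zero.{u, v} G X).continuous_base)⟩
  map_act _ _ _ := rfl

noncomputable def indPullback (F : GVect.{u, v} S X) (f : GMap G Y X) :
    Iso (F.pullback (f.restrict S)).ind (F.ind.pullback f) where
  toEquiv y := LinearEquiv.piCongrRight fun q : G ⧸ S => F.cast (f.map_smul q.out⁻¹ y)
  continuous_toFun := by
    have hb := (F.pullback (f.restrict S)).indVB.continuous_base
    refine (VB.pullback_isInducing F.indVB f.toFun f.continuous_toFun).continuous_iff.2 ?_
    refine hb.prodMk (ind_continuous_iff.2 ⟨f.continuous_toFun.comp hb, fun q => ?_⟩)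
    refine ((continuous_snd.comp (VB.pullback_isInducing F.toVB f.toFun
      f.continuous_toFun).continuous).comp
        ((F.pullback (f.restrict S)).continuous_indComp q)).congr fun p => ?_
    exact (F.mk_cast _ _).symm
  continuous_invFun := by
    have hj := (VB.pullback_isInducing F.indVB f.toFun f.continuous_toFun).continuous
    have hb : Continuous (Tot.base : Tot (F.ind.pullback f).fiber → Y) :=
      (F.ind.pullback f).continuous_base
    refine ind_continuous_iff.2 ⟨hb, fun q => ?_⟩
    refine (VB.pullback_isInducing F.toVB f.toFun f.continuous_toFun).continuous_iff.2 ?_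
    refine ((continuous_const_smul q.out⁻¹).comp hb).prodMk ?_
    refine ((F.continuous_indComp q).comp (continuous_snd.comp hj)).congr fun p => ?_
    exact (F.mk_cast_symm (f.map_smul q.out⁻¹ p.base) _).symm
  map_act g y v := by
    refine Tot.mk_inj (F := F.indVB.fiber) (ind_ext rfl fun q => ?_)
    refine (F.mk_cast _ _).trans ?_
    have h1 := congrArg (fun p : Tot (F.pullback (f.restrict S)).fiber =>
      (⟨f.toFun p.base, p.vec⟩ : Tot F.fiber))
      ((F.pullback (f.restrict S)).indComp_act g q ⟨y, v⟩)
    refine h1.trans ((F.mk_cast _ _).trans ?_)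
    refine Eq.trans ?_ (congrArg (F.indComp q) (F.ind.mk_cast (f.map_smul g y).symm _)).symm
    refine Eq.trans ?_ (F.indComp_act g q ⟨f.toFun y, _⟩).symm
    exact congrArg (F.tact (cosetElt S g q))
      (F.mk_cast (f.map_smul (g⁻¹ • q).out⁻¹ y) (v (g⁻¹ • q))).symm

end Ind

end GVect

/-! ### Suspensions -/

section Susp

/-- The points of `I^n × X_+` collapsed to the base point in `Σ^n X_+`, where `X_+ = X ⊔ {∗}`:
those of `∂I^n × X_+ ∪ I^n × {∗}`. -/
def SuspBase (n : ℕ) (X : Type u) : Set ((Fin n → unitInterval) × (X ⊕ PUnit.{1})) :=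
  {p | p.1 ∈ Cube.boundary (Fin n) ∨ p.2 = Sum.inr PUnit.unit}

def suspSetoid (n : ℕ) (X : Type u) : Setoid ((Fin n → unitInterval) × (X ⊕ PUnit.{1})) where
  r p q := p = q ∨ (p ∈ SuspBase n X ∧ q ∈ SuspBase n X)
  iseqv := by
    refine ⟨fun p => Or.inl rfl, ?_, ?_⟩
    · rintro p q (rfl | ⟨h, h'⟩)
      · exact Or.inl rfl
      · exact Or.inr ⟨h', h⟩
    · rintro p q r (rfl | ⟨h, h'⟩) (rfl | ⟨k, k'⟩)
      · exact Or.inl rfl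
      · exact Or.inr ⟨k, k'⟩
      · exact Or.inr ⟨h, h'⟩
      · exact Or.inr ⟨h, k'⟩

/-- The `n`-fold reduced suspension `Σ^n X_+ = (I^n × X_+) / (∂I^n × X_+ ∪ I^n × {∗})` of `X` with
an added base point. -/
def Susp (n : ℕ) (X : Type u) : Type u := Quotient (suspSetoid n X)

instance (n : ℕ) (X : Type u) [TopologicalSpace X] : TopologicalSpace (Susp n X) :=
  inferInstanceAs (TopologicalSpace (Quotient (suspSetoid n X)))

namespace Susp

variable {n : ℕ} {X : Type u} {Y : Type u'}

/-- The class of a point of `I^n × X_+`. -/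
def mk (p : (Fin n → unitInterval) × (X ⊕ PUnit.{1})) : Susp n X := Quotient.mk _ p

/-- The map of suspensions induced by a map of spaces. -/
def mapFun (n : ℕ) (f : X → Y) : Susp n X → Susp n Y :=
  Quotient.map (fun p => (p.1, Sum.map f id p.2)) (by
    rintro p q (rfl | ⟨h, h'⟩)
    · exact Or.inl rfl
    · refine Or.inr ⟨h.imp_right fun e => ?_, h'.imp_right fun e => ?_⟩
      · simp [e]
      · simp [e])

theorem mapFun_mk (f : X → Y) (p : (Fin n → unitInterval) × (X ⊕ PUnit.{1})) :
    mapFun n f (mk p) = mk (p.1, Sum.map f id p.2) := rfl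

theorem continuous_mapFun [TopologicalSpace X] [TopologicalSpace Y] {f : X → Y}
    (hf : Continuous f) : Continuous (mapFun n f) :=
  Continuous.quotient_map'
    (continuous_fst.prodMk ((hf.sumMap continuous_id).comp continuous_snd)) _

/-- The base point of `Σ^n X_+`. -/
def pt (n : ℕ) (X : Type u) : Susp n X := mk (fun _ => 0, Sum.inr PUnit.unit)

theorem mapFun_pt (f : X → Y) : mapFun n f (pt n X) = pt n Y := rfl

/-- The group acts on `Σ^n X_+` through its action on `X`. -/
instance (priority := 100) {H : Type w} [Group H] [MulAction H X] : MulAction H (Susp n X) where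
  smul h := mapFun n (h • ·)
  one_smul := by
    rintro ⟨t, x | x⟩
    · exact congrArg (fun y => mk (t, Sum.inl y)) (one_smul H x)
    · rfl
  mul_smul := by
    rintro g h ⟨t, x | x⟩
    · exact congrArg (fun y => mk (t, Sum.inl y)) (mul_smul g h x)
    · rfl

instance (priority := 100) {H : Type w} [Group H] [TopologicalSpace X] [MulAction H X]
    [ContinuousConstSMul H X] : ContinuousConstSMul H (Susp n X) :=
  ⟨fun h => continuous_mapFun (continuous_const_smul h)⟩

instance (priority := 100) {A : Type*} {H : Type w} [Group A] [Group H] (i : A →* H)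
    [MulAction H X] [hX : ActsTrivially i X] : ActsTrivially i (Susp n X) where
  smul_eq a := by
    rintro ⟨t, x | x⟩
    · exact congrArg (fun y => mk (t, Sum.inl y)) (hX.smul_eq a x)
    · rfl

end Susp

instance (H : Type w) [Group H] : ContinuousConstSMul H PUnit.{1} := ⟨fun _ => continuous_const⟩

instance {A : Type*} {H : Type w} [Group A] [Group H] (i : A →* H) :
    ActsTrivially i PUnit.{1} := ⟨fun _ _ => rfl⟩

namespace GMap

variable {G : Type w} [Group G] {X : Type u} {Y : Type u'} [TopologicalSpace X] [TopologicalSpace Y]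
  [MulAction G X] [MulAction G Y]

def comp {Z : Type*} [TopologicalSpace Z] [MulAction G Z] (f : GMap G Y X) (g : GMap G Z Y) :
    GMap G Z X :=
  ⟨f.toFun ∘ g.toFun, f.continuous_toFun.comp g.continuous_toFun, fun h z =>
    (congrArg f.toFun (g.map_smul h z)).trans (f.map_smul h _)⟩

/-- The map `Σ^n Y_+ → Σ^n X_+` induced by a `G`-map `Y → X`. -/
def susp (n : ℕ) (f : GMap G Y X) : GMap G (Susp n Y) (Susp n X) where
  toFun := Susp.mapFun n f.toFun
  continuous_toFun := Susp.continuous_mapFun f.continuous_toFun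
  map_smul g := by
    rintro ⟨t, y | y⟩
    · exact congrArg (fun y => Susp.mk (t, Sum.inl y)) (f.map_smul g y)
    · rfl

/-- The inclusion of the base point into `Σ^n X_+`. -/
def suspPt (G : Type w) [Group G] (n : ℕ) (X : Type u) [TopologicalSpace X] [MulAction G X] :
    GMap G PUnit.{1} (Susp n X) :=
  ⟨fun _ => Susp.pt n X, continuous_const, fun _ _ => rfl⟩

theorem susp_comp_pt (n : ℕ) (f : GMap G Y X) : (f.susp n).comp (suspPt G n Y) = suspPt G n X := rfl

end GMap

end Susp

/-! ### Equivariant K-theory -/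

section KTheory

variable (G : Type w) [Group G] (X : Type u) {Y : Type u'} [TopologicalSpace X]
  [TopologicalSpace Y] [MulAction G X] [MulAction G Y] [ContinuousConstSMul G X]
  [ContinuousConstSMul G Y]

/-- `K_G^0(X)`, the Grothendieck group of `Vec_G(X)`. -/
abbrev KG := Algebra.GrothendieckAddGroup (Vec.{u, v} G X)

variable {G X}

/-- The class `[E]` in `K_G^0(X)`. -/
noncomputable def KG.of (E : GVect.{u, v} G X) : KG.{u, v} G X :=
  Algebra.GrothendieckAddGroup.of (Vec.mk E)

/-- `f^* : K_G^0(X) → K_G^0(Y)`. -/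
noncomputable def KG.pullback (f : GMap G Y X) : KG.{u, v} G X →+ KG.{u', v} G Y :=
  grothMap (Vec.pullback f)

def GVect.pullbackComp {Z : Type*} [TopologicalSpace Z] [MulAction G Z] [ContinuousConstSMul G Z]
    (E : GVect.{u, v} G X) (f : GMap G Y X) (g : GMap G Z Y) :
    GVect.Iso ((E.pullback f).pullback g) (E.pullback (f.comp g)) where
  toEquiv z := LinearEquiv.refl ℂ (E.fiber (f.toFun (g.toFun z)))
  continuous_toFun := by
    have h1 := (VB.pullback_isInducing (E.pullback f).toVB g.toFun g.continuous_toFun).continuous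
    have h2 := (VB.pullback_isInducing E.toVB f.toFun f.continuous_toFun).continuous.comp
      (continuous_snd.comp h1)
    refine (VB.pullback_isInducing E.toVB _ (f.comp g).continuous_toFun).continuous_iff.2 ?_
    exact (continuous_fst.comp h1).prodMk (continuous_snd.comp h2)
  continuous_invFun := by
    have h1 := (VB.pullback_isInducing E.toVB _ (f.comp g).continuous_toFun).continuous
    refine (VB.pullback_isInducing (E.pullback f).toVB g.toFun
      g.continuous_toFun).continuous_iff.2 ?_
    refine (continuous_fst.comp h1).prodMk ?_
    refine (VB.pullback_isInducing E.toVB f.toFun f.continuous_toFun).continuous_iff.2 ?_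
    exact (g.continuous_toFun.comp (continuous_fst.comp h1)).prodMk (continuous_snd.comp h1)
  map_act h z v := by
    refine Tot.mk_inj (F := E.fiber) ?_
    have h1 := congrArg (fun p : Tot (E.pullback f).fiber => (⟨f.toFun p.base, p.vec⟩ : Tot E.fiber))
      ((E.pullback f).mk_cast (g.map_smul h z).symm ((E.pullback f).act h (g.toFun z) v))
    refine h1.trans ((E.mk_cast _ _).trans (E.mk_cast _ _).symm)

theorem Vec.pullback_comp {Z : Type*} [TopologicalSpace Z] [MulAction G Z]
    [ContinuousConstSMul G Z] (f : GMap G Y X) (g : GMap G Z Y) (c : Vec.{u, v} G X) :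
    Vec.pullback g (Vec.pullback f c) = Vec.pullback (f.comp g) c := by
  obtain ⟨E⟩ := c
  exact Vec.mk_eq (E.pullbackComp f g)

theorem KG.pullback_comp {Z : Type*} [TopologicalSpace Z] [MulAction G Z]
    [ContinuousConstSMul G Z] (f : GMap G Y X) (g : GMap G Z Y) (ξ : KG.{u, v} G X) :
    KG.pullback g (KG.pullback f ξ) = KG.pullback (f.comp g) ξ := by
  refine DFunLike.congr_fun (f := (KG.pullback g).comp (KG.pullback f)) (groth_ext fun c => ?_) ξ
  simp only [AddMonoidHom.comp_apply, KG.pullback, grothMap_of, Vec.pullback_comp]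

variable (G X)

/-- The reduced group of `Σ^n X_+`: the kernel of the restriction of `K_G^0(Σ^n X_+)` to the base
point. -/
noncomputable def KG.red (n : ℕ) : AddSubgroup (KG.{u, v} G (Susp n X)) :=
  (KG.pullback (GMap.suspPt G n X)).ker

/-- `K_G^n(X)`: the Grothendieck group of `Vec_G(X)` for `n = 0`, and the reduced `K_G^0` of
`Σ^n X_+` for `n > 0`. -/
def KGn : ℕ → Type (max u w (v + 1))
  | 0 => KG.{u, v} G X
  | n + 1 => KG.red.{u, v} G X (n + 1)

noncomputable instance : ∀ n, AddCommGroup (KGn.{u, v} G X n)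
  | 0 => inferInstanceAs (AddCommGroup (KG.{u, v} G X))
  | n + 1 => inferInstanceAs (AddCommGroup (KG.red.{u, v} G X (n + 1)))

variable {G X}

/-- `f^* : K_G^n(X) → K_G^n(Y)`. -/
noncomputable def KGn.pullback (f : GMap G Y X) : ∀ n, KGn.{u, v} G X n →+ KGn.{u', v} G Y n
  | 0 => KG.pullback f
  | n + 1 => ((KG.pullback (f.susp (n + 1))).comp (KG.red.{u, v} G X (n + 1)).subtype).codRestrict
      (KG.red.{u', v} G Y (n + 1)) fun ξ => by
        have h : KG.pullback (GMap.suspPt G (n + 1) X) ξ.1 = 0 := AddMonoidHom.mem_ker.1 ξ.2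
        exact AddMonoidHom.mem_ker.2 ((KG.pullback_comp _ _ _).trans h)

end KTheory

section KTau

variable {G : Type w} [Group G] [Finite G] {A : Subgroup G} [A.Normal] (τ : IrrRep.{v} A)
  (X : Type u) {Y : Type u'}
  [TopologicalSpace X] [MulAction G X] [ContinuousConstSMul G X] [ActsTrivially A.subtype X]
  [TopologicalSpace Y] [MulAction G Y] [ContinuousConstSMul G Y] [ActsTrivially A.subtype Y]

/-- The monoid `Vec_{G_[τ], τ}(X)` of isomorphism classes of `(G_[τ], τ)`-equivariant vector
bundles over `X`. -/
def VecTau : AddSubmonoid (Vec.{u, v} τ.stab X) where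
  carrier := {c | ∃ F : GVect.{u, v} τ.stab X, F.IsIsotypic τ.incl τ ∧ Vec.mk F = c}
  zero_mem' := ⟨_, GVect.IsIsotypic.zero τ.incl τ, rfl⟩
  add_mem' := by
    rintro _ _ ⟨E, hE, rfl⟩ ⟨F, hF, rfl⟩
    exact ⟨_, GVect.IsIsotypic.sum τ.incl τ hE hF, rfl⟩

/-- `K^0_{G_[τ], τ}(X)`, the Grothendieck group of `Vec_{G_[τ], τ}(X)`. -/
abbrev KTau := Algebra.GrothendieckAddGroup (VecTau.{u, v} τ X)

variable {X}

/-- The class `[F]` in `K^0_{G_[τ], τ}(X)`. -/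
noncomputable def KTau.of (F : GVect.{u, v} τ.stab X) (hF : F.IsIsotypic τ.incl τ) :
    KTau.{u, v} τ X :=
  Algebra.GrothendieckAddGroup.of (⟨Vec.mk F, F, hF, rfl⟩ : VecTau.{u, v} τ X)

/-- Pullback of classes of `(G_[τ], τ)`-equivariant bundles along a `G`-map. -/
def VecTau.pullback (f : GMap G Y X) : VecTau.{u, v} τ X →+ VecTau.{u', v} τ Y :=
  ((Vec.pullback (f.restrict τ.stab)).comp (VecTau.{u, v} τ X).subtype).codRestrict
    (VecTau.{u', v} τ Y) (by
      rintro ⟨_, F, hF, rfl⟩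
      exact ⟨_, hF.pullback τ.incl τ _, rfl⟩)

/-- `f^* : K^0_{G_[τ], τ}(X) → K^0_{G_[τ], τ}(Y)`. -/
noncomputable def KTau.pullback (f : GMap G Y X) : KTau.{u, v} τ X →+ KTau.{u', v} τ Y :=
  grothMap (VecTau.pullback τ f)

theorem KTau.pullback_comp {Z : Type*} [TopologicalSpace Z] [MulAction G Z]
    [ContinuousConstSMul G Z] [ActsTrivially A.subtype Z] (f : GMap G Y X) (g : GMap G Z Y)
    (ξ : KTau.{u, v} τ X) :
    KTau.pullback τ g (KTau.pullback τ f ξ) = KTau.pullback τ (f.comp g) ξ := by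
  refine DFunLike.congr_fun (f := (KTau.pullback τ g).comp (KTau.pullback τ f))
    (groth_ext fun c => ?_) ξ
  simp only [AddMonoidHom.comp_apply, KTau.pullback, grothMap_of]
  exact congrArg _ (Subtype.ext (Vec.pullback_comp _ _ _))

variable (X)

/-- The reduced group of `Σ^n X_+`. -/
noncomputable def KTau.red (n : ℕ) : AddSubgroup (KTau.{u, v} τ (Susp n X)) :=
  (KTau.pullback τ (GMap.suspPt G n X)).ker

/-- `K^n_{G_[τ], τ}(X)`: the Grothendieck group of `Vec_{G_[τ], τ}(X)` for `n = 0`, and the reduced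
`K^0_{G_[τ], τ}` of `Σ^n X_+` for `n > 0`. -/
def KTaun : ℕ → Type (max u w (v + 1))
  | 0 => KTau.{u, v} τ X
  | n + 1 => KTau.red.{u, v} τ X (n + 1)

noncomputable instance : ∀ n, AddCommGroup (KTaun.{u, v} τ X n)
  | 0 => inferInstanceAs (AddCommGroup (KTau.{u, v} τ X))
  | n + 1 => inferInstanceAs (AddCommGroup (KTau.red.{u, v} τ X (n + 1)))

variable {X}

/-- `f^* : K^n_{G_[τ], τ}(X) → K^n_{G_[τ], τ}(Y)`. -/
noncomputable def KTaun.pullback (f : GMap G Y X) :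
    ∀ n, KTaun.{u, v} τ X n →+ KTaun.{u', v} τ Y n
  | 0 => KTau.pullback τ f
  | n + 1 =>
    ((KTau.pullback τ (f.susp (n + 1))).comp (KTau.red.{u, v} τ X (n + 1)).subtype).codRestrict
      (KTau.red.{u', v} τ Y (n + 1)) fun ξ => by
        have h : KTau.pullback τ (GMap.suspPt G (n + 1) X) ξ.1 = 0 := AddMonoidHom.mem_ker.1 ξ.2
        exact AddMonoidHom.mem_ker.2 ((KTau.pullback_comp τ _ _ _).trans h)

/-- `[E] ↦ [V_τ ⊗ Hom_A(V_τ, E)]` on isomorphism classes of `G`-vector bundles. -/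
noncomputable def vecPsi : Vec.{u, v} G X →+ VecTau.{u, v} τ X where
  toFun := Quotient.lift
    (fun E => ⟨Vec.mk (E.isotypic τ), E.isotypic τ, E.isotypic_isIsotypic τ, rfl⟩)
    fun _ _ ⟨e⟩ => Subtype.ext (Vec.mk_eq (GVect.isotypicCongr τ e))
  map_zero' := Subtype.ext (Vec.mk_eq (GVect.isotypicZero τ))
  map_add' := by
    rintro ⟨E⟩ ⟨F⟩
    exact Subtype.ext (Vec.mk_eq (GVect.isotypicSum τ E F))

/-- The homomorphism `K_G^0(X) → K^0_{G_[τ], τ}(X)`, `[E] ↦ [V_τ ⊗ Hom_A(V_τ, E)]`. -/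
noncomputable def psi : KG.{u, v} G X →+ KTau.{u, v} τ X := grothMap (vecPsi τ)

theorem psi_of (E : GVect.{u, v} G X) :
    psi τ (KG.of E) = KTau.of τ (E.isotypic τ) (E.isotypic_isIsotypic τ) := grothMap_of _ _

theorem psi_pullback (f : GMap G Y X) (ξ : KG.{u, v} G X) :
    psi τ (KG.pullback f ξ) = KTau.pullback τ f (psi τ ξ) := by
  refine DFunLike.congr_fun (f := (psi τ).comp (KG.pullback f))
    (g := (KTau.pullback τ f).comp (psi τ)) (groth_ext fun c => ?_) ξ
  simp only [AddMonoidHom.comp_apply, KTau.pullback, KG.pullback, psi, grothMap_of]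
  obtain ⟨E⟩ := c
  exact congrArg _ (Subtype.ext (Vec.mk_eq (GVect.isotypicPullback τ E f)))

/-- The homomorphism `K_G^n(X) → K^n_{G_[τ], τ}(X)` given by `E ↦ V_τ ⊗ Hom_A(V_τ, E)`, applied to
bundles over `X` for `n = 0` and over `Σ^n X_+` for `n > 0`. -/
noncomputable def psin : ∀ n, KGn.{u, v} G X n →+ KTaun.{u, v} τ X n
  | 0 => psi τ
  | n + 1 => ((psi τ).comp (KG.red.{u, v} G X (n + 1)).subtype).codRestrict
      (KTau.red.{u, v} τ X (n + 1)) fun ξ => by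
        have h : KG.pullback (GMap.suspPt G (n + 1) X) ξ.1 = 0 := AddMonoidHom.mem_ker.1 ξ.2
        refine AddMonoidHom.mem_ker.2 ?_
        refine (psi_pullback τ (GMap.suspPt G (n + 1) X) _).symm.trans ?_
        exact (congrArg _ h).trans (map_zero _)

end KTau

section KInd

variable {G : Type v} [Group G] [Finite G] {A : Subgroup G} [A.Normal] (τ : IrrRep.{v} A)
  {X : Type u} {Y : Type u'}
  [TopologicalSpace X] [MulAction G X] [ContinuousConstSMul G X] [ActsTrivially A.subtype X]
  [TopologicalSpace Y] [MulAction G Y] [ContinuousConstSMul G Y] [ActsTrivially A.subtype Y]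

/-- `[F] ↦ [Ind F]` on isomorphism classes. -/
noncomputable def vecInd (S : Subgroup G) : Vec.{u, v} S X →+ Vec.{u, v} G X where
  toFun := Quotient.map (fun F => F.ind) fun _ _ ⟨e⟩ => ⟨GVect.indCongr e⟩
  map_zero' := Vec.mk_eq (GVect.indZero S X)
  map_add' := by rintro ⟨E⟩ ⟨F⟩; exact Vec.mk_eq (GVect.indSum E F)

/-- The homomorphism `K^0_{G_[τ], τ}(X) → K_G^0(X)`, `[F] ↦ [Ind F]`, of induction from `G_[τ]`
to `G`. -/
noncomputable def kInd : KTau.{u, v} τ X →+ KG.{u, v} G X :=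
  grothMap ((vecInd τ.stab).comp (VecTau.{u, v} τ X).subtype)

theorem kInd_of (F : GVect.{u, v} τ.stab X) (hF : F.IsIsotypic τ.incl τ) :
    kInd τ (KTau.of τ F hF) = KG.of F.ind := grothMap_of _ _

theorem kInd_pullback (f : GMap G Y X) (η : KTau.{u, v} τ X) :
    kInd τ (KTau.pullback τ f η) = KG.pullback f (kInd τ η) := by
  refine DFunLike.congr_fun (f := (kInd τ).comp (KTau.pullback τ f))
    (g := (KG.pullback f).comp (kInd τ)) (groth_ext fun c => ?_) η
  simp only [AddMonoidHom.comp_apply, KTau.pullback, KG.pullback, kInd, grothMap_of]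
  obtain ⟨_, F, hF, rfl⟩ := c
  exact congrArg _ (Vec.mk_eq (GVect.indPullback F f))

/-- Induction `K^n_{G_[τ], τ}(X) → K_G^n(X)`. -/
noncomputable def kIndn : ∀ n, KTaun.{u, v} τ X n →+ KGn.{u, v} G X n
  | 0 => kInd τ
  | n + 1 => ((kInd τ).comp (KTau.red.{u, v} τ X (n + 1)).subtype).codRestrict
      (KG.red.{u, v} G X (n + 1)) fun η => by
        have h : KTau.pullback τ (GMap.suspPt G (n + 1) X) η.1 = 0 := AddMonoidHom.mem_ker.1 η.2
        refine AddMonoidHom.mem_ker.2 ?_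
        refine (kInd_pullback τ (GMap.suspPt G (n + 1) X) _).symm.trans ?_
        exact (congrArg _ h).trans (map_zero _)

end KInd

/-! ### Spaces and orbits -/

/-- A compact Hausdorff `G`-space on which the subgroup `A` acts trivially. -/
structure TrivSpace {G : Type v} [Group G] (A : Subgroup G) : Type (max v (u + 1)) where
  carrier : Type u
  [top : TopologicalSpace carrier]
  [compact : CompactSpace carrier]
  [t2 : T2Space carrier]
  [action : MulAction G carrier]
  [cont : ContinuousConstSMul G carrier]
  [triv : ActsTrivially A.subtype carrier]

attribute [instance] TrivSpace.top TrivSpace.compact TrivSpace.t2 TrivSpace.action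
  TrivSpace.cont TrivSpace.triv

instance {G : Type v} [Group G] (A : Subgroup G) :
    CoeSort (TrivSpace.{u, v} A) (Type u) := ⟨TrivSpace.carrier⟩

/-- The set `G \ Irr(A)` of orbits. -/
abbrev IrrOrbit {G : Type v} [Group G] (A : Subgroup G) [A.Normal] :=
  MulAction.orbitRel.Quotient G (Irr.{v} A)

/-- The orbit of the class of an irreducible representation. -/
def orbitOf {G : Type v} [Group G] {A : Subgroup G} [A.Normal] (σ : IrrRep.{v} A) : IrrOrbit A :=
  Quotient.mk _ (Irr.mk σ)

end EqK

/-!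
The projection of a representation of `A` onto its `τ`-isotypic part is a combination of the
operators of `A` whose coefficients depend on `τ` only. Applied fibrewise it is therefore
continuous, and it exhibits `V_τ ⊗ Hom_A(V_τ, E)` as a `G_[τ]`-equivariant direct summand of `E`.
An element `g` carries the `σ`-isotypic part of `E_x` to the `g • σ`-isotypic part of `E_{g x}`. So
the translates of that summand are indexed by `G / G_[τ]` and independent: their sum, which is the
part of `E` belonging to the orbit of `τ`, is the bundle induced from `V_τ ⊗ Hom_A(V_τ, E)`.
Conversely, if `F` is `(G_[τ], τ)`-equivariant, the summand of `Ind F` at a coset `q` is of type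
`q • τ`, so that the `τ`-isotypic part of `Ind F` is the summand `F` at the trivial coset and
representations outside the orbit of `τ` do not occur. Induction thus inverts `Ψ` already on
isomorphism classes of bundles.
-/

namespace EqK

open TensorProduct Topology

section EvRep

variable {A : Type w} [Group A] {τ τ' : IrrRep.{v} A} {W W' : Type v} [AddCommGroup W]
  [Module ℂ W] [AddCommGroup W'] [Module ℂ W'] {σ : Representation ℂ A W}
  {σ' : Representation ℂ A W'}

theorem apply_mem_range_evRep (f : τ.ρ.IntertwiningMap σ) (v : τ.V) :
    f v ∈ LinearMap.range (evRep τ σ) :=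
  ⟨v ⊗ₜ f, rfl⟩

theorem range_evRep_le_iff {p : Submodule ℂ W} :
    LinearMap.range (evRep τ σ) ≤ p ↔ ∀ (f : τ.ρ.IntertwiningMap σ) v, f v ∈ p := by
  refine ⟨fun h f v => h (apply_mem_range_evRep f v), fun h => ?_⟩
  rw [LinearMap.range_eq_map, ← TensorProduct.span_tmul_eq_top, Submodule.map_span_le]
  rintro _ ⟨v, f, rfl⟩
  exact h f v

theorem map_range_evRep_le (φ : W →ₗ[ℂ] W') (hφ : ∀ a w, φ (σ a w) = σ' a (φ w)) :
    (LinearMap.range (evRep τ σ)).map φ ≤ LinearMap.range (evRep τ σ') :=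
  Submodule.map_le_iff_le_comap.2 <| range_evRep_le_iff.2 fun f => apply_mem_range_evRep
    ⟨φ ∘ₗ f.toLinearMap, fun a => LinearMap.ext fun v =>
      (congrArg φ (f.isIntertwining _ _ a v)).trans (hφ a (f v))⟩

theorem map_range_evRep_le_conj {G : Type*} [Group G] {A : Subgroup G} [A.Normal]
    {τ : IrrRep.{v} A} {σ : Representation ℂ A W} {σ' : Representation ℂ A W'} (g : G)
    (φ : W →ₗ[ℂ] W') (hφ : ∀ a w, φ (σ (MulAut.conjNormal g⁻¹ a) w) = σ' a (φ w)) :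
    (LinearMap.range (evRep τ σ)).map φ ≤ LinearMap.range (evRep (τ.conj g) σ') :=
  Submodule.map_le_iff_le_comap.2 <| range_evRep_le_iff.2 fun f v =>
    apply_mem_range_evRep (τ := τ.conj g)
      ⟨φ ∘ₗ f.toLinearMap, fun a => LinearMap.ext fun w : τ.V =>
        (congrArg φ (f.isIntertwining _ _ (MulAut.conjNormal g⁻¹ a) w)).trans (hφ a (f w))⟩ v

theorem range_evRep_le_of_mk_eq (h : Irr.mk τ = Irr.mk τ') :
    LinearMap.range (evRep τ σ) ≤ LinearMap.range (evRep τ' σ) := by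
  obtain ⟨e⟩ := Quotient.exact (s := IrrRep.setoid.{v} A) h
  refine range_evRep_le_iff.2 fun f v => ?_
  rw [← e.symm_apply_apply v]
  exact apply_mem_range_evRep (f.comp e.symm.toIntertwiningMap) (e v)

theorem range_evRep_eq_of_mk_eq (h : Irr.mk τ = Irr.mk τ') :
    LinearMap.range (evRep τ σ) = LinearMap.range (evRep τ' σ) :=
  (range_evRep_le_of_mk_eq h).antisymm (range_evRep_le_of_mk_eq h.symm)

theorem range_evRep_eq_bot_of_mk_ne (h : Irr.mk τ ≠ Irr.mk τ') :
    LinearMap.range (evRep τ τ'.ρ) = ⊥ := by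
  have : IsEmpty (τ.ρ.Equiv τ'.ρ) := ⟨fun e => h (Quotient.sound ⟨e⟩)⟩
  refine le_bot_iff.1 (range_evRep_le_iff.2 fun f v => ?_)
  rw [Subsingleton.elim f 0]
  exact zero_mem _

theorem Irr.mk_out (t : Irr.{v} A) : Irr.mk (Quotient.out t) = t := Quotient.out_eq t

end EvRep

section IsotypicProjection

variable {A : Type w} [Group A] [Finite A] (τ : IrrRep.{v} A)

theorem exists_isotypicCoeff : ∃ c : A → ℂ,
    ∀ {W : Type v} [AddCommGroup W] [Module ℂ W] (σ : Representation ℂ A W),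
      ∃ r : W →ₗ[ℂ] τ.V ⊗[ℂ] (τ.ρ.IntertwiningMap σ),
        (∀ t, r (evRep τ σ t) = t) ∧ ∀ e, evRep τ σ (r e) = ∑ᶠ a, c a • σ a e := by
  have := Fintype.ofFinite A
  simpa only [finsum_eq_sum_of_fintype] using exists_retraction τ

/-- Coefficients `c` for which `∑ₐ c a • σ a` is the projection onto the `τ`-isotypic part of
every representation `σ`. -/
noncomputable def isotypicCoeff : A → ℂ := (exists_isotypicCoeff τ).choose

variable {W : Type v} [AddCommGroup W] [Module ℂ W] (σ : Representation ℂ A W)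

/-- The retraction of the evaluation `V_τ ⊗ Hom_A(V_τ, W) → W` whose composite with evaluation
is the projection with coefficients `isotypicCoeff τ`. -/
noncomputable def evRetr : W →ₗ[ℂ] τ.V ⊗[ℂ] (τ.ρ.IntertwiningMap σ) :=
  ((exists_isotypicCoeff τ).choose_spec σ).choose

theorem evRetr_evRep (t : τ.V ⊗[ℂ] (τ.ρ.IntertwiningMap σ)) : evRetr τ σ (evRep τ σ t) = t :=
  ((exists_isotypicCoeff τ).choose_spec σ).choose_spec.1 t

theorem evRep_evRetr (e : W) :
    evRep τ σ (evRetr τ σ e) = ∑ᶠ a, isotypicCoeff τ a • σ a e :=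
  ((exists_isotypicCoeff τ).choose_spec σ).choose_spec.2 e

variable {τ σ}

theorem evRetr_eq_zero_of_mem_range {τ' : IrrRep.{v} A} (h : Irr.mk τ ≠ Irr.mk τ') {e : W}
    (he : e ∈ LinearMap.range (evRep τ' σ)) : evRetr τ σ e = 0 := by
  have range_le_ker : LinearMap.range (evRep τ' σ) ≤ LinearMap.ker (evRetr τ σ) := by
    refine range_evRep_le_iff.2 fun f v => LinearMap.mem_ker.2 (evRep_injective τ σ ?_)
    have natural : evRep τ σ (evRetr τ σ (f v)) = f (evRep τ τ'.ρ (evRetr τ τ'.ρ v)) := by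
      have := Fintype.ofFinite A
      simp only [evRep_evRetr, finsum_eq_sum_of_fintype, map_sum, map_smul,
        Representation.IntertwiningMap.isIntertwining]
    have vanish : evRep τ τ'.ρ (evRetr τ τ'.ρ v) = 0 :=
      (Submodule.mem_bot ℂ).1 (range_evRep_eq_bot_of_mk_ne h ▸ LinearMap.mem_range_self _ _)
    rw [natural, vanish, map_zero, map_zero]
  exact range_le_ker he

theorem iSupIndep_range_evRep :
    iSupIndep fun t : Irr.{v} A => LinearMap.range (evRep (Quotient.out t) σ) := by
  refine fun t => Submodule.disjoint_def.2 ?_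
  rintro _ ⟨s, rfl⟩ hs
  have iSup_le_ker : (⨆ t' : Irr.{v} A, ⨆ _ : t' ≠ t, LinearMap.range (evRep (Quotient.out t') σ)) ≤
      LinearMap.ker (evRetr (Quotient.out t) σ) :=
    iSup₂_le fun t' ht' _ => evRetr_eq_zero_of_mem_range (by
      rw [Irr.mk_out, Irr.mk_out]; exact ht'.symm)
  rw [← evRetr_evRep (Quotient.out t) σ s, LinearMap.mem_ker.1 (iSup_le_ker hs), map_zero]

end IsotypicProjection

section Semisimple

variable {A : Type w} [Group A] {W : Type v} [AddCommGroup W] [Module ℂ W]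
  {σ : Representation ℂ A W}

theorem isIrreducible_toRepresentation_of_isAtom {a : Subrepresentation σ} (ha : IsAtom a) :
    a.toRepresentation.IsIrreducible := by
  let f : Subrepresentation a.toRepresentation ≃o Set.Iic a :=
    { toFun := fun s => ⟨⟨s.toSubmodule.map a.toSubmodule.subtype, by
          rintro g _ ⟨v, hv, rfl⟩
          exact ⟨_, s.apply_mem_toSubmodule g hv, rfl⟩⟩, by
          rintro _ ⟨v, -, rfl⟩
          exact v.2⟩
      invFun := fun s => ⟨s.1.toSubmodule.comap a.toSubmodule.subtype, fun g v hv =>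
        s.1.apply_mem_toSubmodule g hv⟩
      left_inv := fun s => Subrepresentation.toSubmodule_injective
        (Submodule.comap_map_eq_of_injective Subtype.val_injective _)
      right_inv := fun s => Subtype.ext (Subrepresentation.toSubmodule_injective
        (Submodule.map_comap_subtype _ _ |>.trans (inf_eq_right.2 s.2)))
      map_rel_iff' := fun {s t} => Submodule.map_le_map_iff_of_injective
        (f := a.toSubmodule.subtype) Subtype.val_injective s.toSubmodule t.toSubmodule }
  exact f.isSimpleOrder_iff.2 (Set.isSimpleOrder_Iic_iff_isAtom.2 ha)

variable [FiniteDimensional ℂ W]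

theorem toSubmodule_le_iSup_range_evRep_of_isAtom {a : Subrepresentation σ} (ha : IsAtom a) :
    a.toSubmodule ≤ ⨆ t : Irr.{v} A, LinearMap.range (evRep (Quotient.out t) σ) := by
  let α : IrrRep.{v} A :=
    ⟨a.toSubmodule, a.toRepresentation, isIrreducible_toRepresentation_of_isAtom ha⟩
  have hα : a.toSubmodule ≤ LinearMap.range (evRep α σ) := fun v hv =>
    apply_mem_range_evRep (τ := α) ⟨a.toSubmodule.subtype, fun _ => rfl⟩ ⟨v, hv⟩
  rw [range_evRep_eq_of_mk_eq (Irr.mk_out (Irr.mk α)).symm] at hα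
  exact hα.trans (le_iSup (fun t : Irr.{v} A => LinearMap.range (evRep (Quotient.out t) σ)) _)

variable [Finite A]

variable (σ) in
theorem iSup_range_evRep :
    ⨆ t : Irr.{v} A, LinearMap.range (evRep (Quotient.out t) σ) = ⊤ := by
  let U : Subrepresentation σ := ⟨⨆ t : Irr.{v} A, LinearMap.range (evRep (Quotient.out t) σ),
    fun a => (iSup_le fun t => range_evRep_le_iff.2 fun f v => Submodule.mem_comap.2 <|
      Submodule.mem_iSup_of_mem t (f.isIntertwining _ _ a v ▸ apply_mem_range_evRep f _) :
      _ ≤ Submodule.comap (σ a) _)⟩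
  let e := Subrepresentation.subrepresentationSubmoduleOrderIso (ρ := σ)
  have : NeZero (Nat.card A : ℂ) := ⟨Nat.cast_ne_zero.2 Nat.card_pos.ne'⟩
  have hU : e U = ⊤ := by
    rw [eq_top_iff, ← IsSemisimpleModule.sSup_simples_eq_top]
    refine sSup_le fun m hm => (e.symm_apply_le).1 ?_
    exact toSubmodule_le_iSup_range_evRep_of_isAtom
      ((OrderIso.isAtom_iff e.symm m).2 (isSimpleModule_iff_isAtom.1 hm))
  exact congrArg Subrepresentation.toSubmodule ((map_eq_top_iff e).1 hU)

theorem linearMap_ext_of_eqOn_range_evRep {M : Type*} [AddCommGroup M] [Module ℂ M]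
    {φ ψ : W →ₗ[ℂ] M}
    (h : ∀ τ : IrrRep.{v} A, Set.EqOn φ ψ (LinearMap.range (evRep τ σ))) : φ = ψ := by
  refine LinearMap.eqLocus_eq_top.1 (eq_top_iff.2 ?_)
  rw [← iSup_range_evRep σ]
  exact iSup_le fun t => h _

theorem bijective_toModule_evRep [DecidableEq (Irr.{v} A)] :
    Function.Bijective
      (DirectSum.toModule ℂ (Irr.{v} A) W fun t => evRep (Quotient.out t) σ) := by
  have isInternal : DirectSum.IsInternal fun t : Irr.{v} A =>
      LinearMap.range (evRep (Quotient.out t) σ) :=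
    DirectSum.isInternal_submodule_of_iSupIndep_of_iSup_eq_top iSupIndep_range_evRep
      (iSup_range_evRep σ)
  have factor : DirectSum.toModule ℂ (Irr.{v} A) W (fun t => evRep (Quotient.out t) σ) =
      DirectSum.coeLinearMap (fun t : Irr.{v} A => LinearMap.range (evRep (Quotient.out t) σ)) ∘ₗ
        DirectSum.lmap fun t => (evRep (Quotient.out t) σ).rangeRestrict :=
    DirectSum.linearMap_ext ℂ fun t => LinearMap.ext fun s => by
      simp only [LinearMap.comp_apply, DirectSum.lmap_lof, DirectSum.toModule_lof,
        DirectSum.coeLinearMap_lof]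
      rfl
  rw [factor]
  exact isInternal.comp
    ⟨(DirectSum.lmap_injective _).2 fun t =>
        (evRep_injective (Quotient.out t) σ).codRestrict _,
      (DirectSum.lmap_surjective _).2 fun t => LinearMap.surjective_rangeRestrict _⟩

end Semisimple

section Finiteness

variable {A : Type v} [Group A] [Finite A]

theorem range_evRep_leftRegular_ne_bot (τ : IrrRep.{v} A) :
    LinearMap.range (evRep τ (Representation.leftRegular ℂ A)) ≠ ⊥ := by
  intro hbot
  have : Nontrivial τ.V :=
    IsSimpleModule.nontrivial (MonoidAlgebra ℂ A) (Representation.asModule τ.ρ)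
  obtain ⟨v, hv⟩ := exists_ne (0 : τ.V)
  let f := (Representation.leftRegularMapEquiv τ.ρ).symm v
  have hf : f.toLinearMap = 0 :=
    linearMap_ext_of_eqOn_range_evRep (σ := Representation.leftRegular ℂ A) fun τ' w hw => by
      by_cases h : Irr.mk τ' = Irr.mk τ
      · rw [range_evRep_eq_of_mk_eq h, hbot, SetLike.mem_coe, Submodule.mem_bot] at hw
        rw [hw, map_zero, map_zero]
      · have := map_range_evRep_le f.toLinearMap (f.isIntertwining _ _)
          (Submodule.mem_map_of_mem hw)
        rwa [range_evRep_eq_bot_of_mk_ne h] at this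
  have hv' : f (.single 1 1) = v := by
    rw [Representation.leftRegularMapEquiv_symm_single, map_one, Module.End.one_apply]
  exact hv (hv'.symm.trans (LinearMap.congr_fun hf _))

theorem finite_irr (A : Type v) [Group A] [Finite A] : Finite (Irr.{v} A) :=
  WellFoundedGT.finite_of_iSupIndep iSupIndep_range_evRep
    fun t => range_evRep_leftRegular_ne_bot (Quotient.out t)

end Finiteness

instance {G : Type v} [Group G] [Finite G] (A : Subgroup G) [A.Normal] : Finite (IrrOrbit A) :=
  have := finite_irr A
  Quotient.finite _

theorem VB.finiteDimensional_fiber {X : Type u} [TopologicalSpace X] (E : VB.{u, v} X) (x : X) :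
    FiniteDimensional ℂ (E.fiber x) := by
  obtain ⟨U, -, hx, n, φ, ψ, left_inv, -⟩ := E.locTriv x
  exact Module.Finite.of_surjective (ψ x) fun e => ⟨φ x e, left_inv x hx e⟩

namespace GVect

section Hom

variable {G : Type w} [Group G] {X : Type u} [TopologicalSpace X] [MulAction G X]
  {E F : GVect.{u, v} G X}

/-- The map of total spaces underlying a homomorphism of `G`-vector bundles. -/
def Hom.map (φ : Hom E F) (p : Tot E.fiber) : Tot F.fiber := ⟨p.base, φ.toFun p.base p.vec⟩

theorem Hom.map_tact (φ : Hom E F) (g : G) (p : Tot E.fiber) :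
    φ.map (E.tact g p) = F.tact g (φ.map p) :=
  congrArg (Tot.mk _) (φ.map_act g p.base p.vec)

theorem Hom.map_fiberRep {A : Type*} [Group A] (i : A →* G) [ActsTrivially i X] (φ : Hom E F)
    (x : X) (a : A) (v : E.fiber x) :
    φ.toFun x (E.fiberRep i x a v) = F.fiberRep i x a (φ.toFun x v) := by
  apply Tot.mk_inj (F := F.fiber)
  rw [mk_fiberRep]
  exact (congrArg φ.map (E.mk_fiberRep i x a v)).trans (φ.map_tact (i a) ⟨x, v⟩)

variable (E) in
/-- The `S`-vector bundle obtained from a `G`-vector bundle by restricting the action to a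
subgroup. -/
abbrev res (S : Subgroup G) : GVect.{u, v} S X where
  toVB := E.toVB
  act s := E.act s
  act_one := E.act_one
  act_mul s s' := E.act_mul s s'
  continuous_act s := E.continuous_act s

end Hom

section Retract

variable {G : Type w} [Group G] {X : Type u} [TopologicalSpace X] [MulAction G X]
  {E P Q : GVect.{u, v} G X}

/-- An inclusion of `P` as a direct summand of the `G`-vector bundle `E`, together with an
equivariant projection onto it. -/
structure Retract (P E : GVect.{u, v} G X) where
  incl : Hom P E
  proj : Hom E P
  proj_incl : ∀ x v, proj.toFun x (incl.toFun x v) = v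

namespace Retract

theorem incl_proj_of_mem_range (r : Retract P E) {x : X} {e : E.fiber x}
    (he : e ∈ LinearMap.range (r.incl.toFun x)) : r.incl.toFun x (r.proj.toFun x e) = e := by
  obtain ⟨v, rfl⟩ := he
  rw [r.proj_incl]

/-- Two direct summands of `E` with the same fibres inside `E` are isomorphic. -/
def isoOfRangeEq (r : Retract P E) (s : Retract Q E)
    (h : ∀ x, LinearMap.range (r.incl.toFun x) = LinearMap.range (s.incl.toFun x)) : Iso P Q where
  toEquiv x := LinearEquiv.ofLinearMap (s.proj.toFun x ∘ₗ r.incl.toFun x)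
    (r.proj.toFun x ∘ₗ s.incl.toFun x)
    (LinearMap.ext fun v => (congrArg (s.proj.toFun x) (r.incl_proj_of_mem_range
      (h x ▸ LinearMap.mem_range_self _ v))).trans (s.proj_incl x v))
    (LinearMap.ext fun v => (congrArg (r.proj.toFun x) (s.incl_proj_of_mem_range
      (h x ▸ LinearMap.mem_range_self _ v))).trans (r.proj_incl x v))
  continuous_toFun := s.proj.continuous_toFun.comp r.incl.continuous_toFun
  continuous_invFun := r.proj.continuous_toFun.comp s.incl.continuous_toFun
  map_act g x v :=
    (congrArg (s.proj.toFun (g • x)) (r.incl.map_act g x v)).trans (s.proj.map_act g x _)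

/-- Every `G`-vector bundle is a direct summand of itself. -/
protected def refl (E : GVect.{u, v} G X) : Retract E E where
  incl := ⟨fun _ => LinearMap.id, continuous_id, fun _ _ _ => rfl⟩
  proj := ⟨fun _ => LinearMap.id, continuous_id, fun _ _ _ => rfl⟩
  proj_incl _ _ := rfl

/-- The zero bundle as a direct summand of `E`. -/
protected def zero [ContinuousConstSMul G X] (E : GVect.{u, v} G X) :
    Retract (GVect.zero G X) E where
  incl := ⟨fun _ => 0, E.continuous_zero (GVect.zero.{u, v} G X).continuous_base,
    fun g x _ => (map_zero (E.act g x)).symm⟩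
  proj := ⟨fun _ => 0, (GVect.zero.{u, v} G X).continuous_zero E.continuous_base,
    fun _ _ _ => rfl⟩
  proj_incl _ _ := rfl

/-- The sum of two direct summands of `E` each of which is annihilated by the projection onto
the other. -/
protected def sum (r : Retract P E) (s : Retract Q E)
    (hsr : ∀ x v, s.proj.toFun x (r.incl.toFun x v) = 0)
    (hrs : ∀ x v, r.proj.toFun x (s.incl.toFun x v) = 0) : Retract (P.sum Q) E where
  incl :=
    { toFun := fun x => (r.incl.toFun x).coprod (s.incl.toFun x)
      continuous_toFun :=
        have hPQ := (VB.prod_isInducing P.toVB Q.toVB).continuous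
        E.continuous_add (r.incl.continuous_toFun.comp (continuous_fst.comp hPQ))
          (s.incl.continuous_toFun.comp (continuous_snd.comp hPQ))
      map_act := fun g x t =>
        (congrArg₂ (· + ·) (r.incl.map_act g x t.1) (s.incl.map_act g x t.2)).trans
          (map_add (E.act g x) _ _).symm }
  proj :=
    { toFun := fun x => (r.proj.toFun x).prod (s.proj.toFun x)
      continuous_toFun := (VB.prod_isInducing P.toVB Q.toVB).continuous_iff.2
        (r.proj.continuous_toFun.prodMk s.proj.continuous_toFun)
      map_act := fun g x e => Prod.ext (r.proj.map_act g x e) (s.proj.map_act g x e) }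
  proj_incl x := by
    rintro ⟨t, t'⟩
    refine Prod.ext ?_ ?_
    · change r.proj.toFun x (r.incl.toFun x t + s.incl.toFun x t') = t
      rw [map_add, r.proj_incl, hrs, add_zero]
    · change s.proj.toFun x (r.incl.toFun x t + s.incl.toFun x t') = t'
      rw [map_add, hsr, s.proj_incl, zero_add]

variable {ι : Type*} {P : ι → GVect.{u, v} G X} {r : ∀ o, Retract (P o) E}

theorem exists_retract_finset_sum [ContinuousConstSMul G X]
    (hr : ∀ o o' x v, o ≠ o' → (r o').proj.toFun x ((r o).incl.toFun x v) = 0) (s : Finset ι) :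
    ∃ (S : GVect.{u, v} G X) (R : Retract S E), Vec.mk S = ∑ o ∈ s, Vec.mk (P o) ∧
      ∀ x e, R.incl.toFun x (R.proj.toFun x e) =
        ∑ o ∈ s, (r o).incl.toFun x ((r o).proj.toFun x e) := by
  induction s using Finset.cons_induction with
  | empty => exact ⟨_, Retract.zero E, rfl, fun x e => rfl⟩
  | cons o s ho ih =>
    obtain ⟨S, R, hS, hR⟩ := ih
    have ne_of_mem {o'} (ho' : o' ∈ s) : o' ≠ o := ne_of_mem_of_not_mem ho' ho
    have proj_incl_R x v : (r o).proj.toFun x (R.incl.toFun x v) = 0 := by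
      rw [← R.proj_incl x v, hR, map_sum]
      exact Finset.sum_eq_zero fun o' ho' => hr _ _ _ _ (ne_of_mem ho')
    have R_proj_incl x v : R.proj.toFun x ((r o).incl.toFun x v) = 0 := by
      rw [← R.proj_incl x (R.proj.toFun x _), hR, Finset.sum_eq_zero, map_zero]
      intro o' ho'
      rw [hr o o' x v (ne_of_mem ho').symm, map_zero]
    refine ⟨_, (r o).sum R R_proj_incl proj_incl_R, ?_, fun x e => ?_⟩
    · rw [Finset.sum_cons, ← hS, Vec.mk_add]
    · rw [Finset.sum_cons, ← hR]
      rfl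

variable [Finite ι]

theorem mk_eq_finsum_mk [ContinuousConstSMul G X]
    (hr : ∀ o o' x v, o ≠ o' → (r o').proj.toFun x ((r o).incl.toFun x v) = 0)
    (hsum : ∀ x e, ∑ᶠ o, (r o).incl.toFun x ((r o).proj.toFun x e) = e) :
    Vec.mk E = ∑ᶠ o, Vec.mk (P o) := by
  have := Fintype.ofFinite ι
  simp only [finsum_eq_sum_of_fintype] at hsum ⊢
  obtain ⟨S, R, hS, hR⟩ := exists_retract_finset_sum hr Finset.univ
  have incl_surjective x : LinearMap.range (R.incl.toFun x) = ⊤ :=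
    LinearMap.range_eq_top.2 fun e => ⟨R.proj.toFun x e, (hR x e).trans (hsum x e)⟩
  rw [← hS]
  exact Vec.mk_eq ((Retract.refl E).isoOfRangeEq R fun x =>
    LinearMap.range_id.trans (incl_surjective x).symm)

theorem finsum_incl_proj {x : X}
    (hr : ∀ o o' v, o ≠ o' → (r o').proj.toFun x ((r o).incl.toFun x v) = 0)
    (htop : ⨆ o, LinearMap.range ((r o).incl.toFun x) = ⊤) (e : E.fiber x) :
    ∑ᶠ o, (r o).incl.toFun x ((r o).proj.toFun x e) = e := by
  have he : e ∈ ⨆ o, LinearMap.range ((r o).incl.toFun x) := htop ▸ Submodule.mem_top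
  have := Fintype.ofFinite ι
  simp only [finsum_eq_sum_of_fintype]
  induction he using Submodule.iSup_induction' with
  | zero => simp only [map_zero, Finset.sum_const_zero]
  | add e e' _ _ he he' => simp only [map_add, Finset.sum_add_distrib, he, he']
  | mem o e he =>
    obtain ⟨v, rfl⟩ := he
    rw [Finset.sum_eq_single o (fun o' _ ho' => by rw [hr o o' v ho'.symm, map_zero])
      fun ho => absurd (Finset.mem_univ o) ho, (r o).proj_incl]

end Retract

end Retract

section Translate

variable {G : Type w} [Group G] {X : Type u} [TopologicalSpace X] [MulAction G X]
  (E : GVect.{u, v} G X)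

/-- The isomorphism `E_{g⁻¹ x} ≃ E_x` given by the action of `g`. -/
def translate (g : G) (x : X) : E.fiber (g⁻¹ • x) ≃ₗ[ℂ] E.fiber x :=
  have mk_act_inv_act (v : E.fiber (g⁻¹ • x)) :
      E.tact g⁻¹ ⟨x, E.cast (smul_inv_smul g x) (E.act g (g⁻¹ • x) v)⟩ = ⟨g⁻¹ • x, v⟩ := by
    rw [E.mk_cast, ← tact_mk, ← tact_mul, inv_mul_cancel, tact_one]
  have mk_act_act_inv (v : E.fiber x) :
      (⟨x, E.cast (smul_inv_smul g x) (E.act g (g⁻¹ • x) (E.act g⁻¹ x v))⟩ : Tot E.fiber) =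
        ⟨x, v⟩ := by
    rw [E.mk_cast, ← tact_mk, ← tact_mk, ← tact_mul, mul_inv_cancel, tact_one]
  LinearEquiv.ofLinearMap ((E.cast (smul_inv_smul g x)).toLinearMap ∘ₗ E.act g (g⁻¹ • x))
    (E.act g⁻¹ x) (LinearMap.ext fun v => Tot.mk_inj (mk_act_act_inv v))
    (LinearMap.ext fun v => Tot.mk_inj (mk_act_inv_act v))

theorem mk_translate (g : G) (x : X) (v : E.fiber (g⁻¹ • x)) :
    (⟨x, E.translate g x v⟩ : Tot E.fiber) = E.tact g ⟨g⁻¹ • x, v⟩ :=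
  E.mk_cast _ _

theorem mk_act_inv_translate (g g' : G) (x : X) (v : E.fiber (g'⁻¹ • x)) :
    (⟨g⁻¹ • x, E.act g⁻¹ x (E.translate g' x v)⟩ : Tot E.fiber) =
      E.tact (g⁻¹ * g') ⟨g'⁻¹ • x, v⟩ := by
  rw [← tact_mk, mk_translate, tact_mul]

theorem act_inv_translate (g : G) (x : X) (v : E.fiber (g⁻¹ • x)) :
    E.act g⁻¹ x (E.translate g x v) = v :=
  (E.translate g x).symm_apply_apply v

theorem translate_act_inv (g : G) (x : X) (v : E.fiber x) :
    E.translate g x (E.act g⁻¹ x v) = v :=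
  (E.translate g x).apply_symm_apply v

variable {E} in
theorem Hom.act_inv_translate_eq_zero {S : Subgroup G} {F : GVect.{u, v} S X}
    (ψ : Hom (E.res S) F) {g g' : G} {x : X} {v : E.fiber (g'⁻¹ • x)}
    (h : ψ.toFun _ (E.act (g⁻¹ * g') (g'⁻¹ • x) v) = 0) :
    ψ.toFun (g⁻¹ • x) (E.act g⁻¹ x (E.translate g' x v)) = 0 := by
  change (ψ.map ⟨g⁻¹ • x, E.act g⁻¹ x (E.translate g' x v)⟩).vec = 0
  rw [mk_act_inv_translate]
  exact h

end Translate

theorem out_mul_cosetElt {G : Type v} [Group G] {S : Subgroup G} (g : G) (q : G ⧸ S) :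
    q.out * (cosetElt S g q : G) = g * (g⁻¹ • q).out := by
  simp only [cosetElt]
  group

section InducedFiber

variable {G : Type v} [Group G] [Finite G] {S : Subgroup G} {X : Type u} [TopologicalSpace X]
  [MulAction G X] [ContinuousConstSMul G X] (F : GVect.{u, v} S X)

/-- The component of an element of a fibre of `Ind F` at a coset. -/
noncomputable def indProj (q : G ⧸ S) (x : X) : F.ind.fiber x →ₗ[ℂ] F.fiber (q.out⁻¹ • x) :=
  (LinearMap.proj q : (∀ q : G ⧸ S, F.fiber (q.out⁻¹ • x)) →ₗ[ℂ] F.fiber (q.out⁻¹ • x))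

/-- The linear map into a fibre of `Ind F` with given components. -/
noncomputable def indPi {x : X} {M : Type*} [AddCommGroup M] [Module ℂ M]
    (φ : ∀ q : G ⧸ S, M →ₗ[ℂ] F.fiber (q.out⁻¹ • x)) : M →ₗ[ℂ] F.ind.fiber x :=
  LinearMap.pi φ

variable {F}

theorem ind_fiber_ext {x : X} {t t' : F.ind.fiber x}
    (h : ∀ q : G ⧸ S, F.indProj q x t = F.indProj q x t') : t = t' :=
  funext h

open Classical in
variable (F) in
/-- The inclusion of the summand of a fibre of `Ind F` at a coset. -/
noncomputable def indSingle (q : G ⧸ S) (x : X) : F.fiber (q.out⁻¹ • x) →ₗ[ℂ] F.ind.fiber x :=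
  LinearMap.single ℂ (fun q : G ⧸ S => F.fiber (q.out⁻¹ • x)) q

theorem indProj_indSingle (q : G ⧸ S) (x : X) (v : F.fiber (q.out⁻¹ • x)) :
    F.indProj q x (F.indSingle q x v) = v := by
  classical
  exact Pi.single_eq_same (M := fun q : G ⧸ S => F.fiber (q.out⁻¹ • x)) q v

theorem indProj_indSingle_of_ne {q q' : G ⧸ S} (h : q' ≠ q) (x : X) (v : F.fiber (q.out⁻¹ • x)) :
    F.indProj q' x (F.indSingle q x v) = 0 := by
  classical
  exact Pi.single_eq_of_ne (M := fun q : G ⧸ S => F.fiber (q.out⁻¹ • x)) h v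

theorem mk_indProj_act (g : G) (q : G ⧸ S) (x : X) (t : F.ind.fiber x) :
    (⟨q.out⁻¹ • g • x, F.indProj q (g • x) (F.ind.act g x t)⟩ : Tot F.fiber) =
      F.tact (cosetElt S g q) ⟨(g⁻¹ • q).out⁻¹ • x, F.indProj (g⁻¹ • q) x t⟩ :=
  F.mk_cast _ _

end InducedFiber

section Frobenius

variable {G : Type v} [Group G] [Finite G] {S S' : Subgroup G} {X : Type u} [TopologicalSpace X]
  [MulAction G X] [ContinuousConstSMul G X] {F : GVect.{u, v} S X} {F' : GVect.{u, v} S' X}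
  {E : GVect.{u, v} G X}

/-- The `G`-homomorphism `Ind F → E` corresponding to an `S`-homomorphism `F → E` by Frobenius
reciprocity. -/
noncomputable def indDesc (φ : Hom F (E.res S)) : Hom F.ind E where
  toFun x :=
    { toFun := fun t =>
        ∑ᶠ q : G ⧸ S, E.translate q.out x (φ.toFun (q.out⁻¹ • x) (F.indProj q x t))
      map_add' := fun t t' => by
        simp only [map_add, finsum_add_distrib (Set.toFinite _) (Set.toFinite _)]
      map_smul' := fun c t => by simp only [map_smul, smul_finsum, RingHom.id_apply] }
  continuous_toFun := by
    have := Fintype.ofFinite (G ⧸ S)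
    refine (E.continuous_sum F.ind.continuous_base Finset.univ fun q _ => ?_).congr fun p =>
      congrArg _ (finsum_eq_sum_of_fintype _).symm
    exact ((E.continuous_tact q.out).comp (φ.continuous_toFun.comp (F.continuous_indComp q))).congr
      fun p => (E.mk_translate q.out p.base _).symm
  map_act g x t := by
    refine Eq.trans ?_ ((E.act g x).toAddMonoidHom.map_finsum (Set.toFinite _)).symm
    refine Eq.trans (finsum_congr fun q => Tot.mk_inj ?_)
      (finsum_comp_equiv (MulAction.toPerm g⁻¹ : Equiv.Perm (G ⧸ S)))
    let p : Tot F.fiber := ⟨(g⁻¹ • q).out⁻¹ • x, F.indProj (g⁻¹ • q) x t⟩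
    calc _ = E.tact q.out (φ.map ⟨_, F.indProj q (g • x) (F.ind.act g x t)⟩) :=
          E.mk_translate _ _ _
      _ = E.tact q.out (E.tact (cosetElt S g q : G) (φ.map p)) := by
        rw [mk_indProj_act, φ.map_tact]
        rfl
      _ = E.tact g (E.tact (g⁻¹ • q).out (φ.map p)) := by
        rw [← tact_mul, out_mul_cosetElt, tact_mul]
      _ = _ := congrArg (E.tact g) (E.mk_translate _ _ _).symm

theorem indDesc_apply (φ : Hom F (E.res S)) (x : X) (t : F.ind.fiber x) :
    (indDesc φ).toFun x t =
      ∑ᶠ q : G ⧸ S, E.translate q.out x (φ.toFun (q.out⁻¹ • x) (F.indProj q x t)) := rfl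

theorem range_indDesc (φ : Hom F (E.res S)) (x : X) :
    LinearMap.range ((indDesc φ).toFun x) = ⨆ q : G ⧸ S,
      (LinearMap.range (φ.toFun (q.out⁻¹ • x))).map (E.translate q.out x).toLinearMap := by
  have := Fintype.ofFinite (G ⧸ S)
  refine le_antisymm ?_ (iSup_le fun q => ?_)
  · rintro _ ⟨t, rfl⟩
    rw [indDesc_apply, finsum_eq_sum_of_fintype]
    exact Submodule.sum_mem _ fun q _ => Submodule.mem_iSup_of_mem q
      (Submodule.mem_map_of_mem (LinearMap.mem_range_self _ _))
  · rintro _ ⟨_, ⟨v, rfl⟩, rfl⟩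
    refine ⟨F.indSingle q x v, ?_⟩
    rw [indDesc_apply, finsum_eq_single _ q, indProj_indSingle]
    · rfl
    · intro q' hq'
      rw [indProj_indSingle_of_ne hq', map_zero, map_zero]

/-- The `G`-homomorphism `E → Ind F` corresponding to an `S`-homomorphism `E → F` by Frobenius
reciprocity. -/
noncomputable def indLift (ψ : Hom (E.res S) F) : Hom E F.ind where
  toFun x := F.indPi fun q : G ⧸ S => ψ.toFun (q.out⁻¹ • x) ∘ₗ E.act q.out⁻¹ x
  continuous_toFun := ind_continuous_iff.2 ⟨E.continuous_base, fun q =>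
    ψ.continuous_toFun.comp (E.continuous_tact q.out⁻¹)⟩
  map_act g x e := ind_fiber_ext fun q => Tot.mk_inj <| by
    have cosetElt_mul_out_inv : cosetElt S g q * (g⁻¹ • q).out⁻¹ = q.out⁻¹ * g := by
      simp only [cosetElt, mul_inv_cancel_right]
    calc ψ.map (E.tact q.out⁻¹ (E.tact g ⟨x, e⟩))
        = ψ.map (E.tact (cosetElt S g q : G) (E.tact (g⁻¹ • q).out⁻¹ ⟨x, e⟩)) := by
          rw [← tact_mul, ← tact_mul, cosetElt_mul_out_inv]
      _ = F.tact (cosetElt S g q) (ψ.map (E.tact (g⁻¹ • q).out⁻¹ ⟨x, e⟩)) := ψ.map_tact _ _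
      _ = _ := (mk_indProj_act g q x (F.indPi (fun q : G ⧸ S =>
          ψ.toFun (q.out⁻¹ • x) ∘ₗ E.act q.out⁻¹ x) e)).symm

theorem indProj_indLift_indDesc (ψ : Hom (E.res S) F) (φ : Hom F' (E.res S')) (x : X)
    (t : F'.ind.fiber x) (q : G ⧸ S) :
    F.indProj q x ((indLift ψ).toFun x ((indDesc φ).toFun x t)) =
      ∑ᶠ q' : G ⧸ S', ψ.toFun (q.out⁻¹ • x)
        (E.act q.out⁻¹ x (E.translate q'.out x (φ.toFun (q'.out⁻¹ • x) (F'.indProj q' x t)))) :=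
  (ψ.toFun (q.out⁻¹ • x) ∘ₗ E.act q.out⁻¹ x).toAddMonoidHom.map_finsum (Set.toFinite _)

theorem indLift_indDesc_eq_zero {ψ : Hom (E.res S) F} {φ : Hom F' (E.res S')}
    (h : ∀ g x v, ψ.toFun (g • x) (E.act g x (φ.toFun x v)) = 0) (x : X)
    (t : F'.ind.fiber x) : (indLift ψ).toFun x ((indDesc φ).toFun x t) = 0 := by
  refine ind_fiber_ext fun q => ?_
  rw [indProj_indLift_indDesc, map_zero]
  exact finsum_eq_zero_of_forall_eq_zero fun q' => ψ.act_inv_translate_eq_zero (h _ _ _)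

/-- If the `G`-translates of an `S`-invariant summand `F` of `E` by elements outside `S` are
annihilated by the projection onto `F`, then the sum of all translates is a summand of `E`
isomorphic to `Ind F`. -/
noncomputable def Retract.ind (r : Retract F (E.res S))
    (h : ∀ g ∉ S, ∀ x v, r.proj.toFun (g • x) (E.act g x (r.incl.toFun x v)) = 0) :
    Retract F.ind E where
  incl := indDesc r.incl
  proj := indLift r.proj
  proj_incl x t := by
    refine ind_fiber_ext fun q => ?_
    rw [indProj_indLift_indDesc, finsum_eq_single _ q, act_inv_translate, r.proj_incl]
    intro q' hq
    refine r.proj.act_inv_translate_eq_zero (h _ (fun hS => hq ?_) _ _)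
    rw [← QuotientGroup.out_eq' q', ← QuotientGroup.out_eq' q]
    exact (QuotientGroup.eq.2 hS).symm

end Frobenius

section InducedSummand

variable {G : Type v} [Group G] {S : Subgroup G}

/-- The representative of the trivial coset chosen in the definition of `Ind`, which need not be
the unit. -/
noncomputable def outOne (S : Subgroup G) : S :=
  ⟨((1 : G) : G ⧸ S).out, by
    rw [← inv_inv ((1 : G) : G ⧸ S).out, S.inv_mem_iff, ← mul_one (_)⁻¹, ← QuotientGroup.eq]
    exact QuotientGroup.out_eq' _⟩

theorem inv_smul_one_coset (s : S) : (s : G)⁻¹ • ((1 : G) : G ⧸ S) = (1 : G) :=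
  MulAction.mem_stabilizer_iff.1 ((MulAction.stabilizer_quotient S).ge (s⁻¹).2)

variable [Finite G] {X : Type u} [TopologicalSpace X] [MulAction G X] [ContinuousConstSMul G X]
  (F : GVect.{u, v} S X)

/-- The inclusion `F → Ind F` of the summand at the trivial coset. -/
noncomputable def indInclFun (x : X) : F.fiber x →ₗ[ℂ] F.ind.fiber x :=
  F.indSingle ((1 : G) : G ⧸ S) x ∘ₗ F.act (outOne S)⁻¹ x

/-- The projection `Ind F → F` onto the summand at the trivial coset. -/
noncomputable def indProjFun (x : X) : F.ind.fiber x →ₗ[ℂ] F.fiber x :=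
  (F.translate (outOne S) x).toLinearMap ∘ₗ F.indProj ((1 : G) : G ⧸ S) x

theorem indProj_indInclFun_of_ne {q : G ⧸ S} (hq : q ≠ (1 : G)) (x : X) (v : F.fiber x) :
    F.indProj q x (F.indInclFun x v) = 0 :=
  indProj_indSingle_of_ne hq x _

theorem indProjFun_indInclFun (x : X) (v : F.fiber x) :
    F.indProjFun x (F.indInclFun x v) = v :=
  (congrArg (F.translate (outOne S) x) (indProj_indSingle _ x _)).trans
    (F.translate_act_inv (outOne S) x v)

theorem mk_indProjFun_act {g : G} {s : S} {q : G ⧸ S} (hq : g⁻¹ • ((1 : G) : G ⧸ S) = q)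
    (hs : (s : G) = g * q.out) (x : X) (t : F.ind.fiber x) :
    (⟨g • x, F.indProjFun (g • x) (F.ind.act g x t)⟩ : Tot F.fiber) =
      F.tact s ⟨q.out⁻¹ • x, F.indProj q x t⟩ := by
  subst hq
  have outOne_mul_cosetElt : outOne S * cosetElt S g (1 : G) = s :=
    Subtype.ext ((out_mul_cosetElt g _).trans hs.symm)
  calc _ = F.tact (outOne S) ⟨_, F.indProj (1 : G) (g • x) (F.ind.act g x t)⟩ :=
        F.mk_translate _ _ _
    _ = _ := by rw [mk_indProj_act, ← tact_mul, outOne_mul_cosetElt]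

theorem indProjFun_act_out_inv (q : G ⧸ S) (x : X) (t : F.ind.fiber x) :
    F.indProjFun (q.out⁻¹ • x) (F.ind.act q.out⁻¹ x t) = F.indProj q x t := by
  have out_smul_one : q.out⁻¹⁻¹ • ((1 : G) : G ⧸ S) = q := by
    rw [inv_inv, MulAction.Quotient.smul_coe, smul_eq_mul, mul_one, QuotientGroup.out_eq']
  refine Tot.mk_inj (F := F.fiber) ((F.mk_indProjFun_act (s := 1) out_smul_one ?_ x t).trans
    (F.tact_one _))
  rw [inv_mul_cancel, Subgroup.coe_one]

theorem indProjFun_act (s : S) (x : X) (t : F.ind.fiber x) :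
    F.indProjFun (s • x) (F.ind.act (s : G) x t) = F.act s x (F.indProjFun x t) := by
  apply Tot.mk_inj (F := F.fiber)
  calc _ = F.tact (s * outOne S) ⟨_, F.indProj (1 : G) x t⟩ :=
        F.mk_indProjFun_act (inv_smul_one_coset s) rfl x t
    _ = F.tact s ⟨x, F.indProjFun x t⟩ := by
        rw [tact_mul]
        exact congrArg (F.tact s) (F.mk_translate _ _ _).symm

theorem indInclFun_indProjFun {x : X} {t : F.ind.fiber x}
    (ht : ∀ q : G ⧸ S, q ≠ (1 : G) → F.indProj q x t = 0) :
    F.indInclFun x (F.indProjFun x t) = t := by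
  refine ind_fiber_ext fun q => ?_
  by_cases hq : q = (1 : G)
  · subst hq
    exact (indProj_indSingle _ x _).trans (F.act_inv_translate (outOne S) x _)
  · rw [indProj_indInclFun_of_ne F hq, ht q hq]

theorem indProj_act_indInclFun_of_ne (s : S) {q : G ⧸ S} (hq : q ≠ (1 : G)) (x : X)
    (v : F.fiber x) : F.indProj q (s • x) (F.ind.act (s : G) x (F.indInclFun x v)) = 0 := by
  have inv_smul_ne : (s : G)⁻¹ • q ≠ (1 : G) := by
    rw [← inv_smul_one_coset s]
    exact (MulAction.injective _).ne hq
  change (⟨_, F.indProj q ((s : G) • x) (F.ind.act (s : G) x (F.indInclFun x v))⟩ :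
    Tot F.fiber).vec = 0
  rw [mk_indProj_act, indProj_indInclFun_of_ne F inv_smul_ne]
  exact map_zero _

/-- The bundle `F` as a summand of `Ind F`. -/
noncomputable def indRetract : Retract F (F.ind.res S) where
  incl :=
    { toFun := F.indInclFun
      continuous_toFun := by
        refine ind_continuous_iff.2 ⟨F.continuous_base, fun q => ?_⟩
        by_cases hq : q = (1 : G)
        · subst hq
          exact (F.continuous_tact (outOne S)⁻¹).congr fun p =>
            congrArg (Tot.mk _) (indProj_indSingle _ p.base _).symm
        · exact (F.continuous_zero ((continuous_const_smul q.out⁻¹).comp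
            F.continuous_base)).congr fun p =>
              congrArg (Tot.mk _) (F.indProj_indInclFun_of_ne hq p.base p.vec).symm
      map_act := fun s x v => by
        have := F.indInclFun_indProjFun (x := s • x) (t := F.ind.act (s : G) x (F.indInclFun x v))
          fun q hq => F.indProj_act_indInclFun_of_ne s hq x v
        rwa [indProjFun_act, indProjFun_indInclFun] at this }
  proj :=
    { toFun := F.indProjFun
      continuous_toFun := ((F.continuous_tact (outOne S)).comp
        (F.continuous_indComp ((1 : G) : G ⧸ S))).congr fun p => (F.mk_translate _ _ _).symm
      map_act := F.indProjFun_act }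
  proj_incl := F.indProjFun_indInclFun

end InducedSummand

end GVect

section IrrOrbit

variable {G : Type v} [Group G] {A : Subgroup G} [A.Normal] {σ τ : IrrRep.{v} A}

theorem orbitOf_eq_orbitOf_iff : orbitOf σ = orbitOf τ ↔ ∃ g : G, g • Irr.mk τ = Irr.mk σ :=
  Quotient.eq (r := MulAction.orbitRel G (Irr.{v} A))

theorem orbitOf_eq_orbitOf_iff_exists_out :
    orbitOf σ = orbitOf τ ↔ ∃ q : G ⧸ τ.stab, q.out • Irr.mk τ = Irr.mk σ := by
  refine orbitOf_eq_orbitOf_iff.trans ⟨fun ⟨g, hg⟩ => ⟨g, ?_⟩, fun ⟨q, hq⟩ => ⟨_, hq⟩⟩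
  obtain ⟨s, hs⟩ := QuotientGroup.mk_out_eq_mul τ.stab g
  rw [hs, mul_smul, MulAction.mem_stabilizer_iff.1 s.2, hg]

end IrrOrbit

namespace GVect

section Evaluation

variable {A : Type*} [Group A] {H : Type w} [Group H] {i : A →* H} {X : Type u}
  [TopologicalSpace X] [MulAction H X] [ActsTrivially i X] {E : GVect.{u, v} H X}

theorem cast_mem_range_ev {σ : IrrRep.{v} A} {x y : X} (h : x = y) {e : E.fiber x}
    (he : e ∈ LinearMap.range (E.ev i σ x)) :
    E.cast h e ∈ LinearMap.range (E.ev i σ y) := by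
  subst h
  exact he

variable [Finite A]

theorem continuous_ev_evRetr (τ : IrrRep.{v} A) :
    Continuous fun p : Tot E.fiber => (⟨p.base, E.ev i τ p.base
      (evRetr τ (E.fiberRep i p.base) p.vec)⟩ : Tot E.fiber) := by
  have := Fintype.ofFinite A
  have continuous_sum := E.continuous_sum (s := fun (a : A) (p : Tot E.fiber) =>
      isotypicCoeff τ a • E.fiberRep i p.base a p.vec) E.continuous_base Finset.univ
    fun a _ => E.continuous_smul
      ((E.continuous_tact (i a)).congr fun p => (E.mk_fiberRep i _ a _).symm) _
  exact continuous_sum.congr fun p => congrArg (Tot.mk _)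
    ((evRep_evRetr τ _ p.vec).trans (finsum_eq_sum_of_fintype _)).symm

theorem IsIsotypic.eq_zero_of_mem_range_ev {σ τ : IrrRep.{v} A} (hE : E.IsIsotypic i τ)
    (h : Irr.mk σ ≠ Irr.mk τ) {x : X} {e : E.fiber x}
    (he : e ∈ LinearMap.range (E.ev i σ x)) : e = 0 := by
  obtain ⟨t, rfl⟩ := (hE x).2 e
  have evRetr_eq_zero : evRetr τ (E.fiberRep i x) (E.ev i τ x t) = 0 :=
    evRetr_eq_zero_of_mem_range h.symm he
  rw [← evRetr_evRep τ (E.fiberRep i x) t]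
  exact (congrArg _ evRetr_eq_zero).trans (map_zero _)

variable (i E) in
theorem bijective_toModule_ev [DecidableEq (Irr.{v} A)] (x : X) :
    Function.Bijective (DirectSum.toModule ℂ (Irr.{v} A) (E.fiber x)
      fun t => E.ev i (Quotient.out t) x) :=
  have := E.finiteDimensional_fiber x
  bijective_toModule_evRep (σ := E.fiberRep i x)

end Evaluation

section IsotypicSummand

variable {G : Type w} [Group G] {A : Subgroup G} [A.Normal] {X : Type u} [TopologicalSpace X]
  [MulAction G X] [ActsTrivially A.subtype X] {E : GVect.{u, v} G X}

theorem act_mem_range_ev {σ : IrrRep.{v} A} {x : X} {e : E.fiber x}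
    (he : e ∈ LinearMap.range (E.ev A.subtype σ x)) (g : G) :
    E.act g x e ∈ LinearMap.range (E.ev A.subtype (σ.conj g) (g • x)) :=
  map_range_evRep_le_conj g (E.act g x) (E.act_fiberRep g x) (Submodule.mem_map_of_mem he)

theorem map_translate_range_ev (σ : IrrRep.{v} A) (g : G) (x : X) :
    (LinearMap.range (E.ev A.subtype σ (g⁻¹ • x))).map (E.translate g x).toLinearMap =
      LinearMap.range (E.ev A.subtype (σ.conj g) x) := by
  refine le_antisymm ?_ fun e he => ?_
  · rintro _ ⟨v, hv, rfl⟩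
    exact cast_mem_range_ev _ (act_mem_range_ev hv g)
  · refine ⟨E.act g⁻¹ x e, ?_, E.translate_act_inv g x e⟩
    exact range_evRep_le_of_mk_eq (inv_smul_smul g (Irr.mk σ)) (act_mem_range_ev he g⁻¹)

variable [Finite G]

theorem evRetr_act_of_mem_stab (τ : IrrRep.{v} A) (h : τ.stab) (x : X) (e : E.fiber x) :
    evRetr τ (E.fiberRep A.subtype ((h : G) • x)) (E.act (h : G) x e) =
      E.star τ h x (evRetr τ (E.fiberRep A.subtype x) e) := by
  have := E.finiteDimensional_fiber x
  refine LinearMap.congr_fun (f := evRetr τ (E.fiberRep A.subtype _) ∘ₗ E.act (h : G) x)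
    (g := E.star τ h x ∘ₗ evRetr τ (E.fiberRep A.subtype x))
    (linearMap_ext_of_eqOn_range_evRep (σ := E.fiberRep A.subtype x) fun σ e he => ?_) e
  change evRetr τ _ (E.act (h : G) x e) = E.star τ h x (evRetr τ _ e)
  by_cases hσ : Irr.mk τ = Irr.mk σ
  · obtain ⟨t, rfl⟩ := range_evRep_le_of_mk_eq hσ.symm he
    rw [evRetr_evRep]
    exact (congrArg _ (E.ev_star τ h x t).symm).trans (evRetr_evRep τ _ _)
  · have mk_ne_smul : Irr.mk τ ≠ Irr.mk (σ.conj (h : G)) := fun hτ =>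
      hσ (smul_left_cancel (h : G) ((MulAction.mem_stabilizer_iff.1 h.2).trans hτ))
    rw [evRetr_eq_zero_of_mem_range hσ he, map_zero,
      evRetr_eq_zero_of_mem_range mk_ne_smul (act_mem_range_ev he (h : G))]

variable (E) in
/-- The bundle `V_τ ⊗ Hom_A(V_τ, E)` as a summand of `E`, included by evaluation. -/
noncomputable def isotypicRetract (τ : IrrRep.{v} A) : Retract (E.isotypic τ) (E.res τ.stab) where
  incl :=
    { toFun := E.ev A.subtype τ
      continuous_toFun := (E.isoVB_isInducing A.subtype τ).continuous
      map_act := E.ev_star τ }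
  proj :=
    { toFun := fun x => evRetr τ (E.fiberRep A.subtype x)
      continuous_toFun := (E.isoVB_isInducing A.subtype τ).continuous_iff.2
        (continuous_ev_evRetr (i := A.subtype) τ)
      map_act := evRetr_act_of_mem_stab τ }
  proj_incl x := evRetr_evRep τ (E.fiberRep A.subtype x)

theorem isotypicRetract_proj_act_incl {τ τ' : IrrRep.{v} A} {g : G}
    (h : Irr.mk τ' ≠ g • Irr.mk τ) (x : X) (t : (E.isotypic τ).fiber x) :
    (E.isotypicRetract τ').proj.toFun (g • x)
      (E.act g x ((E.isotypicRetract τ).incl.toFun x t)) = 0 :=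
  evRetr_eq_zero_of_mem_range (τ' := τ.conj g) h (act_mem_range_ev ⟨t, rfl⟩ g)

end IsotypicSummand

section OrbitSummand

variable {G : Type v} [Group G] [Finite G] {A : Subgroup G} [A.Normal] {X : Type u}
  [TopologicalSpace X] [MulAction G X] [ContinuousConstSMul G X] [ActsTrivially A.subtype X]
  {E : GVect.{u, v} G X}

variable (E) in
/-- The summand of `E` belonging to the orbit of `τ`, which is induced from the summand
`V_τ ⊗ Hom_A(V_τ, E)`. -/
noncomputable def orbitRetract (τ : IrrRep.{v} A) : Retract (E.isotypic τ).ind E :=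
  (E.isotypicRetract τ).ind fun _ hg => isotypicRetract_proj_act_incl fun h =>
    hg (MulAction.mem_stabilizer_iff.2 h.symm)

theorem orbitRetract_proj_incl_of_ne {τ τ' : IrrRep.{v} A} (h : orbitOf τ' ≠ orbitOf τ) (x : X)
    (t : (E.isotypic τ).ind.fiber x) :
    (E.orbitRetract τ').proj.toFun x ((E.orbitRetract τ).incl.toFun x t) = 0 :=
  indLift_indDesc_eq_zero (fun g => isotypicRetract_proj_act_incl fun hg =>
    h (orbitOf_eq_orbitOf_iff.2 ⟨g, hg.symm⟩)) x t

theorem range_orbitRetract_incl (τ : IrrRep.{v} A) (x : X) :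
    LinearMap.range ((E.orbitRetract τ).incl.toFun x) =
      ⨆ σ : {σ : IrrRep.{v} A // orbitOf σ = orbitOf τ},
        LinearMap.range (E.ev A.subtype σ.1 x) := by
  have range_eq : LinearMap.range ((E.orbitRetract τ).incl.toFun x) =
      ⨆ q : G ⧸ τ.stab, LinearMap.range (E.ev A.subtype (τ.conj q.out) x) :=
    (range_indDesc _ x).trans (iSup_congr fun q => map_translate_range_ev τ q.out x)
  refine range_eq.trans (le_antisymm (iSup_le fun q => ?_) (iSup_le fun σ => ?_))
  · exact le_iSup_of_le (ι := {σ : IrrRep.{v} A // orbitOf σ = orbitOf τ})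
      ⟨τ.conj q.out, orbitOf_eq_orbitOf_iff.2 ⟨q.out, rfl⟩⟩ le_rfl
  · obtain ⟨q, hq⟩ := orbitOf_eq_orbitOf_iff_exists_out.1 σ.2
    exact le_iSup_of_le q (range_evRep_le_of_mk_eq hq.symm)

variable {τ : IrrOrbit A → IrrRep.{v} A}

theorem iSup_range_orbitRetract_incl (hτ : ∀ o, orbitOf (τ o) = o) (x : X) :
    ⨆ o, LinearMap.range ((E.orbitRetract (τ o)).incl.toFun x) = ⊤ := by
  have := E.finiteDimensional_fiber x
  refine eq_top_iff.2 ((iSup_range_evRep (E.fiberRep A.subtype x)).symm.trans_le ?_)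
  refine iSup_le fun t => le_iSup_of_le (orbitOf (Quotient.out t)) ?_
  rw [range_orbitRetract_incl]
  exact le_iSup_of_le (ι := {σ : IrrRep.{v} A // orbitOf σ = orbitOf (τ _)})
    ⟨Quotient.out t, (hτ _).symm⟩ le_rfl

theorem finsum_orbitRetract_incl_proj (hτ : ∀ o, orbitOf (τ o) = o) (x : X) (e : E.fiber x) :
    ∑ᶠ o, (E.orbitRetract (τ o)).incl.toFun x ((E.orbitRetract (τ o)).proj.toFun x e) = e := by
  refine Retract.finsum_incl_proj (r := fun o => E.orbitRetract (τ o)) (fun o o' v h => ?_)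
    (iSup_range_orbitRetract_incl hτ x) e
  exact orbitRetract_proj_incl_of_ne (by rwa [hτ, hτ, ne_comm]) x v

end OrbitSummand

section IsotypicInd

variable {G : Type v} [Group G] [Finite G] {A : Subgroup G} [A.Normal] {τ σ : IrrRep.{v} A}
  {X : Type u} [TopologicalSpace X] [MulAction G X] [ContinuousConstSMul G X]
  [ActsTrivially A.subtype X] {F : GVect.{u, v} τ.stab X}

theorem indProjFun_mem_range_ev {x : X} {t : F.ind.fiber x}
    (ht : t ∈ LinearMap.range (F.ind.ev A.subtype σ x)) :
    F.indProjFun x t ∈ LinearMap.range (F.ev τ.incl σ x) :=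
  map_range_evRep_le (F.indProjFun x) (F.indRetract.proj.map_fiberRep τ.incl x)
    (Submodule.mem_map_of_mem ht)

theorem indInclFun_mem_range_ev {x : X} {v : F.fiber x}
    (hv : v ∈ LinearMap.range (F.ev τ.incl σ x)) :
    F.indInclFun x v ∈ LinearMap.range (F.ind.ev A.subtype σ x) :=
  map_range_evRep_le (F.indInclFun x) (F.indRetract.incl.map_fiberRep τ.incl x)
    (Submodule.mem_map_of_mem hv)

theorem IsIsotypic.indProj_eq_zero (hF : F.IsIsotypic τ.incl τ) {q : G ⧸ τ.stab}
    (h : Irr.mk σ ≠ q.out • Irr.mk τ) {x : X} {t : F.ind.fiber x}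
    (ht : t ∈ LinearMap.range (F.ind.ev A.subtype σ x)) : F.indProj q x t = 0 := by
  rw [← indProjFun_act_out_inv]
  refine hF.eq_zero_of_mem_range_ev (σ := σ.conj q.out⁻¹) (fun h' => h ?_)
    (indProjFun_mem_range_ev (act_mem_range_ev ht q.out⁻¹))
  exact inv_smul_eq_iff.1 h'

theorem IsIsotypic.range_isotypicRetract_incl_ind (hF : F.IsIsotypic τ.incl τ) (x : X) :
    LinearMap.range ((F.ind.isotypicRetract τ).incl.toFun x) =
      LinearMap.range (F.indRetract.incl.toFun x) := by
  refine le_antisymm (fun t ht => ?_) ?_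
  · refine ⟨F.indProjFun x t, F.indInclFun_indProjFun fun q hq => hF.indProj_eq_zero ?_ ht⟩
    intro h
    have out_mem : q.out ∈ τ.stab := MulAction.mem_stabilizer_iff.2 h.symm
    refine hq ?_
    rw [← QuotientGroup.out_eq' q, QuotientGroup.eq, mul_one]
    exact inv_mem out_mem
  · rintro _ ⟨v, rfl⟩
    exact indInclFun_mem_range_ev ((hF x).2 v)

/-- A `(G_[τ], τ)`-equivariant bundle is the `τ`-isotypic part of the bundle it induces. -/
noncomputable def IsIsotypic.isotypicInd (hF : F.IsIsotypic τ.incl τ) :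
    Iso (F.ind.isotypic τ) F :=
  (F.ind.isotypicRetract τ).isoOfRangeEq F.indRetract hF.range_isotypicRetract_incl_ind

/-- The bundle induced from a `(G_[τ], τ)`-equivariant bundle has no isotypic part at a
representation outside the orbit of `τ`. -/
noncomputable def IsIsotypic.isotypicIndZero (hF : F.IsIsotypic τ.incl τ)
    (h : orbitOf σ ≠ orbitOf τ) : Iso (F.ind.isotypic σ) (GVect.zero.{u, v} σ.stab X) :=
  (F.ind.isotypicRetract σ).isoOfRangeEq (Retract.zero _) fun x => by
    have range_eq_bot : LinearMap.range (F.ind.ev A.subtype σ x) = ⊥ :=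
      (Submodule.eq_bot_iff _).2 fun t ht => ind_fiber_ext fun q => hF.indProj_eq_zero
        (fun h' => h (orbitOf_eq_orbitOf_iff.2 ⟨q.out, h'.symm⟩)) ht
    exact range_eq_bot.trans LinearMap.range_zero.symm

end IsotypicInd

end GVect

section Biproduct

variable {ι M : Type*} {N : ι → Type*} [DecidableEq ι] [AddCommMonoid M]
  [∀ i, AddCommMonoid (N i)] {p : ∀ i, M →+ N i} {j : ∀ i, N i →+ M}

theorem apply_toAddMonoid_of_biproduct (hpj : ∀ i y, p i (j i y) = y)
    (hne : ∀ i i' y, i' ≠ i → p i' (j i y) = 0) (t : DirectSum ι N) (i : ι) :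
    p i (DirectSum.toAddMonoid j t) = t i := by
  induction t using DirectSum.induction_on with
  | zero => simp only [map_zero, DirectSum.zero_apply]
  | add s t hs ht => rw [map_add, map_add, hs, ht, DirectSum.add_apply]
  | of i' y =>
    rw [DirectSum.toAddMonoid_of]
    obtain rfl | h := eq_or_ne i i'
    · rw [hpj, DirectSum.of_eq_same]
    · rw [hne i' i y h, DirectSum.of_eq_of_ne _ _ _ h]

variable [Finite ι]

theorem bijective_toAddMonoid_of_biproduct (hpj : ∀ i y, p i (j i y) = y)
    (hne : ∀ i i' y, i' ≠ i → p i' (j i y) = 0) (hsum : ∀ x, ∑ᶠ i, j i (p i x) = x) :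
    Function.Bijective (DirectSum.toAddMonoid j) := by
  refine ⟨fun s t h => DFinsupp.ext fun i => ?_, fun x => ?_⟩
  · rw [← apply_toAddMonoid_of_biproduct hpj hne s, h, apply_toAddMonoid_of_biproduct hpj hne]
  · have := Fintype.ofFinite ι
    refine ⟨∑ i, DirectSum.of N i (p i x), ?_⟩
    simp only [map_sum, DirectSum.toAddMonoid_of]
    exact (finsum_eq_sum_of_fintype _).symm.trans (hsum x)

/-- The isomorphism `M ≅ ⨁ i, N i` given by projections `p i` and injections `j i` that satisfy the
biproduct relations. -/
noncomputable def biproductEquiv (p : ∀ i, M →+ N i) (j : ∀ i, N i →+ M)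
    (hpj : ∀ i y, p i (j i y) = y) (hne : ∀ i i' y, i' ≠ i → p i' (j i y) = 0)
    (hsum : ∀ x, ∑ᶠ i, j i (p i x) = x) : M ≃+ DirectSum ι N :=
  (AddEquiv.ofBijective (DirectSum.toAddMonoid j)
    (bijective_toAddMonoid_of_biproduct hpj hne hsum)).symm

variable (hpj : ∀ i y, p i (j i y) = y) (hne : ∀ i i' y, i' ≠ i → p i' (j i y) = 0)
  (hsum : ∀ x, ∑ᶠ i, j i (p i x) = x)

theorem biproductEquiv_apply (x : M) (i : ι) : biproductEquiv p j hpj hne hsum x i = p i x := by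
  rw [← apply_toAddMonoid_of_biproduct hpj hne]
  exact congrArg (p i) ((biproductEquiv p j hpj hne hsum).symm_apply_apply x)

theorem biproductEquiv_symm_of (i : ι) (y : N i) :
    (biproductEquiv p j hpj hne hsum).symm (DirectSum.of N i y) = j i y :=
  DirectSum.toAddMonoid_of j i y

end Biproduct

section KDecomposition

variable {G : Type v} [Group G] [Finite G] {A : Subgroup G} [A.Normal]
  {X : Type u} [TopologicalSpace X] [MulAction G X] [ContinuousConstSMul G X]
  [ActsTrivially A.subtype X] {Y : Type u'} [TopologicalSpace Y] [MulAction G Y]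
  [ContinuousConstSMul G Y] [ActsTrivially A.subtype Y]

theorem psi_kInd (τ : IrrRep.{v} A) (η : KTau.{u, v} τ X) : psi τ (kInd τ η) = η := by
  refine DFunLike.congr_fun (f := (psi τ).comp (kInd τ)) (g := AddMonoidHom.id _)
    (groth_ext fun c => ?_) η
  simp only [AddMonoidHom.comp_apply, psi, kInd, grothMap_of, AddMonoidHom.id_apply]
  obtain ⟨_, F, hF, rfl⟩ := c
  exact congrArg _ (Subtype.ext (Vec.mk_eq hF.isotypicInd))

theorem psi_kInd_of_ne {σ τ : IrrRep.{v} A} (h : orbitOf σ ≠ orbitOf τ) (η : KTau.{u, v} τ X) :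
    psi σ (kInd τ η) = 0 := by
  refine DFunLike.congr_fun (f := (psi σ).comp (kInd τ)) (g := 0) (groth_ext fun c => ?_) η
  simp only [AddMonoidHom.comp_apply, psi, kInd, grothMap_of, AddMonoidHom.zero_apply]
  obtain ⟨_, F, hF, rfl⟩ := c
  exact (congrArg _ (Subtype.ext (Vec.mk_eq (hF.isotypicIndZero h)))).trans
    (map_zero (Algebra.GrothendieckAddGroup.of (M := VecTau.{u, v} σ X)))

theorem psin_kIndn (τ : IrrRep.{v} A) : ∀ (n : ℕ) (η : KTaun.{u, v} τ X n),
    psin τ n (kIndn τ n η) = η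
  | 0, η => psi_kInd τ η
  | n + 1, η => Subtype.ext (psi_kInd (X := Susp (n + 1) X) τ η.1)

theorem psin_kIndn_of_ne {σ τ : IrrRep.{v} A} (h : orbitOf σ ≠ orbitOf τ) :
    ∀ (n : ℕ) (η : KTaun.{u, v} τ X n), psin σ n (kIndn τ n η) = 0
  | 0, η => psi_kInd_of_ne h η
  | n + 1, η => Subtype.ext (psi_kInd_of_ne (X := Susp (n + 1) X) h η.1)

theorem psin_pullback (τ : IrrRep.{v} A) (f : GMap G Y X) : ∀ (n : ℕ) (ξ : KGn.{u, v} G X n),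
    psin τ n (KGn.pullback f n ξ) = KTaun.pullback τ f n (psin τ n ξ)
  | 0, ξ => psi_pullback τ f ξ
  | n + 1, ξ => Subtype.ext (psi_pullback τ (f.susp (n + 1)) ξ.1)

variable {τ : IrrOrbit A → IrrRep.{v} A}

theorem finsum_vecInd_vecPsi (hτ : ∀ o, orbitOf (τ o) = o) (c : Vec.{u, v} G X) :
    ∑ᶠ o, vecInd (τ o).stab (vecPsi (τ o) c).1 = c := by
  obtain ⟨E⟩ := c
  exact (GVect.Retract.mk_eq_finsum_mk (r := fun o => E.orbitRetract (τ o))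
    (fun o o' x v h => GVect.orbitRetract_proj_incl_of_ne (by rwa [hτ, hτ, ne_comm]) x v)
    (GVect.finsum_orbitRetract_incl_proj hτ)).symm

theorem finsum_kInd_psi (hτ : ∀ o, orbitOf (τ o) = o) (ξ : KG.{u, v} G X) :
    ∑ᶠ o, kInd (τ o) (psi (τ o) ξ) = ξ := by
  have := Fintype.ofFinite (IrrOrbit A)
  have sum_comp : ∑ o, (kInd (τ o)).comp (psi (τ o)) = AddMonoidHom.id (KG.{u, v} G X) :=
    groth_ext fun c => by
      simp only [AddMonoidHom.finsetSum_apply, AddMonoidHom.comp_apply, psi, kInd, grothMap_of,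
        AddMonoidHom.id_apply, ← map_sum]
      exact congrArg _ ((finsum_eq_sum_of_fintype _).symm.trans (finsum_vecInd_vecPsi hτ c))
  simpa only [finsum_eq_sum_of_fintype, AddMonoidHom.finsetSum_apply, AddMonoidHom.comp_apply,
    AddMonoidHom.id_apply] using DFunLike.congr_fun sum_comp ξ

theorem finsum_kIndn_psin (hτ : ∀ o, orbitOf (τ o) = o) : ∀ (n : ℕ) (ξ : KGn.{u, v} G X n),
    ∑ᶠ o, kIndn (τ o) n (psin (τ o) n ξ) = ξ
  | 0, ξ => finsum_kInd_psi hτ ξ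
  | n + 1, ξ => Subtype.ext <|
    (AddMonoidHom.map_finsum (KG.red.{u, v} G X (n + 1)).subtype (Set.toFinite _)).trans
      (finsum_kInd_psi (X := Susp (n + 1) X) hτ ξ.1)

variable [DecidableEq (IrrOrbit A)]

variable (X) in
/-- The decomposition of `K_G^n(X)` over the orbits of `G` on `Irr(A)`, with induction as its
inverse. -/
noncomputable def kDecomposition (hτ : ∀ o, orbitOf (τ o) = o) (n : ℕ) :
    KGn.{u, v} G X n ≃+ DirectSum (IrrOrbit A) fun o => KTaun.{u, v} (τ o) X n :=
  biproductEquiv (fun o => psin (τ o) n) (fun o => kIndn (τ o) n) (fun o => psin_kIndn (τ o) n)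
    (fun _ _ η h => psin_kIndn_of_ne (by rwa [hτ, hτ]) n η) (finsum_kIndn_psin hτ n)

theorem kDecomposition_apply (hτ : ∀ o, orbitOf (τ o) = o) (n : ℕ) (ξ : KGn.{u, v} G X n)
    (o : IrrOrbit A) : kDecomposition X hτ n ξ o = psin (τ o) n ξ :=
  biproductEquiv_apply _ _ _ ξ o

theorem kDecomposition_symm_of (hτ : ∀ o, orbitOf (τ o) = o) (n : ℕ) (o : IrrOrbit A)
    (η : KTaun.{u, v} (τ o) X n) : (kDecomposition X hτ n).symm
      (DirectSum.of (fun o => KTaun.{u, v} (τ o) X n) o η) = kIndn (τ o) n η :=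
  biproductEquiv_symm_of (N := fun o => KTaun.{u, v} (τ o) X n) _ _ _ o η

end KDecomposition

end EqK

theorem mainTheorem2_general {G : Type v} [Group G] [Finite G] (A : Subgroup G) [A.Normal]
    [DecidableEq (EqK.Irr.{v} A)] [DecidableEq (EqK.IrrOrbit A)]
    (τ : EqK.IrrOrbit A → EqK.IrrRep.{v} A) (hτ : ∀ o, EqK.orbitOf (τ o) = o) :
    (∃ Ψ : ∀ (X : Type u) [TopologicalSpace X] [MulAction G X] [ContinuousConstSMul G X]
        [EqK.ActsTrivially A.subtype X] (n : ℕ),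
        EqK.KGn.{u, v} G X n ≃+ DirectSum (EqK.IrrOrbit A) fun o => EqK.KTaun.{u, v} (τ o) X n,
      (∀ (X : Type u) [TopologicalSpace X] [MulAction G X] [ContinuousConstSMul G X]
        [EqK.ActsTrivially A.subtype X] n ξ o, Ψ X n ξ o = EqK.psin (τ o) n ξ) ∧
      (∀ (X : Type u) [TopologicalSpace X] [MulAction G X] [ContinuousConstSMul G X]
        [EqK.ActsTrivially A.subtype X] (E : EqK.GVect.{u, v} G X) o, Ψ X 0 (EqK.KG.of E) o =
        EqK.KTau.of (τ o) (E.isotypic (τ o)) (E.isotypic_isIsotypic (τ o))) ∧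
      (∀ (X Y : Type u) [TopologicalSpace X] [MulAction G X] [ContinuousConstSMul G X]
        [EqK.ActsTrivially A.subtype X] [TopologicalSpace Y] [MulAction G Y]
        [ContinuousConstSMul G Y] [EqK.ActsTrivially A.subtype Y] (f : EqK.GMap G X Y) n ξ o,
        Ψ X n (EqK.KGn.pullback f n ξ) o = EqK.KTaun.pullback (τ o) f n (Ψ Y n ξ o)) ∧
      (∀ (X : Type u) [TopologicalSpace X] [MulAction G X] [ContinuousConstSMul G X]
        [EqK.ActsTrivially A.subtype X] n o η,
        (Ψ X n).symm (DirectSum.of (fun o => EqK.KTaun.{u, v} (τ o) X n) o η) =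
          EqK.kIndn (τ o) n η)) ∧
    ∀ (X : Type u) [TopologicalSpace X] [MulAction G X] [ContinuousConstSMul G X]
      [EqK.ActsTrivially A.subtype X] (E : EqK.GVect.{u, v} G X),
      (∀ x, Function.Bijective (DirectSum.toModule ℂ (EqK.Irr.{v} A) (E.fiber x)
        fun t => E.ev A.subtype (Quotient.out t) x)) ∧
      ∃ (P : EqK.IrrOrbit A → EqK.GVect.{u, v} G X) (j : ∀ o, EqK.GVect.Hom (P o) E)
        (p : ∀ o, EqK.GVect.Hom E (P o)),
        (∀ o x, LinearMap.range ((j o).toFun x) =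
          ⨆ σ : {σ : EqK.IrrRep.{v} A // EqK.orbitOf σ = o},
            LinearMap.range (E.ev A.subtype σ.1 x)) ∧
        (∀ o x v, (p o).toFun x ((j o).toFun x v) = v) ∧
        (∀ o o' x v, o ≠ o' → (p o').toFun x ((j o).toFun x v) = 0) ∧
        (∀ x v, ∑ᶠ o, (j o).toFun x ((p o).toFun x v) = v) := by
  refine ⟨⟨fun X _ _ _ _ n => EqK.kDecomposition X hτ n, ?degrees, ?bundles, ?naturality,
    ?inverse⟩, fun X _ _ _ _ E => ⟨E.bijective_toModule_ev A.subtype, ?orbits⟩⟩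
  case degrees => exact fun X _ _ _ _ => EqK.kDecomposition_apply hτ
  case bundles => exact fun X _ _ _ _ E o =>
    (EqK.kDecomposition_apply hτ 0 _ o).trans (EqK.psi_of (τ o) E)
  case naturality =>
    intro X Y _ _ _ _ _ _ _ _ f n ξ o
    rw [EqK.kDecomposition_apply, EqK.kDecomposition_apply, EqK.psin_pullback]
  case inverse => exact fun X _ _ _ _ => EqK.kDecomposition_symm_of hτ
  case orbits =>
    refine ⟨fun o => (E.isotypic (τ o)).ind, fun o => (E.orbitRetract (τ o)).incl,
      fun o => (E.orbitRetract (τ o)).proj, fun o x => ?_,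
      fun o => (E.orbitRetract (τ o)).proj_incl, fun o o' x v h => ?_,
      EqK.GVect.finsum_orbitRetract_incl_proj hτ⟩
    · rw [EqK.GVect.range_orbitRetract_incl, hτ]
    · exact EqK.GVect.orbitRetract_proj_incl_of_ne (by rwa [hτ, hτ, ne_comm]) x v

theorem mainTheorem2 {G : Type v} [Group G] [Finite G] (A : Subgroup G) [A.Normal]
    [DecidableEq (EqK.Irr.{v} A)] [DecidableEq (EqK.IrrOrbit A)]
    -- a choice of one representation `τ o` in each orbit `o` of `G` on `Irr(A)`
    (τ : EqK.IrrOrbit A → EqK.IrrRep.{v} A) (hτ : ∀ o, EqK.orbitOf (τ o) = o) :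
    (∃ Ψ : ∀ (X : EqK.TrivSpace.{u, v} A) (n : ℕ),
        EqK.KGn.{u, v} G X n ≃+ DirectSum (EqK.IrrOrbit A) fun o => EqK.KTaun.{u, v} (τ o) X n,
      -- the component of `Ψ` at `o` is induced by `E ↦ V_τ ⊗ Hom_A(V_τ, E)`
      (∀ X n ξ o, Ψ X n ξ o = EqK.psin (τ o) n ξ) ∧
      -- in degree zero, on the class of a bundle `E`
      (∀ (X : EqK.TrivSpace.{u, v} A) (E : EqK.GVect.{u, v} G X) o, Ψ X 0 (EqK.KG.of E) o =
        EqK.KTau.of (τ o) (E.isotypic (τ o)) (E.isotypic_isIsotypic (τ o))) ∧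
      -- functoriality on `G`-maps
      (∀ (X Y : EqK.TrivSpace.{u, v} A) (f : EqK.GMap G X Y) n ξ o,
        Ψ X n (EqK.KGn.pullback f n ξ) o = EqK.KTaun.pullback (τ o) f n (Ψ Y n ξ o)) ∧
      -- induction gives the inverse
      (∀ X n o η, (Ψ X n).symm (DirectSum.of (fun o => EqK.KTaun.{u, v} (τ o) X n) o η) =
        EqK.kIndn (τ o) n η)) ∧
    -- the isotypic decomposition of a `G`-vector bundle, grouped over the orbits
    ∀ (X : EqK.TrivSpace.{u, v} A) (E : EqK.GVect.{u, v} G X),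
      (∀ x, Function.Bijective (DirectSum.toModule ℂ (EqK.Irr.{v} A) (E.fiber x)
        fun t => E.ev A.subtype (Quotient.out t) x)) ∧
      ∃ (P : EqK.IrrOrbit A → EqK.GVect.{u, v} G X) (j : ∀ o, EqK.GVect.Hom (P o) E)
        (p : ∀ o, EqK.GVect.Hom E (P o)),
        (∀ o x, LinearMap.range ((j o).toFun x) =
          ⨆ σ : {σ : EqK.IrrRep.{v} A // EqK.orbitOf σ = o},
            LinearMap.range (E.ev A.subtype σ.1 x)) ∧
        (∀ o x v, (p o).toFun x ((j o).toFun x v) = v) ∧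
        (∀ o o' x v, o ≠ o' → (p o').toFun x ((j o).toFun x v) = 0) ∧
        (∀ x v, ∑ᶠ o, (j o).toFun x ((p o).toFun x v) = v) := by
  obtain ⟨⟨Ψ, hΨ, hof, hnat, hinv⟩, hiso⟩ := mainTheorem2_general A τ hτ
  exact ⟨⟨fun X n => Ψ X n, fun X => hΨ X, fun X => hof X, fun X Y => hnat X Y, fun X => hinv X⟩,
    fun X => hiso X⟩
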